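/- **Conventions.** For a category $\mathcal V$ let $\mathcal V^{\otimes}$ be the free symmetric monoidal category on $\mathcal V$, with inclusion $j:\mathcal V\to\mathcal V^\otimes$: its objects are (bracketed) words in objects of $\mathcal V$, and a morphism of words is a bijection between the positions of the letters together with, for each letter, a morphism of $\mathcal V$ to the corresponding letter. A functor $k$ from $\mathcal V$ to a symmetric monoidal category $\mathcal C$ extends, uniquely up to isomorphism, to a strong symmetric monoidal functor $k^\otimes:\mathcal V^\otimes\to\mathcal C$. The comma category $(\mathcal F\downarrow\mathcal F)$ of morphisms and commutative squares of a symmetric monoidal category $\mathcal F$ is symmetric monoidal under the pointwise tensor product. For isomorphisms $\sigma,\sigma'$ and $\phi'=\sigma'\circ\phi\circ\sigma^{-1}$ write $(\sigma\Downarrow\sigma'):\phi\to\phi'$ for the corresponding isomorphism of $(\mathcal F\downarrow\mathcal F)$. **Feynman categories.** A *Feynman category* is a triple $\mathfrak F=(\mathcal V,\mathcal F,\imath)$ of a groupoid $\mathcal V$, a symmetric monoidal category $\mathcal F$ and a functor $\imath:\mathcal V\to\mathcal F$ such that (i) $\imath^\otimes$ is an equivalence $\mathcal V^\otimes\simeq\mathrm{Iso}(\mathcal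 F)$; (ii) the inclusion of the groupoid $\mathrm{Iso}(\mathcal F\downarrow\mathcal V)$ of *basic* morphisms $X\to\imath(v)$ into $(\mathcal F\downarrow\mathcal F)$ induces an equivalence $\mathrm{Iso}(\mathcal F\downarrow\mathcal V)^\otimes\simeq\mathrm{Iso}(\mathcal F\downarrow\mathcal F)$; (iii) every slice $(\mathcal F\downarrow \imath(v))$, $v\in\mathcal V$, is essentially small. A morphism $(v,f):(\mathcal V,\mathcal F,\imath)\to(\mathcal V',\mathcal F',\imath')$ consists of a functor $v:\mathcal V\to\mathcal V'$ and a strong symmetric monoidal functor $f:\mathcal F\to\mathcal F'$ with $f\circ\imath=\imath'\circ v$. Write $\mathfrak F\simeq\mathfrak F'$ if there is a morphism $(v,f):\mathfrak F\to\mathfrak F'$ in which $v$ and $f$ are equivalences of categories. The *trivial* Feynman category is $\mathfrak F^{triv}=(\mathbf 1,\mathbf 1^\otimes,j)$, where $\mathbf 1$ is the category with one object and one morphism. **Plus construction.** Let $\mathfrak F^+=(\mathcal V^+,\mathcal F^+,\imath^+)$, where $\mathcal V^+=\mathrm{Iso}(\mathcal F\downarrow\mathcal V)$, the objects of $\mathcal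 F^+$ are the morphisms of $\mathcal F$ with the tensor product of $\mathcal F$, and $\imath^+$ is the evident functor. The morphisms of $\mathcal F^+$ are generated under composition and tensor product by the isomorphisms $(\sigma\Downarrow\sigma')$ of $(\mathcal F\downarrow\mathcal F)$ and, for a basic morphism $\phi_0$ and basic morphisms $\phi_1,\dots,\phi_n$ with $\phi_0$ and $\phi_1\otimes\dots\otimes\phi_n$ composable, morphisms $$\gamma(\phi_0;\phi_1,\dots,\phi_n):\ \phi_0\otimes\phi_1\otimes\dots\otimes\phi_n\longrightarrow\phi_0\circ(\phi_1\otimes\dots\otimes\phi_n),$$ subject to: the relations of a symmetric monoidal category, whose isomorphisms $(\sigma\Downarrow\sigma')$ compose and are tensored as in $(\mathcal F\downarrow\mathcal F)$, whose constraints are included; equivariance $$\gamma(\phi_0';\phi_1',\dots,\phi'_{n})\circ\big((\tau\Downarrow\sigma_0)\otimes(\sigma\Downarrow\tau)\big)=(\sigma\Downarrow\sigma_0)\circ\gamma(\phi_0;\phi_1,\dots,\phi_n)$$ whenever $\phi_0'\circ\tau=\sigma_0\circ\phi_0$ and $(\phi_1'\otimes\dots\otimes\phi_n')\circ\sigma=\tau\circ(\phi_1\otimes\dots\otimes\phi_n)$,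 with $\sigma,\tau,\sigma_0$ isomorphisms; associativity $$\gamma\big(\phi_0;\phi_1\circ a_1,\dots,\phi_n\circ a_n\big)\circ\big(\mathrm{id}\otimes\gamma(\phi_1;a_1)\otimes\dots\otimes\gamma(\phi_n;a_n)\big)=\gamma\big(\phi_0\circ(\phi_1\otimes\dots\otimes\phi_n);a_1,\dots,a_n\big)\circ\big(\gamma(\phi_0;\phi_1,\dots,\phi_n)\otimes\mathrm{id}\big)$$ up to symmetry constraints, where each $a_i$ is a tensor product of basic morphisms; and $\gamma(\phi_0;\ )$ is the unit constraint for $n=0$. **Gcp version.** $\mathfrak F^{+gcp}=(\mathcal V^+,\mathcal F^{+gcp},\imath^+)$ is obtained by adjoining to $\mathcal F^+$ morphisms $i_\sigma:\mathbb 1\to\sigma$ for all $\sigma\in\mathrm{Mor}(\mathcal V)$, subject to $(\sigma\Downarrow\sigma')\circ i_\tau=i_{\sigma'\circ\tau\circ\sigma^{-1}}$ and, up to unit constraints, $$\gamma(\phi_0;\sigma_1,\dots,\sigma_n)\circ(\mathrm{id}\otimes i_{\sigma_1}\otimes\dots\otimes i_{\sigma_n})=\big((\sigma_1\otimes\dots\otimes\sigma_n)^{-1}\Downarrow\mathrm{id}\big),\qquad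 \gamma(\sigma_0;\phi_1)\circ(i_{\sigma_0}\otimes\mathrm{id})=(\mathrm{id}\Downarrow\sigma_0).$$ **Noncommutative sets.** $\mathcal{NC}Set$ is the category whose objects are the finite sets and whose morphisms $S\to T$ are maps $f:S\to T$ with a linear order on each fiber $f^{-1}(t)$; the fibers of $g\circ f$ are ordered by $x<y$ if $f(x)<f(y)$ in a fiber of $g$, or $f(x)=f(y)$ and $x<y$ in a fiber of $f$. It is symmetric monoidal under disjoint union. $\mathcal{FS}^<$ is its subcategory of all finite sets and the morphisms whose underlying map is surjective. Let $\mathfrak{NC}Set=(\mathbf 1,\mathcal{NC}Set,\imath)$ and $\mathfrak{FS}^<=(\mathbf 1,\mathcal{FS}^<,\imath)$, where $\imath$ sends the object of $\mathbf 1$ to a one-element set. **Proposition.** $(\mathfrak F^{triv})^+$, $\mathfrak{FS}^<$, $(\mathfrak F^{triv})^{+gcp}$ and $\mathfrak{NC}Set$ are Feynman categories, and there are equivalences of Feynman categories $$(\mathfrak F^{triv})^+\simeq\mathfrak{FS}^<,\qquad(\mathfrak F^{triv})^{+gcp}\simeq\mathfrak{NC}Set.$$ -/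

import Mathlib

open CategoryTheory MonoidalCategory

universe v₁ v₂ v₃ v₄ u₁ u₂ u₃ u₄

/-! ### The free symmetric monoidal category on a category -/

/-- Bracketed words in the objects of `V`: the objects of the free symmetric monoidal category. -/
inductive FreeSym (V : Type u₁) : Type u₁
  | unit : FreeSym V
  | of (v : V) : FreeSym V
  | tensor (w w' : FreeSym V) : FreeSym V

namespace FreeSym

/-- The positions of the letters of a bracketed word. -/
def Pos {V : Type u₁} : FreeSym V → Type
  | unit => Empty
  | of _ => Unit
  | tensor w w' => Pos w ⊕ Pos w'

/-- The letter at a given position. -/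
def letter {V : Type u₁} : (w : FreeSym V) → w.Pos → V
  | unit, i => i.elim
  | of v, _ => v
  | tensor w w', i => Sum.elim (letter w) (letter w') i

theorem permIso_aux {V : Type u₁} {w w' : FreeSym V} (e : w.Pos ≃ w'.Pos)
    (h : ∀ i, w.letter i = w'.letter (e i)) (i : w'.Pos) :
    w'.letter i = w.letter (e.symm i) := by
  rw [h, e.apply_symm_apply]

variable {V : Type u₁} [Category.{v₁} V]

/-- A morphism of words is a bijection of the positions of the letters together with a morphism
of `V` for each letter. (By coherence these are the composites of letterwise morphisms of `V`,
associativity, unit and commutativity constraints.) -/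
structure Hom (w w' : FreeSym V) where
  perm : w.Pos ≃ w'.Pos
  app : ∀ i, w.letter i ⟶ w'.letter (perm i)

theorem Hom.ext' {w w' : FreeSym V} {f g : Hom w w'} (h : ∀ i, f.perm i = g.perm i)
    (h' : ∀ i, f.app i ≫ eqToHom (congrArg w'.letter (h i)) = g.app i) : f = g := by
  obtain ⟨p, a⟩ := f
  obtain ⟨q, b⟩ := g
  obtain rfl : p = q := Equiv.ext h
  congr
  funext i
  simpa using h' i

instance : Category (FreeSym V) where
  Hom := Hom
  id w := ⟨Equiv.refl _, fun _ => 𝟙 _⟩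
  comp f g := ⟨f.perm.trans g.perm, fun i => f.app i ≫ g.app (f.perm i)⟩
  id_comp f := Hom.ext' (fun _ => rfl) (fun i => by simp)
  comp_id f := Hom.ext' (fun _ => rfl) (fun i => by simp)
  assoc f g h := Hom.ext' (fun _ => rfl) (fun i => by simp)

theorem hom_ext {w w' : FreeSym V} {f g : w ⟶ w'} (h : ∀ i, f.perm i = g.perm i)
    (h' : ∀ i, f.app i ≫ eqToHom (congrArg w'.letter (h i)) = g.app i) : f = g :=
  Hom.ext' h h'

theorem eqToHom_comp₃ {a b c : V} (h₁ : a = b) (h₂ : b = c) (h₃ : c = a) :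
    (eqToHom h₁ ≫ eqToHom h₂) ≫ eqToHom h₃ = 𝟙 a := by simp

/-- The isomorphism which only moves letters. -/
def permIso {w w' : FreeSym V} (e : w.Pos ≃ w'.Pos) (h : ∀ i, w.letter i = w'.letter (e i)) :
    w ≅ w' where
  hom := ⟨e, fun i => eqToHom (h i)⟩
  inv := ⟨e.symm, fun i => eqToHom (permIso_aux e h i)⟩
  hom_inv_id := hom_ext (fun i => e.symm_apply_apply i) (fun i =>
    eqToHom_comp₃ (h i) (permIso_aux e h (e i)) _)
  inv_hom_id := hom_ext (fun i => e.apply_symm_apply i) (fun i =>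
    eqToHom_comp₃ (permIso_aux e h i) (h (e.symm i)) _)

/-- Juxtaposition of morphisms. -/
def tensorMap {a b c d : FreeSym V} (f : a ⟶ b) (g : c ⟶ d) : tensor a c ⟶ tensor b d where
  perm := Equiv.sumCongr f.perm g.perm
  app
    | Sum.inl i => f.app i
    | Sum.inr i => g.app i

instance : MonoidalCategoryStruct (FreeSym V) where
  tensorObj := tensor
  tensorHom := tensorMap
  whiskerLeft X _ _ f := tensorMap (𝟙 X) f
  whiskerRight f Y := tensorMap f (𝟙 Y)
  tensorUnit := unit
  associator X Y Z := permIso (Equiv.sumAssoc _ _ _) (by rintro ((i | i) | i) <;> rfl)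
  leftUnitor X := permIso (Equiv.emptySum Empty _) (by rintro (i | i); exacts [i.elim, rfl])
  rightUnitor X := permIso (Equiv.sumEmpty _ Empty) (by rintro (i | i); exacts [rfl, i.elim])

instance : MonoidalCategory (FreeSym V) where
  tensorHom_def f g := hom_ext (by rintro (i | i) <;> rfl) (by
    rintro (i | i)
    · change f.app i ≫ 𝟙 _ = f.app i ≫ 𝟙 _
      rfl
    · change g.app i ≫ 𝟙 _ = 𝟙 _ ≫ g.app i
      simp)
  id_tensorHom_id X Y := hom_ext (by rintro (i | i) <;> rfl) (by
    rintro (i | i) <;> exact Category.comp_id (𝟙 _))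
  tensorHom_comp_tensorHom f₁ f₂ g₁ g₂ := hom_ext (by rintro (i | i) <;> rfl) (by
    rintro (i | i) <;> exact Category.comp_id _)
  whiskerLeft_id X Y := hom_ext (by rintro (i | i) <;> rfl) (by
    rintro (i | i) <;> exact Category.comp_id (𝟙 _))
  id_whiskerRight X Y := hom_ext (by rintro (i | i) <;> rfl) (by
    rintro (i | i) <;> exact Category.comp_id (𝟙 _))
  associator_naturality f₁ f₂ f₃ := hom_ext (by rintro ((i | i) | i) <;> rfl) (by
    rintro ((i | i) | i)
    · change (f₁.app i ≫ 𝟙 _) ≫ 𝟙 _ = 𝟙 _ ≫ f₁.app i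
      simp
    · change (f₂.app i ≫ 𝟙 _) ≫ 𝟙 _ = 𝟙 _ ≫ f₂.app i
      simp
    · change (f₃.app i ≫ 𝟙 _) ≫ 𝟙 _ = 𝟙 _ ≫ f₃.app i
      simp)
  leftUnitor_naturality f := hom_ext (by rintro (i | i); exacts [i.elim, rfl]) (by
    rintro (i | i)
    · exact i.elim
    · change (f.app i ≫ 𝟙 _) ≫ 𝟙 _ = 𝟙 _ ≫ f.app i
      simp)
  rightUnitor_naturality f := hom_ext (by rintro (i | i); exacts [rfl, i.elim]) (by
    rintro (i | i)
    · change (f.app i ≫ 𝟙 _) ≫ 𝟙 _ = 𝟙 _ ≫ f.app i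
      simp
    · exact i.elim)
  pentagon W X Y Z := hom_ext (by rintro (((i | i) | i) | i) <;> rfl) (by
    rintro (((i | i) | i) | i)
    all_goals
      change (𝟙 _ ≫ 𝟙 _ ≫ 𝟙 _) ≫ 𝟙 _ = 𝟙 _ ≫ 𝟙 _
      simp)
  triangle X Y := hom_ext (by rintro ((i | i) | i); exacts [rfl, i.elim, rfl]) (by
    rintro ((i | i) | i)
    · change (𝟙 _ ≫ 𝟙 _) ≫ 𝟙 _ = 𝟙 _
      simp
    · exact i.elim
    · change (𝟙 _ ≫ 𝟙 _) ≫ 𝟙 _ = 𝟙 _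
      simp)

instance : SymmetricCategory (FreeSym V) where
  braiding X Y := permIso (Equiv.sumComm _ _) (by rintro (i | i) <;> rfl)
  braiding_naturality_right X _ _ f := hom_ext (by rintro (i | i) <;> rfl) (by
    rintro (i | i)
    · change (𝟙 _ ≫ 𝟙 _) ≫ 𝟙 _ = 𝟙 _ ≫ 𝟙 _
      simp
    · change (f.app i ≫ 𝟙 _) ≫ 𝟙 _ = 𝟙 _ ≫ f.app i
      simp)
  braiding_naturality_left f Z := hom_ext (by rintro (i | i) <;> rfl) (by
    rintro (i | i)
    · change (f.app i ≫ 𝟙 _) ≫ 𝟙 _ = 𝟙 _ ≫ f.app i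
      simp
    · change (𝟙 _ ≫ 𝟙 _) ≫ 𝟙 _ = 𝟙 _ ≫ 𝟙 _
      simp)
  hexagon_forward X Y Z := hom_ext (by rintro ((i | i) | i) <;> rfl) (by
    rintro ((i | i) | i)
    all_goals
      change (𝟙 _ ≫ 𝟙 _ ≫ 𝟙 _) ≫ 𝟙 _ = 𝟙 _ ≫ 𝟙 _ ≫ 𝟙 _
      simp)
  hexagon_reverse X Y Z := hom_ext (by rintro (i | (i | i)) <;> rfl) (by
    rintro (i | (i | i))
    all_goals
      change (𝟙 _ ≫ 𝟙 _ ≫ 𝟙 _) ≫ 𝟙 _ = 𝟙 _ ≫ 𝟙 _ ≫ 𝟙 _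
      simp)
  symmetry X Y := hom_ext (by rintro (i | i) <;> rfl) (by
    rintro (i | i)
    all_goals
      change (𝟙 _ ≫ 𝟙 _) ≫ 𝟙 _ = 𝟙 _
      simp)

/-- The inclusion of `V` as one-letter words. -/
def incl (V : Type u₁) [Category.{v₁} V] : V ⥤ FreeSym V where
  obj := of
  map f := ⟨Equiv.refl _, fun _ => f⟩
  map_id _ := rfl
  map_comp _ _ := rfl

end FreeSym

instance {G : Type u₁} [Groupoid.{v₁} G] : Groupoid (FreeSym G) where
  inv {w w'} f := ⟨f.perm.symm, fun i =>
    eqToHom (by rw [f.perm.apply_symm_apply]) ≫ Groupoid.inv (f.app (f.perm.symm i))⟩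
  inv_comp {w w'} f := FreeSym.hom_ext (fun i => f.perm.apply_symm_apply i) (fun i => by
    change ((_ ≫ Groupoid.inv _) ≫ f.app _) ≫ eqToHom _ = 𝟙 _
    simp
    exact eqToHom_trans _ _)
  comp_inv {w w'} f := FreeSym.hom_ext (fun i => f.perm.symm_apply_apply i) (fun i => by
    change (f.app i ≫ eqToHom _ ≫ Groupoid.inv (f.app _)) ≫ eqToHom _ = 𝟙 _
    have key : ∀ (j : w.Pos) (hj : i = j) (h₁ : w'.letter (f.perm i) = w'.letter (f.perm j))
        (h₂ : w.letter j = w.letter i),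
        (f.app i ≫ eqToHom h₁ ≫ Groupoid.inv (f.app j)) ≫ eqToHom h₂ = 𝟙 _ := by
      rintro j rfl _ _
      simp
    exact key _ (f.perm.symm_apply_apply i).symm _ _)

/-! ### The category of arrows `(F ↓ F)` with the pointwise tensor product -/

section ArrowCat

variable (C : Type u₂) [Category.{v₂} C]

/-- The category `(C ↓ C)` of morphisms of `C` and commutative squares. -/
abbrev Mor := Comma (𝟭 C) (𝟭 C)

variable {C}

/-- A morphism of `C` as an object of `(C ↓ C)`. -/
abbrev Mor.mk {X Y : C} (φ : X ⟶ Y) : Mor C := Comma.mk (L := 𝟭 C) (R := 𝟭 C) X Y φ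

/-- The isomorphism `(σ ⇓ σ') : φ ⟶ φ'` for `σ' ∘ φ = φ' ∘ σ`. -/
abbrev Mor.sd {X Y X' Y' : C} {φ : X ⟶ Y} {φ' : X' ⟶ Y'} (σ : X ≅ X') (σ' : Y ≅ Y')
    (h : φ ≫ σ'.hom = σ.hom ≫ φ') : Mor.mk φ ≅ Mor.mk φ' :=
  Comma.isoMk (X := Mor.mk φ) (Y := Mor.mk φ') σ σ' h.symm

/-- Equal morphisms are isomorphic by identities. -/
abbrev Mor.ofEq {X Y : C} {φ φ' : X ⟶ Y} (h : φ = φ') : Mor.mk φ ≅ Mor.mk φ' :=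
  Mor.sd (Iso.refl X) (Iso.refl Y) (by simp [h])

variable [MonoidalCategory C]

instance : MonoidalCategoryStruct (Mor C) where
  tensorObj φ ψ := Mor.mk (φ.hom ⊗ₘ ψ.hom)
  tensorHom {φ φ' ψ ψ'} f g :=
    { left := f.left ⊗ₘ g.left
      right := f.right ⊗ₘ g.right
      w := by
        have h₁ : f.left ≫ φ'.hom = φ.hom ≫ f.right := f.w
        have h₂ : g.left ≫ ψ'.hom = ψ.hom ≫ g.right := g.w
        change (f.left ⊗ₘ g.left) ≫ (φ'.hom ⊗ₘ ψ'.hom) =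
          (φ.hom ⊗ₘ ψ.hom) ≫ (f.right ⊗ₘ g.right)
        rw [tensorHom_comp_tensorHom, tensorHom_comp_tensorHom, h₁, h₂] }
  whiskerLeft φ ψ ψ' g :=
    { left := φ.left ◁ g.left
      right := φ.right ◁ g.right
      w := by
        have h₂ : g.left ≫ ψ'.hom = ψ.hom ≫ g.right := g.w
        change (φ.left ◁ g.left) ≫ (φ.hom ⊗ₘ ψ'.hom) = (φ.hom ⊗ₘ ψ.hom) ≫ (φ.right ◁ g.right)
        rw [← id_tensorHom, ← id_tensorHom, tensorHom_comp_tensorHom, tensorHom_comp_tensorHom, h₂]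
        congr 1
        exact (Category.id_comp _).trans (Category.comp_id _).symm }
  whiskerRight {φ φ'} f ψ :=
    { left := f.left ▷ ψ.left
      right := f.right ▷ ψ.right
      w := by
        have h₁ : f.left ≫ φ'.hom = φ.hom ≫ f.right := f.w
        change (f.left ▷ ψ.left) ≫ (φ'.hom ⊗ₘ ψ.hom) = (φ.hom ⊗ₘ ψ.hom) ≫ (f.right ▷ ψ.right)
        rw [← tensorHom_id, ← tensorHom_id, tensorHom_comp_tensorHom, tensorHom_comp_tensorHom, h₁]
        congr 1
        exact (Category.id_comp _).trans (Category.comp_id _).symm }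
  tensorUnit := Mor.mk (𝟙 (𝟙_ C))
  associator φ ψ χ := Mor.sd (α_ φ.left ψ.left χ.left) (α_ φ.right ψ.right χ.right)
    (associator_naturality φ.hom ψ.hom χ.hom)
  leftUnitor φ := Mor.sd (φ' := φ.hom) (λ_ φ.left) (λ_ φ.right) (by simp)
  rightUnitor φ := Mor.sd (φ' := φ.hom) (ρ_ φ.left) (ρ_ φ.right) (by simp)

instance : MonoidalCategory (Mor C) where
  tensorHom_def _ _ := Comma.hom_ext _ _ (tensorHom_def _ _) (tensorHom_def _ _)
  id_tensorHom_id _ _ := Comma.hom_ext _ _ (id_tensorHom_id _ _) (id_tensorHom_id _ _)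
  tensorHom_comp_tensorHom _ _ _ _ := Comma.hom_ext _ _ (tensorHom_comp_tensorHom _ _ _ _) (tensorHom_comp_tensorHom _ _ _ _)
  whiskerLeft_id _ _ := Comma.hom_ext _ _ (MonoidalCategory.whiskerLeft_id _ _) (MonoidalCategory.whiskerLeft_id _ _)
  id_whiskerRight _ _ := Comma.hom_ext _ _ (MonoidalCategory.id_whiskerRight _ _) (MonoidalCategory.id_whiskerRight _ _)
  associator_naturality _ _ _ := Comma.hom_ext _ _ (associator_naturality _ _ _) (associator_naturality _ _ _)
  leftUnitor_naturality _ := Comma.hom_ext _ _ (leftUnitor_naturality _) (leftUnitor_naturality _)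
  rightUnitor_naturality _ := Comma.hom_ext _ _ (rightUnitor_naturality _) (rightUnitor_naturality _)
  pentagon _ _ _ _ := Comma.hom_ext _ _ (MonoidalCategory.pentagon _ _ _ _) (MonoidalCategory.pentagon _ _ _ _)
  triangle _ _ := Comma.hom_ext _ _ (MonoidalCategory.triangle _ _) (MonoidalCategory.triangle _ _)

end ArrowCat

instance {C : Type u₂} [Category.{v₂} C] [MonoidalCategory C] [SymmetricCategory C] :
    SymmetricCategory (Mor C) where
  braiding φ ψ := Mor.sd (β_ φ.left ψ.left) (β_ φ.right ψ.right)
    (BraidedCategory.braiding_naturality φ.hom ψ.hom)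
  braiding_naturality_right _ _ _ _ := Comma.hom_ext _ _ (BraidedCategory.braiding_naturality_right _ _) (BraidedCategory.braiding_naturality_right _ _)
  braiding_naturality_left _ _ := Comma.hom_ext _ _ (BraidedCategory.braiding_naturality_left _ _) (BraidedCategory.braiding_naturality_left _ _)
  hexagon_forward _ _ _ := Comma.hom_ext _ _ (BraidedCategory.hexagon_forward _ _ _) (BraidedCategory.hexagon_forward _ _ _)
  hexagon_reverse _ _ _ := Comma.hom_ext _ _ (BraidedCategory.hexagon_reverse _ _ _) (BraidedCategory.hexagon_reverse _ _ _)
  symmetry _ _ := Comma.hom_ext _ _ (SymmetricCategory.symmetry _ _) (SymmetricCategory.symmetry _ _)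

/-! ### Feynman categories -/

/-- A triple `(V, F, ι)` of a groupoid `V`, a symmetric monoidal category `F`, and a functor
`ι : V ⥤ F`. -/
structure FeynmanTriple where
  V : Type u₁
  F : Type u₂
  [groupoidV : Groupoid.{v₁} V]
  [categoryF : Category.{v₂} F]
  [monoidalF : MonoidalCategory F]
  [symmetricF : SymmetricCategory F]
  ι : V ⥤ F

attribute [instance] FeynmanTriple.groupoidV FeynmanTriple.categoryF FeynmanTriple.monoidalF
  FeynmanTriple.symmetricF

/-- The symmetric monoidal extension of `k : G ⥤ C` to the free symmetric monoidal category
`FreeSym G` (which is unique up to isomorphism) is an equivalence from `FreeSym G` to the groupoid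
of all isomorphisms of `C`. -/
def FreelyGeneratesIsos {G : Type u₁} [Groupoid.{v₁} G] {C : Type u₂} [Category.{v₂} C]
    [MonoidalCategory C] [SymmetricCategory C] (k : G ⥤ C) : Prop :=
  ∃ (E : FreeSym G ⥤ C) (_ : E.Braided),
    Nonempty (FreeSym.incl G ⋙ E ≅ k) ∧ (Core.functorToCore E).IsEquivalence

namespace FeynmanTriple

variable (𝔉 : FeynmanTriple.{v₁, v₂, u₁, u₂})

/-- The category `(F ↓ V)` of basic morphisms `X ⟶ ι v`. -/
abbrev Basic := Comma (𝟭 𝔉.F) 𝔉.ι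

/-- The functor `Iso(F ↓ V) ⥤ (F ↓ F)`. -/
def basicToMor : Core 𝔉.Basic ⥤ Mor 𝔉.F where
  obj φ := Mor.mk φ.of.hom
  map f := { left := f.iso.hom.left, right := 𝔉.ι.map f.iso.hom.right, w := f.iso.hom.w }

/-- The axioms of a Feynman category. -/
structure IsFeynman : Prop where
  /-- `V^⊗ ≃ Iso(F)` -/
  objects : FreelyGeneratesIsos 𝔉.ι
  /-- `Iso(F ↓ V)^⊗ ≃ Iso(F ↓ F)` -/
  morphisms : FreelyGeneratesIsos 𝔉.basicToMor
  slices : ∀ v : 𝔉.V, EssentiallySmall.{v₂} (Over (𝔉.ι.obj v))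

/-- A morphism `(v, f) : (V, F, ι) ⟶ (V', F', ι')`: a functor `v` and a strong symmetric monoidal
functor `f` with `f ∘ ι = ι' ∘ v`. -/
structure Hom (𝔉 : FeynmanTriple.{v₁, v₂, u₁, u₂}) (𝔊 : FeynmanTriple.{v₃, v₄, u₃, u₄}) where
  v : 𝔉.V ⥤ 𝔊.V
  f : 𝔉.F ⥤ 𝔊.F
  braided : f.Braided
  comm : 𝔉.ι ⋙ f = v ⋙ 𝔊.ι

/-- There is a morphism of triples both of whose components are equivalences of categories. -/
def Equivalent (𝔉 : FeynmanTriple.{v₁, v₂, u₁, u₂}) (𝔊 : FeynmanTriple.{v₃, v₄, u₃, u₄}) : Prop :=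
  ∃ h : Hom 𝔉 𝔊, h.v.IsEquivalence ∧ h.f.IsEquivalence

/-! ### The plus construction and its gcp version -/

/-- `a` is a tensor product `φ₁ ⊗ ⋯ ⊗ φₙ` of `n ≥ 0` basic morphisms (with some bracketing). -/
inductive IsTensor : ∀ {X Y : 𝔉.F}, (X ⟶ Y) → Prop
  | unit : IsTensor (𝟙 (𝟙_ 𝔉.F))
  | basic {X : 𝔉.F} {v : 𝔉.V} (φ : X ⟶ 𝔉.ι.obj v) : IsTensor φ
  | tensor {X Y X' Y' : 𝔉.F} {a : X ⟶ Y} {a' : X' ⟶ Y'} :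
      IsTensor a → IsTensor a' → IsTensor (a ⊗ₘ a')

/-- Formal composites and tensor products of
* the isomorphisms `(σ ⇓ σ')` of `(F ↓ F)`,
* the generators `γ(φ₀; φ₁, …, φₙ) : φ₀ ⊗ φ₁ ⊗ ⋯ ⊗ φₙ ⟶ φ₀ ∘ (φ₁ ⊗ ⋯ ⊗ φₙ)` for basic `φᵢ`,
* in the gcp version, the generators `i_σ : 𝟙 ⟶ σ` for the morphisms `σ` of `V`.
The flag `gcp` says whether the last ones are present. -/
inductive PlusPre (gcp : Prop) : Mor 𝔉.F → Mor 𝔉.F → Type (max u₁ u₂ v₁ v₂)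
  | iso {φ ψ : Mor 𝔉.F} (e : φ ≅ ψ) : PlusPre gcp φ ψ
  | comp {φ ψ χ : Mor 𝔉.F} (s : PlusPre gcp φ ψ) (t : PlusPre gcp ψ χ) : PlusPre gcp φ χ
  | tensor {φ ψ φ' ψ' : Mor 𝔉.F} (s : PlusPre gcp φ ψ) (t : PlusPre gcp φ' ψ') :
      PlusPre gcp (φ ⊗ φ') (ψ ⊗ ψ')
  | gamma {X Y : 𝔉.F} {v : 𝔉.V} (φ₀ : Y ⟶ 𝔉.ι.obj v) (a : X ⟶ Y) (ha : 𝔉.IsTensor a) :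
      PlusPre gcp (Mor.mk φ₀ ⊗ Mor.mk a) (Mor.mk (a ≫ φ₀))
  | point (h : gcp) {v w : 𝔉.V} (σ : v ⟶ w) : PlusPre gcp (𝟙_ (Mor 𝔉.F)) (Mor.mk (𝔉.ι.map σ))

end FeynmanTriple

/-- The shuffle `(φ₀ ⊗ φ₁) ⊗ (ψ₀ ⊗ ψ₁) ≅ (φ₀ ⊗ ψ₀) ⊗ (φ₁ ⊗ ψ₁)`. -/
def shuffleIso {C : Type u₁} [Category.{v₁} C] [MonoidalCategory C] [SymmetricCategory C]
    (φ₀ φ₁ ψ₀ ψ₁ : C) : (φ₀ ⊗ φ₁) ⊗ (ψ₀ ⊗ ψ₁) ≅ (φ₀ ⊗ ψ₀) ⊗ (φ₁ ⊗ ψ₁) where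
  hom := tensorμ φ₀ φ₁ ψ₀ ψ₁
  inv := tensorδ φ₀ φ₁ ψ₀ ψ₁

namespace FeynmanTriple

variable (𝔉 : FeynmanTriple.{v₁, v₂, u₁, u₂}) (gcp : Prop)

/-- `IsParallel b a t` says that `b = φ₁ ⊗ ⋯ ⊗ φₙ` and `a = a₁ ⊗ ⋯ ⊗ aₙ` where `φᵢ` is basic and
`aᵢ` is a tensor product of basic morphisms, and that `t : b ⊗ a ⟶ b ∘ a` is the tensor product
of the morphisms `γ(φᵢ; aᵢ) : φᵢ ⊗ aᵢ ⟶ φᵢ ∘ aᵢ` up to shuffling the factors. -/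
inductive IsParallel : ∀ {X Y Z : 𝔉.F} (b : Y ⟶ Z) (a : X ⟶ Y),
    𝔉.PlusPre gcp (Mor.mk b ⊗ Mor.mk a) (Mor.mk (a ≫ b)) → Prop
  | unit : IsParallel (𝟙 (𝟙_ 𝔉.F)) (𝟙 (𝟙_ 𝔉.F))
      (.iso (Mor.sd (λ_ (𝟙_ 𝔉.F)) (λ_ (𝟙_ 𝔉.F)) (by simp)))
  | basic {X Y : 𝔉.F} {v : 𝔉.V} (φ : Y ⟶ 𝔉.ι.obj v) (a : X ⟶ Y) (ha : 𝔉.IsTensor a) :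
      IsParallel φ a (.gamma φ a ha)
  | tensor {X Y Z X' Y' Z' : 𝔉.F} {b : Y ⟶ Z} {a : X ⟶ Y} {b' : Y' ⟶ Z'} {a' : X' ⟶ Y'}
      {t : 𝔉.PlusPre gcp (Mor.mk b ⊗ Mor.mk a) (Mor.mk (a ≫ b))}
      {t' : 𝔉.PlusPre gcp (Mor.mk b' ⊗ Mor.mk a') (Mor.mk (a' ≫ b'))} :
      IsParallel b a t → IsParallel b' a' t' →
      IsParallel (b ⊗ₘ b') (a ⊗ₘ a')
        (.comp (.iso (shuffleIso (Mor.mk b) (Mor.mk b') (Mor.mk a) (Mor.mk a')))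
          (.comp (.tensor t t') (.iso (Mor.ofEq (tensorHom_comp_tensorHom a a' b b').symm))))

/-- `IsPointing a t` says that `a = σ₁ ⊗ ⋯ ⊗ σₙ` for morphisms `σᵢ` of `V` and that
`t : 𝟙 ⟶ a` is `i_{σ₁} ⊗ ⋯ ⊗ i_{σₙ}` up to unit constraints. -/
inductive IsPointing : ∀ {X Y : 𝔉.F} (a : X ⟶ Y),
    𝔉.PlusPre gcp (𝟙_ (Mor 𝔉.F)) (Mor.mk a) → Prop
  | unit : IsPointing (𝟙 (𝟙_ 𝔉.F)) (.iso (Iso.refl (𝟙_ (Mor 𝔉.F))))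
  | basic (h : gcp) {v w : 𝔉.V} (σ : v ⟶ w) : IsPointing (𝔉.ι.map σ) (.point h σ)
  | tensor {X Y X' Y' : 𝔉.F} {a : X ⟶ Y} {a' : X' ⟶ Y'}
      {t : 𝔉.PlusPre gcp (𝟙_ (Mor 𝔉.F)) (Mor.mk a)}
      {t' : 𝔉.PlusPre gcp (𝟙_ (Mor 𝔉.F)) (Mor.mk a')} :
      IsPointing a t → IsPointing a' t' →
      IsPointing (a ⊗ₘ a') (.comp (.iso (λ_ (𝟙_ (Mor 𝔉.F))).symm) (.tensor t t'))

/-- The relations of the plus construction and of its gcp version. -/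
inductive PlusRel : ∀ {φ ψ : Mor 𝔉.F}, 𝔉.PlusPre gcp φ ψ → 𝔉.PlusPre gcp φ ψ → Prop
  /- congruence -/
  | refl {φ ψ : Mor 𝔉.F} (s : 𝔉.PlusPre gcp φ ψ) : PlusRel s s
  | symm {φ ψ : Mor 𝔉.F} {s t : 𝔉.PlusPre gcp φ ψ} : PlusRel s t → PlusRel t s
  | trans {φ ψ : Mor 𝔉.F} {s t u : 𝔉.PlusPre gcp φ ψ} :
      PlusRel s t → PlusRel t u → PlusRel s u
  | comp_congr {φ ψ χ : Mor 𝔉.F} {s s' : 𝔉.PlusPre gcp φ ψ} {t t' : 𝔉.PlusPre gcp ψ χ} :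
      PlusRel s s' → PlusRel t t' → PlusRel (.comp s t) (.comp s' t')
  | tensor_congr {φ ψ φ' ψ' : Mor 𝔉.F} {s s' : 𝔉.PlusPre gcp φ ψ} {t t' : 𝔉.PlusPre gcp φ' ψ'} :
      PlusRel s s' → PlusRel t t' → PlusRel (.tensor s t) (.tensor s' t')
  /- the relations of a symmetric monoidal category, whose constraints are those of `(F ↓ F)` -/
  | id_comp {φ ψ : Mor 𝔉.F} (s : 𝔉.PlusPre gcp φ ψ) : PlusRel (.comp (.iso (Iso.refl φ)) s) s
  | comp_id {φ ψ : Mor 𝔉.F} (s : 𝔉.PlusPre gcp φ ψ) : PlusRel (.comp s (.iso (Iso.refl ψ))) s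
  | assoc {φ ψ χ ω : Mor 𝔉.F} (s : 𝔉.PlusPre gcp φ ψ) (t : 𝔉.PlusPre gcp ψ χ)
      (u : 𝔉.PlusPre gcp χ ω) : PlusRel (.comp (.comp s t) u) (.comp s (.comp t u))
  | interchange {φ ψ χ φ' ψ' χ' : Mor 𝔉.F} (s : 𝔉.PlusPre gcp φ ψ) (t : 𝔉.PlusPre gcp ψ χ)
      (s' : 𝔉.PlusPre gcp φ' ψ') (t' : 𝔉.PlusPre gcp ψ' χ') :
      PlusRel (.comp (.tensor s s') (.tensor t t')) (.tensor (.comp s t) (.comp s' t'))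
  | associator_nat {φ₁ φ₂ φ₃ ψ₁ ψ₂ ψ₃ : Mor 𝔉.F} (s₁ : 𝔉.PlusPre gcp φ₁ ψ₁)
      (s₂ : 𝔉.PlusPre gcp φ₂ ψ₂) (s₃ : 𝔉.PlusPre gcp φ₃ ψ₃) :
      PlusRel (.comp (.tensor (.tensor s₁ s₂) s₃) (.iso (α_ ψ₁ ψ₂ ψ₃)))
        (.comp (.iso (α_ φ₁ φ₂ φ₃)) (.tensor s₁ (.tensor s₂ s₃)))
  | leftUnitor_nat {φ ψ : Mor 𝔉.F} (s : 𝔉.PlusPre gcp φ ψ) :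
      PlusRel (.comp (.tensor (.iso (Iso.refl (𝟙_ (Mor 𝔉.F)))) s) (.iso (λ_ ψ)))
        (.comp (.iso (λ_ φ)) s)
  | rightUnitor_nat {φ ψ : Mor 𝔉.F} (s : 𝔉.PlusPre gcp φ ψ) :
      PlusRel (.comp (.tensor s (.iso (Iso.refl (𝟙_ (Mor 𝔉.F))))) (.iso (ρ_ ψ)))
        (.comp (.iso (ρ_ φ)) s)
  | braiding_nat {φ ψ φ' ψ' : Mor 𝔉.F} (s : 𝔉.PlusPre gcp φ ψ) (s' : 𝔉.PlusPre gcp φ' ψ') :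
      PlusRel (.comp (.tensor s s') (.iso (β_ ψ ψ'))) (.comp (.iso (β_ φ φ')) (.tensor s' s))
  /- isomorphisms compose and are tensored as in `(F ↓ F)` -/
  | iso_comp {φ ψ χ : Mor 𝔉.F} (e : φ ≅ ψ) (e' : ψ ≅ χ) :
      PlusRel (.comp (.iso e) (.iso e')) (.iso (e ≪≫ e'))
  | iso_tensor {φ ψ φ' ψ' : Mor 𝔉.F} (e : φ ≅ ψ) (e' : φ' ≅ ψ') :
      PlusRel (.tensor (.iso e) (.iso e')) (.iso (e ⊗ᵢ e'))
  /- equivariance of `γ` -/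
  | gamma_equivariant {X Y X' Y' : 𝔉.F} {v v' : 𝔉.V} {φ₀ : Y ⟶ 𝔉.ι.obj v}
      {φ₀' : Y' ⟶ 𝔉.ι.obj v'} {a : X ⟶ Y} {a' : X' ⟶ Y'} (ha : 𝔉.IsTensor a)
      (ha' : 𝔉.IsTensor a') (σ : X ≅ X') (τ : Y ≅ Y') (σ₀ : 𝔉.ι.obj v ≅ 𝔉.ι.obj v')
      (h : a ≫ τ.hom = σ.hom ≫ a') (h₀ : φ₀ ≫ σ₀.hom = τ.hom ≫ φ₀') :
      PlusRel
        (.comp (.tensor (.iso (Mor.sd τ σ₀ h₀)) (.iso (Mor.sd σ τ h))) (.gamma φ₀' a' ha'))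
        (.comp (.gamma φ₀ a ha) (.iso (Mor.sd σ σ₀ (by rw [Category.assoc, h₀, reassoc_of% h]))))
  /- associativity of `γ`: for `b = φ₁ ⊗ ⋯ ⊗ φₙ` and `a = a₁ ⊗ ⋯ ⊗ aₙ`,
  `γ(φ₀; φ₁ ∘ a₁, …, φₙ ∘ aₙ) ∘ (id ⊗ γ(φ₁; a₁) ⊗ ⋯ ⊗ γ(φₙ; aₙ))` is
  `γ(φ₀ ∘ b; a) ∘ (γ(φ₀; b) ⊗ id)` -/
  | gamma_assoc {X Y Z : 𝔉.F} {v : 𝔉.V} (φ₀ : Z ⟶ 𝔉.ι.obj v) {b : Y ⟶ Z} {a : X ⟶ Y}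
      (ha : 𝔉.IsTensor a) (hb : 𝔉.IsTensor b) (hab : 𝔉.IsTensor (a ≫ b))
      {t : 𝔉.PlusPre gcp (Mor.mk b ⊗ Mor.mk a) (Mor.mk (a ≫ b))} (ht : 𝔉.IsParallel gcp b a t) :
      PlusRel
        (.comp (.tensor (.iso (Iso.refl (Mor.mk φ₀))) t) (.gamma φ₀ (a ≫ b) hab))
        (.comp (.iso (α_ (Mor.mk φ₀) (Mor.mk b) (Mor.mk a)).symm)
          (.comp (.tensor (.gamma φ₀ b hb) (.iso (Iso.refl (Mor.mk a))))
            (.comp (.gamma (b ≫ φ₀) a ha) (.iso (Mor.ofEq (Category.assoc a b φ₀).symm)))))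
  /- `γ(φ₀; )`, for `n = 0`, is trivial -/
  | gamma_nil {v : 𝔉.V} (φ₀ : 𝟙_ 𝔉.F ⟶ 𝔉.ι.obj v) :
      PlusRel (.gamma φ₀ (𝟙 (𝟙_ 𝔉.F)) .unit)
        (.iso (Mor.sd (ρ_ (𝟙_ 𝔉.F)) (ρ_ (𝔉.ι.obj v)) (by simp)))
  /- `(σ ⇓ σ') ∘ i_τ = i_{σ' ∘ τ ∘ σ⁻¹}` -/
  | point_equivariant (h : gcp) {v w v' w' : 𝔉.V} (τ : v ⟶ w) (σ : v ≅ v') (σ' : w ≅ w') :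
      PlusRel
        (.comp (.point h τ) (.iso (Mor.sd (φ' := 𝔉.ι.map (σ.inv ≫ τ ≫ σ'.hom))
          (𝔉.ι.mapIso σ) (𝔉.ι.mapIso σ') (by simp [← Functor.map_comp]))))
        (.point h (σ.inv ≫ τ ≫ σ'.hom))
  /- `γ(φ₀; σ₁, …, σₙ) ∘ (id ⊗ i_{σ₁} ⊗ ⋯ ⊗ i_{σₙ})` is
  `((σ₁ ⊗ ⋯ ⊗ σₙ)⁻¹ ⇓ id) : φ₀ ⟶ φ₀ ∘ (σ₁ ⊗ ⋯ ⊗ σₙ)` up to the unit constraint -/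
  | point_right (h : gcp) {X Y : 𝔉.F} {v : 𝔉.V} (φ₀ : Y ⟶ 𝔉.ι.obj v) (e : X ≅ Y)
      (he : 𝔉.IsTensor e.hom) {t : 𝔉.PlusPre gcp (𝟙_ (Mor 𝔉.F)) (Mor.mk e.hom)}
      (ht : 𝔉.IsPointing gcp e.hom t) :
      PlusRel
        (.comp (.iso (ρ_ (Mor.mk φ₀)).symm)
          (.comp (.tensor (.iso (Iso.refl (Mor.mk φ₀))) t) (.gamma φ₀ e.hom he)))
        (.iso (Mor.sd e.symm (Iso.refl _) (by simp)))
  /- `γ(σ₀; φ₁) ∘ (i_{σ₀} ⊗ id)` is `(id ⇓ σ₀) : φ₁ ⟶ σ₀ ∘ φ₁` up to the unit constraint -/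
  | point_left (h : gcp) {X : 𝔉.F} {v w : 𝔉.V} (σ₀ : v ≅ w) (φ₁ : X ⟶ 𝔉.ι.obj v) :
      PlusRel
        (.comp (.iso (λ_ (Mor.mk φ₁)).symm)
          (.comp (.tensor (.point h σ₀.hom) (.iso (Iso.refl (Mor.mk φ₁))))
            (.gamma (𝔉.ι.map σ₀.hom) φ₁ (.basic φ₁))))
        (.iso (Mor.sd (Iso.refl X) (𝔉.ι.mapIso σ₀) (by simp)))

/-- The category `F⁺` (for `gcp = False`) or `F⁺ᵍᶜᵖ` (for `gcp = True`): its objects are the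
morphisms of `F`. -/
structure PlusObj (gcp : Prop) where
  mor : Mor 𝔉.F

namespace PlusObj

variable {𝔉 gcp}

instance : Category (PlusObj 𝔉 gcp) where
  Hom φ ψ := Quot (𝔉.PlusRel gcp (φ := φ.mor) (ψ := ψ.mor))
  id φ := Quot.mk _ (.iso (Iso.refl φ.mor))
  comp := Quot.map₂ .comp (fun _ _ _ h => .comp_congr (.refl _) h)
    (fun _ _ _ h => .comp_congr h (.refl _))
  id_comp := by
    rintro φ ψ ⟨s⟩
    exact Quot.sound (.id_comp s)
  comp_id := by
    rintro φ ψ ⟨s⟩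
    exact Quot.sound (.comp_id s)
  assoc := by
    rintro φ ψ χ ω ⟨s⟩ ⟨t⟩ ⟨u⟩
    exact Quot.sound (.assoc s t u)

/-- The class of a formal morphism. -/
def homMk {φ ψ : PlusObj 𝔉 gcp} (s : 𝔉.PlusPre gcp φ.mor ψ.mor) : φ ⟶ ψ := Quot.mk _ s

/-- Isomorphisms of `(F ↓ F)` as morphisms. -/
def isoMap {φ ψ : PlusObj 𝔉 gcp} (e : φ.mor ≅ ψ.mor) : φ ⟶ ψ := homMk (.iso e)

theorem isoMap_comp {φ ψ χ : PlusObj 𝔉 gcp} (e : φ.mor ≅ ψ.mor) (e' : ψ.mor ≅ χ.mor) :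
    isoMap e ≫ isoMap e' = (isoMap (e ≪≫ e') : φ ⟶ χ) :=
  Quot.sound (.iso_comp e e')

theorem isoMap_refl (φ : PlusObj 𝔉 gcp) : isoMap (Iso.refl φ.mor) = 𝟙 φ := rfl

/-- Isomorphisms of `(F ↓ F)` as isomorphisms. -/
def isoOf {φ ψ : PlusObj 𝔉 gcp} (e : φ.mor ≅ ψ.mor) : φ ≅ ψ where
  hom := isoMap e
  inv := isoMap e.symm
  hom_inv_id := by rw [isoMap_comp, Iso.self_symm_id, isoMap_refl]
  inv_hom_id := by rw [isoMap_comp, Iso.symm_self_id, isoMap_refl]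

/-- The tensor product of morphisms. -/
def tensorMap {φ ψ φ' ψ' : PlusObj 𝔉 gcp} (f : φ ⟶ ψ) (f' : φ' ⟶ ψ') :
    (⟨φ.mor ⊗ φ'.mor⟩ : PlusObj 𝔉 gcp) ⟶ ⟨ψ.mor ⊗ ψ'.mor⟩ :=
  Quot.map₂ .tensor (fun _ _ _ h => .tensor_congr (.refl _) h)
    (fun _ _ _ h => .tensor_congr h (.refl _)) f f'

instance : MonoidalCategoryStruct (PlusObj 𝔉 gcp) where
  tensorObj φ ψ := ⟨φ.mor ⊗ ψ.mor⟩
  tensorHom f f' := tensorMap f f'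
  whiskerLeft φ _ _ f := tensorMap (𝟙 φ) f
  whiskerRight f ψ := tensorMap f (𝟙 ψ)
  tensorUnit := ⟨𝟙_ (Mor 𝔉.F)⟩
  associator φ ψ χ := isoOf (α_ φ.mor ψ.mor χ.mor)
  leftUnitor φ := isoOf (λ_ φ.mor)
  rightUnitor φ := isoOf (ρ_ φ.mor)

theorem tensor_isoMap {φ ψ φ' ψ' : PlusObj 𝔉 gcp} (e : φ.mor ≅ ψ.mor) (e' : φ'.mor ≅ ψ'.mor) :
    tensorMap (isoMap e) (isoMap e') =
      (isoMap (e ⊗ᵢ e') : (⟨φ.mor ⊗ φ'.mor⟩ : PlusObj 𝔉 gcp) ⟶ ⟨ψ.mor ⊗ ψ'.mor⟩) :=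
  Quot.sound (.iso_tensor e e')

theorem tensorMap_id (φ ψ : PlusObj 𝔉 gcp) : tensorMap (𝟙 φ) (𝟙 ψ) = 𝟙 (φ ⊗ ψ) := by
  rw [← isoMap_refl, ← isoMap_refl, tensor_isoMap, ← isoMap_refl]
  congr 1
  ext1
  exact id_tensorHom_id _ _

theorem tensorMap_comp {φ ψ χ φ' ψ' χ' : PlusObj 𝔉 gcp} (f : φ ⟶ ψ) (g : ψ ⟶ χ) (f' : φ' ⟶ ψ')
    (g' : ψ' ⟶ χ') : tensorMap f f' ≫ tensorMap g g' = tensorMap (f ≫ g) (f' ≫ g') := by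
  obtain ⟨s⟩ := f
  obtain ⟨t⟩ := g
  obtain ⟨s'⟩ := f'
  obtain ⟨t'⟩ := g'
  exact Quot.sound (.interchange s t s' t')

theorem isoMap_congr {φ ψ : PlusObj 𝔉 gcp} {e e' : φ.mor ≅ ψ.mor} (h : e.hom = e'.hom) :
    isoMap e = (isoMap e' : φ ⟶ ψ) :=
  congrArg _ (Iso.ext h)

instance : MonoidalCategory (PlusObj 𝔉 gcp) where
  tensorHom_def f g := by
    change tensorMap f g = tensorMap f (𝟙 _) ≫ tensorMap (𝟙 _) g
    rw [tensorMap_comp, Category.comp_id, Category.id_comp]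
  id_tensorHom_id := tensorMap_id
  tensorHom_comp_tensorHom f₁ f₂ g₁ g₂ := tensorMap_comp f₁ g₁ f₂ g₂
  whiskerLeft_id := tensorMap_id
  id_whiskerRight := tensorMap_id
  associator_naturality := by
    rintro _ _ _ _ _ _ ⟨s₁⟩ ⟨s₂⟩ ⟨s₃⟩
    exact Quot.sound (.associator_nat s₁ s₂ s₃)
  leftUnitor_naturality := by
    rintro _ _ ⟨s⟩
    exact Quot.sound (.leftUnitor_nat s)
  rightUnitor_naturality := by
    rintro _ _ ⟨s⟩
    exact Quot.sound (.rightUnitor_nat s)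
  pentagon φ ψ χ ω := by
    change tensorMap (isoMap _) (isoMap (Iso.refl _)) ≫ isoMap _ ≫
      tensorMap (isoMap (Iso.refl _)) (isoMap _) = isoMap _ ≫ isoMap _
    rw [tensor_isoMap, tensor_isoMap, isoMap_comp, isoMap_comp, isoMap_comp]
    refine isoMap_congr ?_
    simp only [Iso.trans_hom, tensorIso_hom, Iso.refl_hom, tensorHom_id, id_tensorHom]
    exact MonoidalCategory.pentagon φ.mor ψ.mor χ.mor ω.mor
  triangle φ ψ := by
    change isoMap _ ≫ tensorMap (isoMap (Iso.refl _)) (isoMap _) =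
      tensorMap (isoMap _) (isoMap (Iso.refl _))
    rw [tensor_isoMap, tensor_isoMap, isoMap_comp]
    refine isoMap_congr ?_
    simp only [Iso.trans_hom, tensorIso_hom, Iso.refl_hom, tensorHom_id, id_tensorHom]
    exact MonoidalCategory.triangle φ.mor ψ.mor

instance : SymmetricCategory (PlusObj 𝔉 gcp) where
  braiding φ ψ := isoOf (β_ φ.mor ψ.mor)
  braiding_naturality_right φ := by
    rintro _ _ ⟨s⟩
    exact Quot.sound (.braiding_nat _ s)
  braiding_naturality_left := by
    rintro _ _ ⟨s⟩ ψ
    exact Quot.sound (.braiding_nat s _)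
  hexagon_forward φ ψ χ := by
    change isoMap _ ≫ isoMap _ ≫ isoMap _ = tensorMap (isoMap _) (isoMap (Iso.refl _)) ≫
      isoMap _ ≫ tensorMap (isoMap (Iso.refl _)) (isoMap _)
    rw [tensor_isoMap, tensor_isoMap, isoMap_comp, isoMap_comp, isoMap_comp, isoMap_comp]
    refine isoMap_congr ?_
    simp only [Iso.trans_hom, tensorIso_hom, Iso.refl_hom, tensorHom_id, id_tensorHom]
    exact BraidedCategory.hexagon_forward φ.mor ψ.mor χ.mor
  hexagon_reverse φ ψ χ := by
    change isoMap _ ≫ isoMap _ ≫ isoMap _ = tensorMap (isoMap (Iso.refl _)) (isoMap _) ≫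
      isoMap _ ≫ tensorMap (isoMap _) (isoMap (Iso.refl _))
    rw [tensor_isoMap, tensor_isoMap, isoMap_comp, isoMap_comp, isoMap_comp, isoMap_comp]
    refine isoMap_congr ?_
    simp only [Iso.trans_hom, tensorIso_hom, Iso.refl_hom, tensorHom_id, id_tensorHom]
    exact BraidedCategory.hexagon_reverse φ.mor ψ.mor χ.mor
  symmetry φ ψ := by
    change isoMap _ ≫ isoMap _ = isoMap (Iso.refl _)
    rw [isoMap_comp]
    exact isoMap_congr (SymmetricCategory.symmetry φ.mor ψ.mor)

end PlusObj

/-- `(V⁺, F⁺, ι⁺)` and `(V⁺ᵍᶜᵖ, F⁺ᵍᶜᵖ, ι⁺ᵍᶜᵖ)`: here `V⁺ = V⁺ᵍᶜᵖ = Iso(F ↓ V)`. -/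
def plusAux : FeynmanTriple where
  V := Core 𝔉.Basic
  F := PlusObj 𝔉 gcp
  ι :=
    { obj := fun φ => ⟨Mor.mk φ.of.hom⟩
      map := fun f => PlusObj.isoMap (Mor.sd (Comma.leftIso f.iso)
        (𝔉.ι.mapIso (Comma.rightIso f.iso)) f.iso.hom.w.symm)
      map_id := fun φ => (PlusObj.isoMap_congr (by
        ext
        · rfl
        · exact 𝔉.ι.map_id _)).trans (PlusObj.isoMap_refl _)
      map_comp := fun f g => (PlusObj.isoMap_congr (by
        ext
        · rfl
        · exact 𝔉.ι.map_comp _ _)).trans (PlusObj.isoMap_comp _ _).symm }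

/-- The plus construction `𝔉⁺`. -/
def plus : FeynmanTriple := 𝔉.plusAux False

/-- The gcp version `𝔉⁺ᵍᶜᵖ` of the plus construction. -/
def plusGcp : FeynmanTriple := 𝔉.plusAux True

/-- The trivial Feynman category `(𝟏, 𝟏^⊗, j)`. -/
def triv : FeynmanTriple where
  V := Discrete PUnit.{1}
  F := FreeSym (Discrete PUnit.{1})
  ι := FreeSym.incl _

end FeynmanTriple

/-! ### Noncommutative sets -/

/-- The objects of `NCSet`: finite sets. -/
structure NCSet where
  carrier : Type
  [finite : Finite carrier]

namespace NCSet

attribute [instance] NCSet.finite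

/-- A map together with a (strict) linear order on each of its fibers, given as the relation `lt`
which relates only elements of the same fiber. -/
@[ext]
structure Hom (S T : NCSet) where
  toFun : S.carrier → T.carrier
  lt : S.carrier → S.carrier → Prop
  fiber : ∀ {x y}, lt x y → toFun x = toFun y
  irrefl : ∀ x, ¬ lt x x
  trans : ∀ {x y z}, lt x y → lt y z → lt x z
  total : ∀ {x y}, toFun x = toFun y → lt x y ∨ x = y ∨ lt y x

/-- A bijection with the trivial orders on its one-element fibers. -/
def Hom.ofEquiv {S T : NCSet} (e : S.carrier ≃ T.carrier) : Hom S T where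
  toFun := e
  lt _ _ := False
  fiber h := h.elim
  irrefl _ h := h
  trans h _ := h
  total h := Or.inr (Or.inl (e.injective h))

/-- Composition: `x < y` in a fiber of `g ∘ f` if `x < y` in a fiber of `f`, or `f x < f y` in a
fiber of `g`. -/
def Hom.comp {S T U : NCSet} (f : Hom S T) (g : Hom T U) : Hom S U where
  toFun := g.toFun ∘ f.toFun
  lt x y := f.lt x y ∨ g.lt (f.toFun x) (f.toFun y)
  fiber := by
    rintro x y (h | h)
    · exact congrArg g.toFun (f.fiber h)
    · exact g.fiber h
  irrefl x := by
    rintro (h | h)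
    · exact f.irrefl _ h
    · exact g.irrefl _ h
  trans := by
    rintro x y z (h | h) (h' | h')
    · exact Or.inl (f.trans h h')
    · exact Or.inr (by rwa [f.fiber h])
    · exact Or.inr (by rwa [← f.fiber h'])
    · exact Or.inr (g.trans h h')
  total := by
    intro x y h
    rcases g.total h with h | h | h
    · exact Or.inl (Or.inr h)
    · rcases f.total h with h | h | h
      · exact Or.inl (Or.inl h)
      · exact Or.inr (Or.inl h)
      · exact Or.inr (Or.inr (Or.inl h))
    · exact Or.inr (Or.inr (Or.inr h))

instance : Category NCSet where
  Hom := Hom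
  id S := Hom.ofEquiv (Equiv.refl _)
  comp := Hom.comp
  id_comp f := Hom.ext rfl (by
    funext x y
    exact false_or _)
  comp_id f := Hom.ext rfl (by
    funext x y
    exact or_false _)
  assoc f g h := Hom.ext rfl (by
    funext x y
    exact propext or_assoc)

theorem hom_ext {S T : NCSet} {f g : S ⟶ T} (h : ∀ x, f.toFun x = g.toFun x)
    (h' : ∀ x y, f.lt x y ↔ g.lt x y) : f = g :=
  Hom.ext (funext h) (funext fun x => funext fun y => propext (h' x y))

/-- Bijections are isomorphisms. -/
def isoOfEquiv {S T : NCSet} (e : S.carrier ≃ T.carrier) : S ≅ T where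
  hom := Hom.ofEquiv e
  inv := Hom.ofEquiv e.symm
  hom_inv_id := hom_ext e.symm_apply_apply (fun _ _ => (or_false _).to_iff)
  inv_hom_id := hom_ext e.apply_symm_apply (fun _ _ => (or_false _).to_iff)

/-- Disjoint union of morphisms. -/
def sumMap {S T S' T' : NCSet} (f : S ⟶ T) (f' : S' ⟶ T') :
    (⟨S.carrier ⊕ S'.carrier⟩ : NCSet) ⟶ ⟨T.carrier ⊕ T'.carrier⟩ where
  toFun := Sum.map f.toFun f'.toFun
  lt := Sum.LiftRel f.lt f'.lt
  fiber := by
    rintro _ _ (h | h)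
    · exact congrArg Sum.inl (f.fiber h)
    · exact congrArg Sum.inr (f'.fiber h)
  irrefl := by
    rintro _ (h | h)
    · exact f.irrefl _ h
    · exact f'.irrefl _ h
  trans := by
    rintro _ _ _ (h | h) (h' | h')
    · exact .inl (f.trans h h')
    · exact .inr (f'.trans h h')
  total := by
    rintro (x | x) (y | y) h
    · rcases f.total (Sum.inl.inj h) with h | h | h
      · exact Or.inl (.inl h)
      · exact Or.inr (Or.inl (congrArg _ h))
      · exact Or.inr (Or.inr (.inl h))
    · cases h
    · cases h
    · rcases f'.total (Sum.inr.inj h) with h | h | h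
      · exact Or.inl (.inr h)
      · exact Or.inr (Or.inl (congrArg _ h))
      · exact Or.inr (Or.inr (.inr h))

instance : MonoidalCategoryStruct NCSet where
  tensorObj S T := ⟨S.carrier ⊕ T.carrier⟩
  tensorHom := sumMap
  whiskerLeft S _ _ f := sumMap (𝟙 S) f
  whiskerRight f T := sumMap f (𝟙 T)
  tensorUnit := ⟨Empty⟩
  associator _ _ _ := isoOfEquiv (Equiv.sumAssoc _ _ _)
  leftUnitor _ := isoOfEquiv (Equiv.emptySum Empty _)
  rightUnitor _ := isoOfEquiv (Equiv.sumEmpty _ Empty)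

theorem id_ordFree (S : NCSet) (x y) : ¬ (𝟙 S : S ⟶ S).lt x y := id

theorem equiv_ordFree {S T : NCSet} (e : S.carrier ≃ T.carrier) (x y) :
    ¬ (isoOfEquiv e).hom.lt x y := id

theorem equiv_inv_ordFree {S T : NCSet} (e : S.carrier ≃ T.carrier) (x y) :
    ¬ (isoOfEquiv e).inv.lt x y := id

theorem comp_ordFree {S T U : NCSet} {f : S ⟶ T} {g : T ⟶ U} (hf : ∀ x y, ¬ f.lt x y)
    (hg : ∀ x y, ¬ g.lt x y) (x y) : ¬ (f ≫ g).lt x y := by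
  rintro (h | h)
  · exact hf _ _ h
  · exact hg _ _ h

theorem sumMap_ordFree {S T S' T' : NCSet} {f : S ⟶ T} {g : S' ⟶ T'} (hf : ∀ x y, ¬ f.lt x y)
    (hg : ∀ x y, ¬ g.lt x y) (x y) : ¬ (sumMap f g).lt x y := by
  rintro (h | h)
  · exact hf _ _ h
  · exact hg _ _ h

theorem hom_ext_ordFree {S T : NCSet} {f g : S ⟶ T} (h : ∀ x, f.toFun x = g.toFun x)
    (hf : ∀ x y, ¬ f.lt x y) (hg : ∀ x y, ¬ g.lt x y) : f = g :=
  hom_ext h fun x y => iff_of_false (hf x y) (hg x y)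

theorem liftRel_comp {A B A' B' : Type} (r : A → A → Prop) (s : B → B → Prop)
    (r' : A' → A' → Prop) (s' : B' → B' → Prop) (f : A → A') (g : B → B') (x y : A ⊕ B) :
    (Sum.LiftRel r s x y ∨ Sum.LiftRel r' s' (Sum.map f g x) (Sum.map f g y)) ↔
      Sum.LiftRel (fun i j => r i j ∨ r' (f i) (f j)) (fun i j => s i j ∨ s' (g i) (g j)) x y := by
  rcases x with x | x <;> rcases y with y | y <;> simp

theorem liftRel_def {A B A' : Type} (r : A → A → Prop) (s : B → B → Prop) (f : A → A')
    (x y : A ⊕ B) : Sum.LiftRel r s x y ↔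
      Sum.LiftRel r (fun _ _ => False) x y ∨
        Sum.LiftRel (fun _ _ => False) s (Sum.map f id x) (Sum.map f id y) := by
  rcases x with x | x <;> rcases y with y | y <;> simp

theorem liftRel_assoc {A B C : Type} (r : A → A → Prop) (s : B → B → Prop) (t : C → C → Prop)
    (x y : (A ⊕ B) ⊕ C) : (Sum.LiftRel (Sum.LiftRel r s) t x y ∨ False) ↔
      (False ∨ Sum.LiftRel r (Sum.LiftRel s t) (Equiv.sumAssoc A B C x)
        (Equiv.sumAssoc A B C y)) := by
  rcases x with (x | x) | x <;> rcases y with (y | y) | y <;> simp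

theorem liftRel_swap {A B : Type} (r : A → A → Prop) (s : B → B → Prop)
    (x y : A ⊕ B) : (Sum.LiftRel r s x y ∨ False) ↔
      (False ∨ Sum.LiftRel s r (Equiv.sumComm A B x) (Equiv.sumComm A B y)) := by
  rcases x with x | x <;> rcases y with y | y <;> simp

theorem liftRel_emptySum {A : Type} (r : A → A → Prop) (x y : Empty ⊕ A) :
    (Sum.LiftRel (fun _ _ => False) r x y ∨ False) ↔
      (False ∨ r (Equiv.emptySum Empty A x) (Equiv.emptySum Empty A y)) := by
  rcases x with x | x
  · exact x.elim
  rcases y with y | y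
  · exact y.elim
  simp

theorem liftRel_sumEmpty {A : Type} (r : A → A → Prop) (x y : A ⊕ Empty) :
    (Sum.LiftRel r (fun _ _ => False) x y ∨ False) ↔
      (False ∨ r (Equiv.sumEmpty A Empty x) (Equiv.sumEmpty A Empty y)) := by
  rcases x with x | x
  swap
  · exact x.elim
  rcases y with y | y
  swap
  · exact y.elim
  simp

instance : MonoidalCategory NCSet where
  tensorHom_def {S _ _ _} f g := hom_ext (by rintro (i | i) <;> rfl)
    (liftRel_def f.lt g.lt f.toFun)
  id_tensorHom_id _ _ := hom_ext_ordFree (by rintro (i | i) <;> rfl)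
    (sumMap_ordFree (id_ordFree _) (id_ordFree _)) (id_ordFree _)
  tensorHom_comp_tensorHom f₁ f₂ g₁ g₂ := hom_ext (by rintro (i | i) <;> rfl)
    (liftRel_comp f₁.lt f₂.lt g₁.lt g₂.lt f₁.toFun f₂.toFun)
  whiskerLeft_id _ _ := hom_ext_ordFree (by rintro (i | i) <;> rfl)
    (sumMap_ordFree (id_ordFree _) (id_ordFree _)) (id_ordFree _)
  id_whiskerRight _ _ := hom_ext_ordFree (by rintro (i | i) <;> rfl)
    (sumMap_ordFree (id_ordFree _) (id_ordFree _)) (id_ordFree _)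
  associator_naturality f₁ f₂ f₃ := hom_ext (by rintro ((i | i) | i) <;> rfl)
    (liftRel_assoc f₁.lt f₂.lt f₃.lt)
  leftUnitor_naturality f := hom_ext (by rintro (i | i); exacts [i.elim, rfl])
    (liftRel_emptySum f.lt)
  rightUnitor_naturality f := hom_ext (by rintro (i | i); exacts [rfl, i.elim])
    (liftRel_sumEmpty f.lt)
  pentagon W X Y Z := hom_ext_ordFree (by rintro (((i | i) | i) | i) <;> rfl)
    (comp_ordFree (sumMap_ordFree (equiv_ordFree _) (id_ordFree _))
      (comp_ordFree (equiv_ordFree _) (sumMap_ordFree (id_ordFree _) (equiv_ordFree _))))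
    (comp_ordFree (equiv_ordFree _) (equiv_ordFree _))
  triangle X Y := hom_ext_ordFree (by rintro ((i | i) | i); exacts [rfl, i.elim, rfl])
    (comp_ordFree (equiv_ordFree _) (sumMap_ordFree (id_ordFree _) (equiv_ordFree _)))
    (sumMap_ordFree (equiv_ordFree _) (id_ordFree _))

instance : SymmetricCategory NCSet where
  braiding X Y := isoOfEquiv (Equiv.sumComm _ _)
  braiding_naturality_right X _ _ f := hom_ext (by rintro (i | i) <;> rfl)
    (liftRel_swap (fun _ _ => False) f.lt)
  braiding_naturality_left f Z := hom_ext (by rintro (i | i) <;> rfl)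
    (liftRel_swap f.lt (fun _ _ => False))
  hexagon_forward X Y Z := hom_ext_ordFree (by rintro ((i | i) | i) <;> rfl)
    (comp_ordFree (equiv_ordFree _) (comp_ordFree (equiv_ordFree _) (equiv_ordFree _)))
    (comp_ordFree (sumMap_ordFree (equiv_ordFree _) (id_ordFree _))
      (comp_ordFree (equiv_ordFree _) (sumMap_ordFree (id_ordFree _) (equiv_ordFree _))))
  hexagon_reverse X Y Z := hom_ext_ordFree (by rintro (i | (i | i)) <;> rfl)
    (comp_ordFree (equiv_inv_ordFree _) (comp_ordFree (equiv_ordFree _) (equiv_inv_ordFree _)))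
    (comp_ordFree (sumMap_ordFree (id_ordFree _) (equiv_ordFree _))
      (comp_ordFree (equiv_inv_ordFree _) (sumMap_ordFree (equiv_ordFree _) (id_ordFree _))))
  symmetry X Y := hom_ext_ordFree (by rintro (i | i) <;> rfl)
    (comp_ordFree (equiv_ordFree _) (equiv_ordFree _)) (id_ordFree _)

/-- The morphisms whose underlying map is surjective. -/
def surj : MorphismProperty NCSet := fun _ _ f => Function.Surjective f.toFun

theorem surj_of_iso {S T : NCSet} (e : S ≅ T) : surj e.hom := fun y =>
  ⟨e.inv.toFun y, congrArg (fun f : T ⟶ T => f.toFun y) e.inv_hom_id⟩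

instance : surj.IsStableUnderBraiding where
  id_mem _ := Function.surjective_id
  comp_mem _ _ hf hg := hg.comp hf
  whiskerLeft _ _ _ _ hg := Function.surjective_id.sumMap hg
  whiskerRight _ hf _ := hf.sumMap Function.surjective_id
  associator_hom_mem _ _ _ := surj_of_iso (α_ _ _ _)
  associator_inv_mem _ _ _ := surj_of_iso (α_ _ _ _).symm
  leftUnitor_hom_mem _ := surj_of_iso (λ_ _)
  leftUnitor_inv_mem _ := surj_of_iso (λ_ _).symm
  rightUnitor_hom_mem _ := surj_of_iso (ρ_ _)
  rightUnitor_inv_mem _ := surj_of_iso (ρ_ _).symm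
  braiding_hom_mem _ _ := surj_of_iso (β_ _ _)
  braiding_inv_mem _ _ := surj_of_iso (β_ _ _).symm

/-- The Feynman category `(𝟏, NCSet, ι)`, with `ι` the one-element set. -/
def feynman : FeynmanTriple where
  V := Discrete PUnit.{1}
  F := NCSet
  ι := (Functor.const _).obj ⟨PUnit⟩

end NCSet

/-- The category of finite sets and surjections with orders on the fibers. -/
abbrev FSOrd := WideSubcategory NCSet.surj

/-- The Feynman category `(𝟏, FS^<, ι)`, with `ι` the one-element set. -/
def FSOrd.feynman : FeynmanTriple where
  V := Discrete PUnit.{1}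
  F := FSOrd
  ι := (Functor.const _).obj ⟨⟨PUnit⟩⟩

/-! In the free symmetric monoidal category on a point every morphism is a bijection of positions.
So an object of the plus construction is determined up to isomorphism by the finite set of positions
of its target, and an isomorphism `(σ ⇓ σ')` by the bijection it induces there (`mor_hom_ext`,
`isoMap_eq`). A basic morphism has one position, hence equivariance reduces every `γ` to a single
map `mul : one ⊗ one ⟶ one` (`gamma_eq`). Associativity of `γ` makes `mul` associative, and the gcp
relations make `unit` a two-sided unit. The plus construction is thus generated by a nonunital
associative algebra, its gcp version by a unital one. An operation with one output multiplies its
inputs in some linear order, and a general morphism is a family of such operations indexed by the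
positions of its target: a map with ordered fibers, which are nonempty when there is no unit.

The interpretation `trivEval` respects all relations (`trivEval_rel`) and gives the symmetric
monoidal functor `trivToWide`. It is fully faithful by induction on the target word. Morphisms into
a tensor product split (`splits`), and a morphism into one letter is a permutation followed by an
iterated product or a unit (`isProd`). Finite linear orders of equal size are isomorphic in exactly
one way (`exists_equiv_lt`, `equiv_lt_unique`).

The Feynman axioms are checked once, for any triple whose monoidal category is symmetric monoidally
equivalent to finite sets with all, or all surjective, maps with ordered fibers
(`isFeynman_of_wide`). A word is sent to a disjoint union. Every finite set is a disjoint union of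
points (`freelyGeneratesIsos_of_unique`), every morphism is the disjoint union of its restrictions
to fibers (`freelyGeneratesIsos_of_mor`), and isomorphisms respect these decompositions. -/

namespace NCSet

/-! ### Isomorphisms of noncommutative sets -/

/-- A pair ordered by `f` stays ordered in `f ≫ inv f`, which is an identity and orders nothing.
Hence equality of isomorphisms can be tested on the underlying maps, which settles most coherence
conditions below. -/
theorem ordFree_of_isIso {S T : NCSet} (f : S ⟶ T) [IsIso f] (x y : S.carrier) : ¬ f.lt x y :=
  fun h => id_ordFree S x y (by
    rw [← IsIso.hom_inv_id f]
    exact Or.inl h)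

theorem hom_ext_of_isIso {S T : NCSet} {f g : S ⟶ T} [hf : IsIso f] [IsIso g]
    (h : ∀ x, f.toFun x = g.toFun x) : f = g :=
  hom_ext_ordFree h (ordFree_of_isIso f) (ordFree_of_isIso g)

/-- The bijection underlying an isomorphism. -/
def equivOfIso {S T : NCSet} (e : S ≅ T) : S.carrier ≃ T.carrier where
  toFun := e.hom.toFun
  invFun := e.inv.toFun
  left_inv x := congrArg (fun f : S ⟶ S => f.toFun x) e.hom_inv_id
  right_inv x := congrArg (fun f : T ⟶ T => f.toFun x) e.inv_hom_id

theorem ofEquiv_comp_lt {S T U : NCSet} (e : S.carrier ≃ T.carrier) (f : T ⟶ U) (x y) :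
    ((Hom.ofEquiv e : S ⟶ T) ≫ f).lt x y ↔ f.lt (e x) (e y) :=
  (false_or _).to_iff

theorem comp_ofEquiv_lt {S T U : NCSet} (f : S ⟶ T) (e : T.carrier ≃ U.carrier) (x y) :
    (f ≫ (Hom.ofEquiv e : T ⟶ U)).lt x y ↔ f.lt x y :=
  (or_false _).to_iff

/-- Both bracketings give the lexicographic order on three consecutive blocks. This is the
order-theoretic content of the associativity of `γ`; the `False` terms match the unfolded
composites. -/
theorem isLeft_isRight_assoc {A B C : Type} (i j : A ⊕ (B ⊕ C)) :
    (Sum.LiftRel (fun _ _ => False) (fun i j => Sum.isLeft i ∧ Sum.isRight j) i j ∨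
      (Sum.isLeft i ∧ Sum.isRight j)) ↔
    (False ∨ Sum.LiftRel (fun i j => Sum.isLeft i ∧ Sum.isRight j) (fun _ _ => False)
        ((Equiv.sumAssoc A B C).symm i) ((Equiv.sumAssoc A B C).symm j) ∨
      (Sum.isLeft ((Equiv.sumAssoc A B C).symm i) ∧
        Sum.isRight ((Equiv.sumAssoc A B C).symm j)) ∨ False) := by
  rcases i with i | (i | i) <;> rcases j with j | (j | j) <;> simp

section Wide

variable {P : MorphismProperty NCSet} [P.IsStableUnderBraiding]

instance isIso_hom {S T : WideSubcategory P} (f : S ⟶ T) [IsIso f] : IsIso f.hom :=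
  inferInstanceAs (IsIso ((wideSubcategoryInclusion P).map f))

theorem wide_hom_ext_of_isIso {S T : WideSubcategory P} {f g : S ⟶ T} [IsIso f] [IsIso g]
    (h : ∀ x, f.hom.toFun x = g.hom.toFun x) : f = g :=
  WideSubcategory.hom_ext _ (hom_ext_of_isIso h)

end Wide

end NCSet

/-! ### Interpretation of formal morphisms as maps with ordered fibers -/

instance FreeSym.finite_pos {V : Type u₁} : ∀ w : FreeSym V, Finite w.Pos
  | unit => inferInstanceAs (Finite Empty)
  | of _ => inferInstanceAs (Finite Unit)
  | tensor w w' =>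
    have := finite_pos w
    have := finite_pos w'
    inferInstanceAs (Finite (w.Pos ⊕ w'.Pos))

/-- The finite set of positions of a word. -/
abbrev FreeSym.posSet {V : Type u₁} (w : FreeSym V) : NCSet := ⟨w.Pos⟩

namespace FeynmanTriple

/-- The positions of the target of a morphism of words. -/
abbrev trivPos (φ : Mor triv.F) : NCSet := FreeSym.posSet (V := Discrete PUnit.{1}) φ.right

/-- The bijection of positions underlying a morphism of words in one letter. -/
abbrev trivPerm {w w' : triv.F} (f : w ⟶ w') :
    FreeSym.Pos (V := Discrete PUnit.{1}) w ≃ FreeSym.Pos (V := Discrete PUnit.{1}) w' :=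
  FreeSym.Hom.perm f

theorem triv_hom_ext {w w' : triv.F} {f g : w ⟶ w'} (h : ∀ i, trivPerm f i = trivPerm g i) :
    f = g :=
  FreeSym.hom_ext (V := Discrete PUnit.{1}) h fun _ => Subsingleton.elim _ _

instance triv_subsingleton_pos (v : triv.V) :
    Subsingleton (FreeSym.Pos (V := Discrete PUnit.{1}) (triv.ι.obj v)) :=
  inferInstanceAs (Subsingleton Unit)

/-- The image of `γ(φ₀; a)`: the positions of the source of `φ₀` come
after the one of its target. -/
def gammaSet {Y : triv.F} {v : triv.V} (φ₀ : Y ⟶ triv.ι.obj v) :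
    NCSet.Hom (FreeSym.posSet (V := Discrete PUnit.{1}) (FreeSym.tensor (FreeSym.of v) Y))
      (FreeSym.posSet (FreeSym.of v)) where
  toFun _ := ()
  lt i j := i.isLeft ∧ j.isRight
  fiber _ := rfl
  irrefl i h := by rcases i with i | i <;> simp at h
  trans {i j k} h h' := by rcases j with j | j <;> simp_all
  total {i j} _ := by
    -- `φ₀` is a bijection onto a single letter, so `Y` has only one position; two positions of `Y`
    -- would not be comparable.
    have : Subsingleton (FreeSym.Pos (V := Discrete PUnit.{1}) Y) := (trivPerm φ₀).subsingleton
    rcases i with i | i <;> rcases j with j | j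
    · exact Or.inr (Or.inl rfl)
    · exact Or.inl ⟨rfl, rfl⟩
    · exact Or.inr (Or.inr ⟨rfl, rfl⟩)
    · exact Or.inr (Or.inl (congrArg _ (Subsingleton.elim _ _)))

/-- The map from the empty set. -/
def emptyMap (S : NCSet) : NCSet.Hom ⟨Empty⟩ S where
  toFun := Empty.elim
  lt i := i.elim
  fiber {i} := i.elim
  irrefl i := i.elim
  trans {i} := i.elim
  total {i} := i.elim

/-- The interpretation of formal morphisms over the trivial Feynman category as maps of positions
with orders on the fibers. -/
def trivEval {gcp : Prop} : ∀ {φ ψ : Mor triv.F}, triv.PlusPre gcp φ ψ → (trivPos φ ⟶ trivPos ψ)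
  | _, _, .iso e => NCSet.Hom.ofEquiv (trivPerm e.hom.right)
  | _, _, .comp s t => trivEval s ≫ trivEval t
  | _, _, .tensor s t => NCSet.sumMap (trivEval s) (trivEval t)
  | _, _, .gamma φ₀ _ _ => gammaSet φ₀
  | _, _, .point _ _ => emptyMap _

/-- Only the points `i_σ` can miss a position of the target. The disjunction with `gcp` lets one
argument serve both versions of the construction. -/
theorem trivEval_surjective {gcp : Prop} {φ ψ : Mor triv.F} (s : triv.PlusPre gcp φ ψ) :
    gcp ∨ Function.Surjective (trivEval s).toFun := by
  induction s with
  | iso e => exact Or.inr (trivPerm e.hom.right).surjective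
  | comp s t hs ht =>
    rcases hs with h | hs
    · exact Or.inl h
    rcases ht with h | ht
    · exact Or.inl h
    exact Or.inr (ht.comp hs)
  | tensor s t hs ht =>
    rcases hs with h | hs
    · exact Or.inl h
    rcases ht with h | ht
    · exact Or.inl h
    exact Or.inr (hs.sumMap ht)
  | gamma φ₀ a ha => exact Or.inr fun i => ⟨Sum.inl i, rfl⟩
  | point h σ => exact Or.inl h

/-- The parallel composition sends the positions of the first factor to themselves and those of the
second along `b`. -/
theorem trivEval_parallel {gcp : Prop} {X Y Z : triv.F} {b : Y ⟶ Z} {a : X ⟶ Y}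
    {t : triv.PlusPre gcp (Mor.mk b ⊗ Mor.mk a) (Mor.mk (a ≫ b))} (ht : triv.IsParallel gcp b a t) :
    (∀ i, (trivEval t).toFun i = Sum.elim id (trivPerm b) i) ∧
      ∀ i j, (trivEval t).lt i j ↔ ∃ y, i = Sum.inl (trivPerm b y) ∧ j = Sum.inr y := by
  induction ht with
  | unit =>
    constructor
    · rintro (i | i) <;> exact i.elim
    · rintro (i | i) <;> exact i.elim
  | basic φ a ha =>
    constructor
    · rintro (i | i) <;> rfl
    · intro i j
      constructor
      · rintro ⟨hi, hj⟩
        rcases i with i | i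
        · rcases j with j | j
          · cases hj
          · exact ⟨j, rfl, rfl⟩
        · cases hi
      · rintro ⟨y, rfl, rfl⟩
        exact ⟨rfl, rfl⟩
  | @tensor X Y Z X' Y' Z' b a b' a' t t' _ _ h h' =>
    constructor
    · rintro ((i | i) | (i | i))
      · exact congrArg Sum.inl (h.1 (Sum.inl i))
      · exact congrArg Sum.inr (h'.1 (Sum.inl i))
      · exact congrArg Sum.inl (h.1 (Sum.inr i))
      · exact congrArg Sum.inr (h'.1 (Sum.inr i))
    -- The outer isomorphisms only relabel positions, so the order is that of `t` and `t'` read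
    -- through the shuffle.
    · have key : ∀ i j, (trivEval (.comp (.iso (shuffleIso (Mor.mk b) (Mor.mk b') (Mor.mk a)
          (Mor.mk a'))) (.comp (.tensor t t') (.iso (Mor.ofEq
            (tensorHom_comp_tensorHom a a' b b').symm))))).lt i j ↔
          Sum.LiftRel (trivEval t).lt (trivEval t').lt (Equiv.sumSumSumComm _ _ _ _ i)
            (Equiv.sumSumSumComm _ _ _ _ j) := by
        intro i j
        refine (NCSet.ofEquiv_comp_lt _ _ i j).trans ((NCSet.comp_ofEquiv_lt _ _ _ _).trans ?_)
        rcases i with (i | i) | (i | i) <;> rcases j with (j | j) | (j | j) <;> exact Iff.rfl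
      intro i j
      rw [key]
      constructor
      · rcases i with (i | i) | (i | i) <;> rcases j with (j | j) | (j | j) <;> rintro (hij | hij)
        all_goals first
          | have hij := (h.2 _ _).1 hij
            obtain ⟨y, hi, hj⟩ := hij
          | have hij := (h'.2 _ _).1 hij
            obtain ⟨y, hi, hj⟩ := hij
        all_goals first
          | cases hi; done
          | cases hj; done
          | exact ⟨Sum.inl y, congrArg Sum.inl (congrArg Sum.inl (Sum.inl.inj hi)),
              congrArg Sum.inr (congrArg Sum.inl (Sum.inr.inj hj))⟩
          | exact ⟨Sum.inr y, congrArg Sum.inl (congrArg Sum.inr (Sum.inl.inj hi)),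
              congrArg Sum.inr (congrArg Sum.inr (Sum.inr.inj hj))⟩
      · rintro ⟨y | y, rfl, rfl⟩
        · exact .inl ((h.2 _ _).2 ⟨y, rfl, rfl⟩)
        · exact .inr ((h'.2 _ _).2 ⟨y, rfl, rfl⟩)

theorem trivEval_rel {gcp : Prop} {φ ψ : Mor triv.F} {s t : triv.PlusPre gcp φ ψ}
    (h : triv.PlusRel gcp s t) : trivEval s = trivEval t := by
  induction h with
  | refl s => rfl
  | symm _ h => exact h.symm
  | trans _ _ h h' => exact h.trans h'
  | comp_congr _ _ h h' => exact congrArg₂ _ h h'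
  | tensor_congr _ _ h h' => exact congrArg₂ _ h h'
  | id_comp s => exact Category.id_comp (trivEval s)
  | comp_id s => exact Category.comp_id (trivEval s)
  | assoc s t u => exact Category.assoc _ _ _
  | interchange s t s' t' =>
    exact tensorHom_comp_tensorHom (trivEval s) (trivEval s') (trivEval t) (trivEval t')
  | associator_nat s₁ s₂ s₃ =>
    exact associator_naturality (trivEval s₁) (trivEval s₂) (trivEval s₃)
  | leftUnitor_nat s =>
    exact (congrArg (· ≫ _) (id_tensorHom _ _)).trans (leftUnitor_naturality (trivEval s))
  | rightUnitor_nat s =>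
    exact (congrArg (· ≫ _) (tensorHom_id _ _)).trans (rightUnitor_naturality (trivEval s))
  | braiding_nat s s' => exact BraidedCategory.braiding_naturality (trivEval s) (trivEval s')
  | iso_comp e e' =>
    exact NCSet.hom_ext_ordFree (fun _ => rfl) (NCSet.comp_ordFree (fun _ _ => id) (fun _ _ => id))
      (fun _ _ => id)
  | iso_tensor e e' =>
    exact NCSet.hom_ext_ordFree (by rintro (i | i) <;> rfl)
      (by rintro _ _ (h | h) <;> exact h) (fun _ _ => id)
  | gamma_equivariant ha ha' σ τ σ₀ h h₀ =>
    refine NCSet.hom_ext (fun _ => Subsingleton.elim (α := Unit) _ _) ?_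
    intro i j
    refine Iff.trans (b := False ∨ i.isLeft ∧ j.isRight) (or_congr ?_ ?_) or_comm
    · exact iff_of_false (by rintro (h | h) <;> exact h) id
    · rcases i with i | i <;> rcases j with j | j <;> exact Iff.rfl
  | @gamma_assoc X Y Z v φ₀ b a ha hb hab t ht =>
    obtain ⟨h, h'⟩ := trivEval_parallel ht
    refine NCSet.hom_ext (fun _ => Subsingleton.elim (α := Unit) _ _) fun i j => ?_
    -- Since `φ₀` ends in one letter, `Y` and `Z` have at most one position. The order of `t` is
    -- then "left before right", and both sides order the three blocks lexicographically.
    have : Subsingleton (FreeSym.Pos (V := Discrete PUnit.{1}) Y) :=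
      (trivPerm (b ≫ φ₀)).subsingleton
    have : Subsingleton (FreeSym.Pos (V := Discrete PUnit.{1}) Z) := (trivPerm φ₀).subsingleton
    have hlt : (trivEval t).lt = fun i j => Sum.isLeft i ∧ Sum.isRight j := by
      funext i j
      refine propext ((h' i j).trans ⟨?_, ?_⟩)
      · rintro ⟨y, rfl, rfl⟩
        exact ⟨rfl, rfl⟩
      · rcases i with i | i <;> rcases j with j | j <;> rintro ⟨hi, hj⟩ <;> first
          | cases hi; done
          | cases hj; done
          | exact ⟨j, congrArg Sum.inl (Subsingleton.elim (α := FreeSym.Pos Z) _ _), rfl⟩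
    have hl : (NCSet.sumMap (NCSet.Hom.ofEquiv (Equiv.refl _) :
        FreeSym.posSet (V := Discrete PUnit.{1}) (FreeSym.of v) ⟶ _) (trivEval t) ≫
          gammaSet φ₀).lt i j ↔
        Sum.LiftRel (fun _ _ => False) (trivEval t).lt i j ∨ (Sum.isLeft i ∧ Sum.isRight j) := by
      refine or_congr Iff.rfl ?_
      rcases i with i | i <;> rcases j with j | j <;> exact Iff.rfl
    rw [hlt] at hl
    refine hl.trans ((NCSet.isLeft_isRight_assoc i j).trans ?_)
    rcases i with i | (i | i) <;> rcases j with j | (j | j) <;> exact Iff.rfl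
  -- Vacuous: no bijection takes the empty word to a letter.
  | gamma_nil φ₀ => exact ((trivPerm φ₀).symm ()).elim
  | point_equivariant h τ σ σ' => exact NCSet.hom_ext (fun i => i.elim) (fun i => i.elim)
  | point_right h φ₀ e he ht =>
    refine NCSet.hom_ext (fun _ => Subsingleton.elim (α := Unit) _ _) fun i j => ?_
    -- The source has a single position, so irreflexivity empties both orders.
    obtain rfl : i = j := Subsingleton.elim (α := Unit) _ _
    exact iff_of_false (NCSet.Hom.irrefl _ _) (NCSet.Hom.irrefl _ _)
  | point_left h σ₀ φ₁ =>
    refine NCSet.hom_ext (fun _ => Subsingleton.elim (α := Unit) _ _) fun i j => ?_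
    obtain rfl : i = j := Subsingleton.elim (α := Unit) _ _
    exact iff_of_false (NCSet.Hom.irrefl _ _) (NCSet.Hom.irrefl _ _)

/-! ### The symmetric monoidal functor to finite sets with ordered fibers -/

section ToWide

variable {gcp : Prop} (P : MorphismProperty NCSet) [P.IsStableUnderBraiding]
  (hP : ∀ {S T : NCSet} (f : S ⟶ T), P f ↔ gcp ∨ Function.Surjective f.toFun)

/-- The functor from the plus construction of the trivial Feynman category which sends a morphism
of words to the set of positions of its target. -/
def trivToWide : PlusObj triv gcp ⥤ WideSubcategory P where
  obj φ := ⟨trivPos φ.mor⟩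
  map {φ ψ} f := Quot.lift (fun s => (⟨trivEval s, (hP _).2 (trivEval_surjective s)⟩ :
      (⟨trivPos φ.mor⟩ : WideSubcategory P) ⟶ ⟨trivPos ψ.mor⟩))
    (fun _ _ h => WideSubcategory.hom_ext _ (trivEval_rel h)) f
  map_id _ := rfl
  map_comp := by
    rintro _ _ _ ⟨s⟩ ⟨t⟩
    rfl

/-- The compatibility of `trivToWide` with units. -/
def trivToWideUnit : 𝟙_ (WideSubcategory P) ≅ (trivToWide P hP).obj (𝟙_ (PlusObj triv gcp)) :=
  Iso.refl _

/-- The compatibility of `trivToWide` with tensor products. -/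
def trivToWideTensor (φ ψ : PlusObj triv gcp) :
    (trivToWide P hP).obj φ ⊗ (trivToWide P hP).obj ψ ≅ (trivToWide P hP).obj (φ ⊗ ψ) :=
  Iso.refl _

/-- The functor `trivToWide` is strictly monoidal. -/
def trivToWideCore : (trivToWide P hP).CoreMonoidal where
  εIso := trivToWideUnit P hP
  μIso := trivToWideTensor P hP
  μIso_hom_natural_left := by
    rintro _ _ ⟨s⟩ _
    exact (Category.comp_id _).trans (Category.id_comp _).symm
  μIso_hom_natural_right := by
    rintro _ _ _ ⟨s⟩
    exact (Category.comp_id _).trans (Category.id_comp _).symm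
  associativity _ _ _ := NCSet.wide_hom_ext_of_isIso (by rintro ((i | i) | i) <;> rfl)
  left_unitality _ := NCSet.wide_hom_ext_of_isIso (by rintro (i | i); exacts [i.elim, rfl])
  right_unitality _ := NCSet.wide_hom_ext_of_isIso (by rintro (i | i); exacts [rfl, i.elim])

/-- The functor `trivToWide` is strictly symmetric monoidal. -/
instance : (trivToWide P hP).Braided where
  __ := (trivToWideCore P hP).toMonoidal
  braided _ _ := NCSet.wide_hom_ext_of_isIso (by rintro (i | i) <;> rfl)

end ToWide

end FeynmanTriple

/-! ### Permutations and the associative algebra in the plus construction -/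

namespace FeynmanTriple

namespace TrivPlus

variable {gcp : Prop}

/-- The positions of the target of a morphism of words. -/
abbrev pos (A : PlusObj triv gcp) : Type := (trivPos A.mor).carrier

/-- The isomorphism of words given by a bijection of positions. -/
abbrev wordIso {w w' : triv.F} (e : FreeSym.Pos (V := Discrete PUnit.{1}) w ≃
    FreeSym.Pos (V := Discrete PUnit.{1}) w') : w ≅ w' :=
  FreeSym.permIso (V := Discrete PUnit.{1}) e fun _ => Subsingleton.elim _ _

/-- The isomorphism of morphisms of words given by a bijection of positions. -/
def morIso {A B : PlusObj triv gcp} (e : pos A ≃ pos B) : A.mor ≅ B.mor :=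
  Comma.isoMk
    (wordIso ((trivPerm A.mor.hom).trans (e.trans (trivPerm B.mor.hom).symm))) (wordIso e)
    (triv_hom_ext fun _ => (trivPerm B.mor.hom).apply_symm_apply _)

/-- The isomorphism given by a bijection of positions. -/
def perm {A B : PlusObj triv gcp} (e : pos A ≃ pos B) : A ⟶ B :=
  PlusObj.isoMap (morIso e)

/-- The objects are themselves bijections, so commutativity of the square recovers the source
component from the target component. -/
theorem mor_hom_ext {φ ψ : Mor triv.F} {f g : φ ⟶ ψ}
    (h : ∀ i, trivPerm f.right i = trivPerm g.right i) : f = g := by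
  have hr : f.right = g.right := triv_hom_ext h
  refine Comma.hom_ext _ _ (triv_hom_ext fun i => (trivPerm ψ.hom).injective ?_) hr
  have hf : f.left ≫ ψ.hom = φ.hom ≫ f.right := f.w
  have hg : g.left ≫ ψ.hom = φ.hom ≫ g.right := g.w
  exact congrArg (fun k => trivPerm k i) (hf.trans ((congrArg (φ.hom ≫ ·) hr).trans hg.symm))

theorem isoMap_eq {A B : PlusObj triv gcp} (e : A.mor ≅ B.mor) :
    (PlusObj.isoMap e : A ⟶ B) = perm (trivPerm e.hom.right) :=
  PlusObj.isoMap_congr (mor_hom_ext fun _ => rfl)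

theorem perm_refl (A : PlusObj triv gcp) : perm (Equiv.refl (pos A)) = 𝟙 A :=
  PlusObj.isoMap_congr (e' := Iso.refl A.mor) (mor_hom_ext fun _ => rfl)

theorem perm_comp {A B C : PlusObj triv gcp} (e : pos A ≃ pos B) (e' : pos B ≃ pos C) :
    perm e ≫ perm e' = perm (e.trans e') :=
  (PlusObj.isoMap_comp _ _).trans (PlusObj.isoMap_congr (mor_hom_ext fun _ => rfl))

theorem perm_comp_symm {A B : PlusObj triv gcp} (e : pos A ≃ pos B) :
    perm e ≫ perm e.symm = 𝟙 A := by
  rw [perm_comp, Equiv.self_trans_symm, perm_refl]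

/-- Juxtaposition of bijections. -/
abbrev sumP {A B A' B' : PlusObj triv gcp} (e : pos A ≃ pos B) (e' : pos A' ≃ pos B') :
    pos (A ⊗ A') ≃ pos (B ⊗ B') :=
  Equiv.sumCongr e e'

theorem perm_tensor {A B A' B' : PlusObj triv gcp} (e : pos A ≃ pos B) (e' : pos A' ≃ pos B') :
    perm e ⊗ₘ perm e' = perm (sumP e e') :=
  (PlusObj.tensor_isoMap _ _).trans
    (PlusObj.isoMap_congr (mor_hom_ext (by rintro (i | i) <;> rfl)))

theorem perm_whiskerRight {A B : PlusObj triv gcp} (e : pos A ≃ pos B) (C : PlusObj triv gcp) :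
    perm e ▷ C = perm (sumP e (Equiv.refl (pos C))) := by
  rw [← tensorHom_id, ← perm_refl, perm_tensor]

theorem whiskerLeft_perm {A B : PlusObj triv gcp} (C : PlusObj triv gcp) (e : pos A ≃ pos B) :
    C ◁ perm e = perm (sumP (Equiv.refl (pos C)) e) := by
  rw [← id_tensorHom, ← perm_refl, perm_tensor]

/-- The bijection underlying the associator. -/
abbrev assocP (A B C : PlusObj triv gcp) : pos ((A ⊗ B) ⊗ C) ≃ pos (A ⊗ (B ⊗ C)) :=
  Equiv.sumAssoc _ _ _

/-- The bijection underlying the braiding. -/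
abbrev commP (A B : PlusObj triv gcp) : pos (A ⊗ B) ≃ pos (B ⊗ A) :=
  Equiv.sumComm _ _

/-- The bijection underlying the left unitor. -/
abbrev leftP (A : PlusObj triv gcp) : pos (𝟙_ _ ⊗ A) ≃ pos A :=
  Equiv.emptySum Empty _

/-- The bijection underlying the right unitor. -/
abbrev rightP (A : PlusObj triv gcp) : pos (A ⊗ 𝟙_ _) ≃ pos A :=
  Equiv.sumEmpty _ Empty

theorem associator_hom_eq (A B C : PlusObj triv gcp) : (α_ A B C).hom = perm (assocP A B C) :=
  isoMap_eq _

theorem associator_inv_eq (A B C : PlusObj triv gcp) :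
    (α_ A B C).inv = perm (assocP A B C).symm :=
  isoMap_eq _

theorem braiding_hom_eq (A B : PlusObj triv gcp) : (β_ A B).hom = perm (commP A B) :=
  isoMap_eq _

theorem leftUnitor_hom_eq (A : PlusObj triv gcp) : (λ_ A).hom = perm (leftP A) :=
  isoMap_eq _

theorem rightUnitor_hom_eq (A : PlusObj triv gcp) : (ρ_ A).hom = perm (rightP A) :=
  isoMap_eq _

theorem rightUnitor_inv_eq (A : PlusObj triv gcp) : (ρ_ A).inv = perm (rightP A).symm :=
  isoMap_eq _

/-- The map of positions, with orders on the fibers, underlying a morphism. -/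
def eval {A B : PlusObj triv gcp} (f : A ⟶ B) : trivPos A.mor ⟶ trivPos B.mor :=
  Quot.lift trivEval (fun _ _ h => trivEval_rel h) f

theorem eval_comp {A B C : PlusObj triv gcp} (f : A ⟶ B) (g : B ⟶ C) :
    eval (f ≫ g) = eval f ≫ eval g := by
  obtain ⟨s⟩ := f
  obtain ⟨t⟩ := g
  rfl

theorem eval_tensor {A B A' B' : PlusObj triv gcp} (f : A ⟶ B) (g : A' ⟶ B') :
    eval (f ⊗ₘ g) = NCSet.sumMap (eval f) (eval g) := by
  obtain ⟨s⟩ := f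
  obtain ⟨t⟩ := g
  rfl

theorem eval_perm {A B : PlusObj triv gcp} (e : pos A ≃ pos B) :
    eval (perm e) = NCSet.Hom.ofEquiv e :=
  rfl

/-- The identity of a word, as an object of the plus construction. -/
abbrev ofWord (w : FreeSym (Discrete PUnit.{1})) : PlusObj triv gcp := ⟨Mor.mk (C := triv.F) (𝟙 w)⟩

/-- The one-letter word. -/
abbrev letterWord : FreeSym (Discrete PUnit.{1}) := .of ⟨⟨⟩⟩

/-- The object with a single position. -/
abbrev one : PlusObj triv gcp := ofWord letterWord

theorem isTensor_of_target {X : triv.F} (a : X ⟶ (letterWord : triv.F)) : triv.IsTensor a :=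
  IsTensor.basic (𝔉 := triv) (v := ⟨⟨⟩⟩) a

/-- The multiplication. -/
def mul : (one ⊗ one : PlusObj triv gcp) ⟶ one :=
  -- The generator ends at the identity composed with itself, which is definitionally the identity
  -- of the letter.
  PlusObj.homMk (.gamma (𝔉 := triv) (v := ⟨⟨⟩⟩) (𝟙 letterWord) (𝟙 letterWord)
    (isTensor_of_target _))

theorem mul_assoc : (one ◁ mul) ≫ mul =
    (α_ one one one).inv ≫ (mul ▷ one) ≫ (mul : _ ⟶ (one : PlusObj triv gcp)) := by
  -- Associativity of `γ` with all three morphisms the identity of the letter and a single inner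
  -- `γ`. The comparison isomorphism at its end is the identity.
  refine (Quot.sound (.gamma_assoc (𝔉 := triv) (gcp := gcp) (v := ⟨⟨⟩⟩) (𝟙 letterWord)
      (b := 𝟙 letterWord)
    (a := 𝟙 letterWord) (isTensor_of_target _) (isTensor_of_target _) (isTensor_of_target _)
      (.basic (𝔉 := triv) (v := ⟨⟨⟩⟩) (𝟙 letterWord) (𝟙 letterWord)
        (isTensor_of_target _)))).trans ?_
  refine (congrArg (fun k : one ⟶ (one : PlusObj triv gcp) => (α_ one one one).inv ≫ (mul ▷ one) ≫
    mul ≫ k) ((isoMap_eq _).trans (perm_refl one))).trans ?_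
  rw [Category.comp_id]

/-- The unit. -/
def unit (h : gcp) : 𝟙_ (PlusObj triv gcp) ⟶ one :=
  PlusObj.homMk (.point (𝔉 := triv) h (v := ⟨⟨⟩⟩) (w := ⟨⟨⟩⟩) (𝟙 _))

theorem unit_mul (h : gcp) : (unit h ▷ one) ≫ mul = (λ_ one).hom := by
  rw [← cancel_epi (λ_ one).inv, Iso.inv_hom_id]
  refine (Quot.sound (.point_left (𝔉 := triv) h (Iso.refl (⟨⟨⟩⟩ : triv.V)) (𝟙 letterWord))).trans ?_
  exact (isoMap_eq _).trans (perm_refl one)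

theorem mul_unit (h : gcp) : (one ◁ unit h) ≫ mul = (ρ_ one).hom := by
  rw [← cancel_epi (ρ_ one).inv, Iso.inv_hom_id]
  refine (Quot.sound (.point_right (𝔉 := triv) h (v := ⟨⟨⟩⟩) (𝟙 letterWord)
    (Iso.refl letterWord) (isTensor_of_target _)
    (.basic (𝔉 := triv) h (v := ⟨⟨⟩⟩) (w := ⟨⟨⟩⟩) (𝟙 _)))).trans ?_
  exact (isoMap_eq _).trans (perm_refl one)

end TrivPlus

end FeynmanTriple

/-! ### Reduction to permutations, multiplication and unit -/

namespace FeynmanTriple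

theorem PlusObj.gamma_naturality {𝔉 : FeynmanTriple.{v₁, v₂, u₁, u₂}} {gcp : Prop}
    {X Y X' Y' : 𝔉.F} {v v' : 𝔉.V} {φ₀ : Y ⟶ 𝔉.ι.obj v} {φ₀' : Y' ⟶ 𝔉.ι.obj v'}
    {a : X ⟶ Y} {a' : X' ⟶ Y'} (ha : 𝔉.IsTensor a) (ha' : 𝔉.IsTensor a')
    (σ : X ≅ X') (τ : Y ≅ Y') (σ₀ : 𝔉.ι.obj v ≅ 𝔉.ι.obj v')
    (h : a ≫ τ.hom = σ.hom ≫ a') (h₀ : φ₀ ≫ σ₀.hom = τ.hom ≫ φ₀') :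
    ((isoMap (Mor.sd τ σ₀ h₀) : (⟨Mor.mk φ₀⟩ : PlusObj 𝔉 gcp) ⟶ ⟨Mor.mk φ₀'⟩) ⊗ₘ
      (isoMap (Mor.sd σ τ h) : (⟨Mor.mk a⟩ : PlusObj 𝔉 gcp) ⟶ ⟨Mor.mk a'⟩)) ≫
        (homMk (.gamma φ₀' a' ha') :
          (⟨Mor.mk φ₀'⟩ : PlusObj 𝔉 gcp) ⊗ ⟨Mor.mk a'⟩ ⟶ ⟨Mor.mk (a' ≫ φ₀')⟩) =
      homMk (.gamma φ₀ a ha) ≫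
        (isoMap (Mor.sd σ σ₀ (by rw [Category.assoc, h₀, reassoc_of% h])) :
          (⟨Mor.mk (a ≫ φ₀)⟩ : PlusObj 𝔉 gcp) ⟶ ⟨Mor.mk (a' ≫ φ₀')⟩) :=
  Quot.sound (.gamma_equivariant ha ha' σ τ σ₀ h h₀)

namespace TrivPlus

variable {gcp : Prop}

theorem exists_eq_of_perm_comp {A B C D : PlusObj triv gcp} {e : pos A ≃ pos C} {e' : pos B ≃ pos D}
    {f : C ⟶ D} {g : A ⟶ B} (h : perm e ≫ f = g ≫ perm e') :
    ∃ (e : pos A ≃ pos C) (e' : pos D ≃ pos B), g = perm e ≫ f ≫ perm e' :=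
  ⟨e, e'.symm, by rw [← Category.assoc, h, Category.assoc, perm_comp_symm, Category.comp_id]⟩

/-- Following `a` and `φ₀` to the final letter identifies `X` and `Y` with the one-letter word.
Equivariance along these isomorphisms turns the given `γ` into the one defining `mul`. -/
theorem gamma_eq {X Y : triv.F} {v : triv.V} (φ₀ : Y ⟶ triv.ι.obj v) (a : X ⟶ Y)
    (ha : triv.IsTensor a) :
    ∃ (e : pos ((⟨Mor.mk φ₀⟩ : PlusObj triv gcp) ⊗ ⟨Mor.mk a⟩) ≃ pos (one ⊗ one : PlusObj triv gcp))
      (e' : pos (one : PlusObj triv gcp) ≃ pos (⟨Mor.mk (a ≫ φ₀)⟩ : PlusObj triv gcp)),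
      (PlusObj.homMk (.gamma φ₀ a ha) :
        (⟨Mor.mk φ₀⟩ : PlusObj triv gcp) ⊗ ⟨Mor.mk a⟩ ⟶ ⟨Mor.mk (a ≫ φ₀)⟩) =
          perm e ≫ mul ≫ perm e' := by
  have h := PlusObj.gamma_naturality (𝔉 := triv) (gcp := gcp) (v' := ⟨⟨⟩⟩) (φ₀ := φ₀)
    (φ₀' := 𝟙 letterWord) (a := a) (a' := 𝟙 letterWord) ha (isTensor_of_target _)
    (wordIso ((trivPerm a).trans (trivPerm φ₀))) (wordIso (trivPerm φ₀)) (Iso.refl _)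
    (triv_hom_ext fun _ => rfl) (triv_hom_ext fun _ => rfl)
  rw [isoMap_eq, isoMap_eq, isoMap_eq, perm_tensor] at h
  exact exists_eq_of_perm_comp h

/-- A property of morphisms of the plus construction of the trivial Feynman category which holds
for isomorphisms, for the multiplication and the unit tensored with an object, and for composites,
holds for all morphisms. -/
theorem hom_induction {S : ∀ {A B : PlusObj triv gcp}, (A ⟶ B) → Prop}
    (h_perm : ∀ {A B : PlusObj triv gcp} (e : pos A ≃ pos B), S (perm e))
    (h_comp : ∀ {A B C : PlusObj triv gcp} (f : A ⟶ B) (g : B ⟶ C), S f → S g → S (f ≫ g))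
    (h_mul : ∀ C : PlusObj triv gcp, S (mul ▷ C))
    (h_unit : ∀ h (C : PlusObj triv gcp), S (unit h ▷ C))
    {A B : PlusObj triv gcp} (f : A ⟶ B) : S f := by
  -- Tensoring with an arbitrary `C` is part of the induction statement, since a tensor product of
  -- generators is handled by applying them one after the other beside a spectator.
  have key : ∀ {φ ψ : Mor triv.F} (s : triv.PlusPre gcp φ ψ) (C : PlusObj triv gcp),
      S ((PlusObj.homMk s : (⟨φ⟩ : PlusObj triv gcp) ⟶ ⟨ψ⟩) ▷ C) := by
    intro φ ψ s
    induction s with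
    | iso e =>
      intro C
      change S (PlusObj.isoMap e ▷ C)
      rw [isoMap_eq, perm_whiskerRight]
      exact h_perm _
    | @comp φ ψ χ s t hs ht =>
      intro C
      change S (((PlusObj.homMk s : (⟨φ⟩ : PlusObj triv gcp) ⟶ ⟨ψ⟩) ≫
        (PlusObj.homMk t : (⟨ψ⟩ : PlusObj triv gcp) ⟶ ⟨χ⟩)) ▷ C)
      rw [comp_whiskerRight]
      exact h_comp _ _ (hs C) (ht C)
    | @tensor φ ψ φ' ψ' s t hs ht =>
      intro C
      change S (((PlusObj.homMk s : (⟨φ⟩ : PlusObj triv gcp) ⟶ ⟨ψ⟩) ⊗ₘ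
        (PlusObj.homMk t : (⟨φ'⟩ : PlusObj triv gcp) ⟶ ⟨ψ'⟩)) ▷ C)
      have hr : ∀ {A B : PlusObj triv gcp} {f : A ⟶ B} (hf : ∀ C, S (f ▷ C)) (D C),
          S ((f ▷ D) ▷ C) := by
        intro A B f hf D C
        rw [whiskerRight_tensor_symm, associator_hom_eq, associator_inv_eq]
        exact h_comp _ _ (h_perm _) (h_comp _ _ (hf _) (h_perm _))
      rw [MonoidalCategory.tensorHom_def, comp_whiskerRight]
      refine h_comp _ _ (hr hs _ _) ?_
      -- The symmetry turns left whiskering into right whiskering, the only kind covered by the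
      -- hypotheses.
      have : (⟨ψ⟩ : PlusObj triv gcp) ◁
          (PlusObj.homMk t : (⟨φ'⟩ : PlusObj triv gcp) ⟶ ⟨ψ'⟩) = (β_ _ _).hom ≫
          ((PlusObj.homMk t : (⟨φ'⟩ : PlusObj triv gcp) ⟶ ⟨ψ'⟩) ▷ _) ≫ (β_ _ _).hom := by
        rw [← BraidedCategory.braiding_naturality_right_assoc, SymmetricCategory.symmetry,
          Category.comp_id]
      rw [this, comp_whiskerRight, comp_whiskerRight, braiding_hom_eq, braiding_hom_eq,
        perm_whiskerRight, perm_whiskerRight]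
      exact h_comp _ _ (h_perm _) (h_comp _ _ (hr ht _ _) (h_perm _))
    | gamma φ₀ a ha =>
      intro C
      obtain ⟨e, e', h⟩ := gamma_eq (gcp := gcp) φ₀ a ha
      refine cast (congrArg (fun k => S (k ▷ C)) h.symm) ?_
      rw [comp_whiskerRight, comp_whiskerRight, perm_whiskerRight, perm_whiskerRight]
      exact h_comp _ _ (h_perm _) (h_comp _ _ (h_mul _) (h_perm _))
    | point h σ =>
      intro C
      -- The groupoid has one object and one morphism, so every point is definitionally `unit h`.
      exact h_unit h C
  obtain ⟨s⟩ := f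
  -- Taking the spectator to be the tensor unit and conjugating by right unitors recovers the bare
  -- morphism.
  have := h_comp _ _ (h_comp _ _ (h_perm (rightP A).symm) (key s (𝟙_ _))) (h_perm (rightP B))
  rw [← rightUnitor_hom_eq, ← rightUnitor_inv_eq, Category.assoc, rightUnitor_naturality,
    Iso.inv_hom_id_assoc] at this
  exact this

end TrivPlus

end FeynmanTriple

/-! ### Bijections of disjoint unions with marked points -/

/-- A bijection of disjoint unions which respects the two parts. -/
theorem Equiv.exists_eq_sumCongr {A B C D : Type*} (e : A ⊕ B ≃ C ⊕ D)
    (h : ∀ x, (e x).isLeft = x.isLeft) :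
    ∃ (e₁ : A ≃ C) (e₂ : B ≃ D), e = Equiv.sumCongr e₁ e₂ := by
  have h₁ : ∀ a, ∃ c, e (Sum.inl a) = Sum.inl c := fun a => Sum.isLeft_iff.1 (h (Sum.inl a))
  have h₂ : ∀ b, ∃ d, e (Sum.inr b) = Sum.inr d := fun b =>
    Sum.isRight_iff.1 (by simpa using h (Sum.inr b))
  have h₃ : ∀ c, ∃ a, e (Sum.inl a) = Sum.inl c := by
    intro c
    obtain ⟨a | b, hx⟩ := e.surjective (Sum.inl c)
    · exact ⟨a, hx⟩
    · obtain ⟨d, hd⟩ := h₂ b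
      rw [hd] at hx
      cases hx
  have h₄ : ∀ d, ∃ b, e (Sum.inr b) = Sum.inr d := by
    intro d
    obtain ⟨a | b, hx⟩ := e.surjective (Sum.inr d)
    · obtain ⟨c, hc⟩ := h₁ a
      rw [hc] at hx
      cases hx
    · exact ⟨b, hx⟩
  choose f hf using h₁
  choose g hg using h₂
  refine ⟨Equiv.ofBijective f ⟨fun a a' haa => ?_, fun c => ?_⟩,
    Equiv.ofBijective g ⟨fun b b' hbb => ?_, fun d => ?_⟩, Equiv.ext ?_⟩
  · exact Sum.inl_injective (e.injective (by rw [hf, hf, haa]))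
  · obtain ⟨a, ha⟩ := h₃ c
    exact ⟨a, Sum.inl_injective ((hf a).symm.trans ha)⟩
  · exact Sum.inr_injective (e.injective (by rw [hg, hg, hbb]))
  · obtain ⟨b, hb⟩ := h₄ d
    exact ⟨b, Sum.inr_injective ((hg b).symm.trans hb)⟩
  · rintro (a | b)
    · exact hf a
    · exact hg b

theorem Equiv.exists_eq_sumCongr_refl {B D : Type*} (e : Unit ⊕ B ≃ Unit ⊕ D)
    (h : e (Sum.inl ()) = Sum.inl ()) :
    ∃ e₂ : B ≃ D, e = Equiv.sumCongr (Equiv.refl Unit) e₂ := by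
  obtain ⟨e₁, e₂, rfl⟩ := e.exists_eq_sumCongr (by
    rintro (x | b)
    · rw [h]
      rfl
    · rcases hb : e (Sum.inr b) with y | y
      · cases e.injective (hb.trans h.symm)
      · rfl)
  exact ⟨e₂, congrArg₂ _ (Equiv.ext fun _ => rfl) rfl⟩

theorem Equiv.exists_split {A A' : Type} (y : A) (e : {x : A // x ≠ y} ≃ A') :
    ∃ q : A ≃ Unit ⊕ A', q y = Sum.inl () := by
  classical
  refine ⟨(Equiv.optionSubtypeNe y).symm.trans ((Equiv.optionEquivSumPUnit.{0} _).trans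
    ((Equiv.sumComm _ _).trans (Equiv.sumCongr (Equiv.refl Unit) e))), ?_⟩
  simp

/-- Once `B₁` is split at the image `b` of the marked point, the bijection fixes that point and is
therefore the identity plus a bijection of the rest. The factors are written as associators and
juxtapositions so that they become structural morphisms under `perm`. -/
theorem Equiv.exists_eq_split {C B₁ B₂ C₁ : Type} (e : Unit ⊕ C ≃ B₁ ⊕ B₂) {b : B₁}
    (hb : e (Sum.inl ()) = Sum.inl b) (q : B₁ ≃ Unit ⊕ C₁) (hq : q b = Sum.inl ()) :
    ∃ r : C ≃ C₁ ⊕ B₂, e = (Equiv.sumCongr (Equiv.refl Unit) r).trans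
      ((Equiv.sumAssoc Unit C₁ B₂).symm.trans (Equiv.sumCongr q.symm (Equiv.refl B₂))) := by
  obtain ⟨r, hr⟩ := Equiv.exists_eq_sumCongr_refl
    (e.trans ((Equiv.sumCongr q (Equiv.refl _)).trans (Equiv.sumAssoc _ _ _))) (by simp [hb, hq])
  refine ⟨r, ?_⟩
  rw [← hr]
  ext x
  simp

/-- Letters are appended one at a time. This is the source of essential surjectivity, both for sets
of positions and for functors out of words. -/
theorem FreeSym.exists_pos_equiv {V : Type u₁} {T : Type} [Finite T] (l : T → V) :
    ∃ (w : FreeSym V) (e : w.Pos ≃ T), ∀ i, w.letter i = l (e i) := by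
  induction T using Finite.induction_empty_option with
  | of_equiv e ih =>
    obtain ⟨w, e', h⟩ := ih (l ∘ e)
    exact ⟨w, e'.trans e, h⟩
  | h_empty => exact ⟨.unit, Equiv.equivOfIsEmpty Empty PEmpty, fun i => i.elim⟩
  | h_option ih =>
    obtain ⟨w, e', h⟩ := ih (l ∘ some)
    refine ⟨.tensor w (.of (l none)),
      (Equiv.sumCongr e' (Equiv.refl Unit)).trans (Equiv.optionEquivSumPUnit.{0} _).symm, ?_⟩
    rintro (i | i)
    · exact h i
    · rfl

/-! ### Splitting morphisms into tensor products -/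

namespace FeynmanTriple

namespace TrivPlus

variable {gcp : Prop}

theorem exists_pos_equiv (gcp : Prop) (T : Type) [Finite T] :
    ∃ A : PlusObj triv gcp, Nonempty (pos A ≃ T) := by
  obtain ⟨w, e, -⟩ := FreeSym.exists_pos_equiv (fun _ : T => (⟨⟨⟩⟩ : Discrete PUnit.{1}))
  exact ⟨ofWord w, ⟨e⟩⟩

theorem exists_split (A : PlusObj triv gcp) (y : pos A) :
    ∃ (A' : PlusObj triv gcp) (e : pos A ≃ pos (one ⊗ A')), e y = Sum.inl () := by
  classical
  have : Finite (pos A) := (trivPos A.mor).finite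
  obtain ⟨A', ⟨e⟩⟩ := exists_pos_equiv gcp {x : pos A // x ≠ y}
  obtain ⟨q, hq⟩ := Equiv.exists_split y e.symm
  exact ⟨A', q, hq⟩

/-- Every morphism into a tensor product is a tensor product, up to isomorphism. -/
def Splits {A B : PlusObj triv gcp} (f : A ⟶ B) : Prop :=
  ∀ (B₁ B₂ : PlusObj triv gcp) (e : pos B ≃ pos (B₁ ⊗ B₂)),
    ∃ (A₁ A₂ : PlusObj triv gcp) (e' : pos A ≃ pos (A₁ ⊗ A₂)) (f₁ : A₁ ⟶ B₁) (f₂ : A₂ ⟶ B₂),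
      f ≫ perm e = perm e' ≫ (f₁ ⊗ₘ f₂)

/-- The single output of `g` lies in one of the two factors; `g` goes entirely to that factor, and
the spectators are distributed as `e` dictates. -/
theorem splits_whiskerRight {X : PlusObj triv gcp} (g : X ⟶ one) (C : PlusObj triv gcp) :
    Splits (g ▷ C) := by
  have key : ∀ (B₁ B₂ : PlusObj triv gcp) (e : pos (one ⊗ C) ≃ pos (B₁ ⊗ B₂)) (b : pos B₁)
      (_ : e (Sum.inl ()) = Sum.inl b), ∃ (A₁ A₂ : PlusObj triv gcp)
      (e' : pos (X ⊗ C) ≃ pos (A₁ ⊗ A₂)) (f₁ : A₁ ⟶ B₁) (f₂ : A₂ ⟶ B₂),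
      (g ▷ C) ≫ perm e = perm e' ≫ (f₁ ⊗ₘ f₂) := by
    intro B₁ B₂ e b hb
    obtain ⟨C₁, q, hq⟩ := exists_split B₁ b
    obtain ⟨r, he⟩ : ∃ r : pos C ≃ pos (C₁ ⊗ B₂), e = (sumP (Equiv.refl _) r).trans
        ((assocP one C₁ B₂).symm.trans (sumP q.symm (Equiv.refl _))) :=
      Equiv.exists_eq_split e hb q hq
    -- Here `B₁` is the output of `g` together with `C₁`, so `g` and the spectators in `C₁` form the
    -- first factor and the second factor is an identity.
    refine ⟨X ⊗ C₁, B₂, (sumP (Equiv.refl _) r).trans (assocP X C₁ B₂).symm,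
      (g ▷ C₁) ≫ perm q.symm, 𝟙 _, ?_⟩
    rw [he, ← perm_comp, ← perm_comp, ← whiskerLeft_perm, ← perm_whiskerRight,
      ← associator_inv_eq, ← perm_comp, ← whiskerLeft_perm, ← associator_inv_eq, tensorHom_id,
      comp_whiskerRight, Category.assoc, ← associator_inv_naturality_left_assoc,
      whisker_exchange_assoc]
  intro B₁ B₂ e
  rcases hx : e (Sum.inl ()) with b | b
  · exact key B₁ B₂ e b hx
  -- If the output lies in the second factor, exchange the factors and exchange them back
  -- afterwards.
  · obtain ⟨A₁, A₂, e', f₁, f₂, h⟩ := key B₂ B₁ (e.trans (commP _ _)) b 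
      (congrArg (commP B₁ B₂) hx)
    refine ⟨A₂, A₁, e'.trans (commP _ _), f₂, f₁, ?_⟩
    rw [← perm_comp, ← braiding_hom_eq, Category.assoc, ← BraidedCategory.braiding_naturality,
      ← reassoc_of% h, ← perm_comp, ← braiding_hom_eq, Category.assoc, SymmetricCategory.symmetry,
      Category.comp_id]

theorem splits {A B : PlusObj triv gcp} (f : A ⟶ B) : Splits f := by
  induction f using hom_induction with
  | h_perm e =>
    intro B₁ B₂ e'
    exact ⟨B₁, B₂, e.trans e', 𝟙 _, 𝟙 _, by rw [perm_comp, id_tensorHom_id, Category.comp_id]⟩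
  | h_comp f g hf hg =>
    intro C₁ C₂ e
    obtain ⟨B₁, B₂, e', g₁, g₂, h⟩ := hg C₁ C₂ e
    obtain ⟨A₁, A₂, e'', f₁, f₂, h'⟩ := hf B₁ B₂ e'
    exact ⟨A₁, A₂, e'', f₁ ≫ g₁, f₂ ≫ g₂, by
      rw [Category.assoc, h, reassoc_of% h', tensorHom_comp_tensorHom]⟩
  | h_mul C => exact splits_whiskerRight _ _
  | h_unit h C => exact splits_whiskerRight _ _

/-- A multiplication or unit leaves an output position, so neither can occur over an empty target.
This is the empty-word case of faithfulness. -/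
theorem eq_perm_of_isEmpty {A B : PlusObj triv gcp} (f : A ⟶ B) :
    IsEmpty (pos B) → ∃ e, f = perm e := by
  induction f using hom_induction with
  | h_perm e => exact fun _ => ⟨e, rfl⟩
  | h_comp f g hf hg =>
    intro hC
    obtain ⟨e, rfl⟩ := hg hC
    obtain ⟨e', rfl⟩ := hf e.isEmpty
    exact ⟨_, perm_comp _ _⟩
  | h_mul C => exact fun h => (h.false (Sum.inl ())).elim
  | h_unit _ C => exact fun h => (h.false (Sum.inl ())).elim

end TrivPlus

end FeynmanTriple

/-! ### Normal form of operations with one output -/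

/-- A bijection which does not preserve the marked point factors through the exchange of the two
outer summands. -/
theorem Equiv.exists_eq_exchange {C C' D : Type} (e : Unit ⊕ C ≃ Unit ⊕ D) (c : C)
    (hc : e (Sum.inr c) = Sum.inl ()) (q : C ≃ Unit ⊕ C') (hq : q c = Sum.inl ()) :
    ∃ r : Unit ⊕ C' ≃ D, e = (Equiv.sumCongr (Equiv.refl Unit) q).trans
      ((Equiv.sumAssoc Unit Unit C').symm.trans
        ((Equiv.sumCongr (Equiv.sumComm Unit Unit) (Equiv.refl C')).trans
          ((Equiv.sumAssoc Unit Unit C').trans (Equiv.sumCongr (Equiv.refl Unit) r)))) := by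
  have hq' : q.symm (Sum.inl ()) = c := by rw [← hq, Equiv.symm_apply_apply]
  obtain ⟨r, hr⟩ := Equiv.exists_eq_sumCongr_refl ((Equiv.sumAssoc Unit Unit C').symm.trans
    ((Equiv.sumCongr (Equiv.sumComm Unit Unit) (Equiv.refl C')).trans
      ((Equiv.sumAssoc Unit Unit C').trans ((Equiv.sumCongr (Equiv.refl Unit) q.symm).trans e))))
    (by simp [hq', hc])
  refine ⟨r, ?_⟩
  rw [← hr]
  ext x
  rcases x with x | x
  · simp
  · obtain ⟨y | y, rfl⟩ := q.symm.surjective x <;> simp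

namespace FeynmanTriple

namespace TrivPlus

variable {gcp : Prop}

/-- The tensor powers of the object with one position. -/
def pow (gcp : Prop) : ℕ → PlusObj triv gcp
  | 0 => 𝟙_ _
  | n + 1 => one ⊗ pow gcp n

/-- The iterated multiplication. -/
def iter : ∀ n, pow gcp (n + 1) ⟶ one
  -- `iter n` has `n + 1` factors: the empty product exists only in the gcp version and is kept
  -- apart as `unit`.
  | 0 => (ρ_ one).hom
  | n + 1 => (one ◁ iter n) ≫ mul

/-- Iterated multiplications and units, up to isomorphism. -/
def IsProd {A : PlusObj triv gcp} (f : A ⟶ one) : Prop :=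
  (∃ (n : ℕ) (e : pos A ≃ pos (pow gcp (n + 1))), f = perm e ≫ iter n) ∨
    ∃ (h : gcp) (e : pos A ≃ pos (𝟙_ (PlusObj triv gcp))), f = perm e ≫ unit h

theorem IsProd.perm_comp {A B : PlusObj triv gcp} {f : B ⟶ one} (hf : IsProd f)
    (e : pos A ≃ pos B) : IsProd (perm e ≫ f) := by
  rcases hf with ⟨n, e', rfl⟩ | ⟨h, e', rfl⟩
  · exact Or.inl ⟨n, e.trans e', by rw [← TrivPlus.perm_comp, Category.assoc]⟩
  · exact Or.inr ⟨h, e.trans e', by rw [← TrivPlus.perm_comp, Category.assoc]⟩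

/-- A new first factor lengthens a product by one; multiplied by the unit it leaves the one-factor
product. -/
theorem IsProd.whiskerLeft_mul {A : PlusObj triv gcp} {f : A ⟶ one} (hf : IsProd f) :
    IsProd ((one ◁ f) ≫ mul) := by
  rcases hf with ⟨n, e', rfl⟩ | ⟨h, e', rfl⟩
  · rw [MonoidalCategory.whiskerLeft_comp, whiskerLeft_perm, Category.assoc]
    exact Or.inl ⟨n + 1, _, rfl⟩
  · rw [MonoidalCategory.whiskerLeft_comp, whiskerLeft_perm, Category.assoc, mul_unit]
    exact Or.inl ⟨0, _, rfl⟩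

theorem isProd_id : IsProd (𝟙 (one : PlusObj triv gcp)) :=
  Or.inl ⟨0, (rightP one).symm, 
    ((congrArg (· ≫ (ρ_ one).hom) (rightUnitor_inv_eq one)).symm.trans (ρ_ one).inv_hom_id).symm⟩

theorem isProd_mul : IsProd (mul : _ ⟶ (one : PlusObj triv gcp)) := by
  have := (isProd_id (gcp := gcp)).whiskerLeft_mul
  rwa [MonoidalCategory.whiskerLeft_id, Category.id_comp] at this

theorem isProd_unit (h : gcp) : IsProd (unit h) :=
  Or.inr ⟨h, Equiv.refl _, by rw [perm_refl, Category.id_comp]⟩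

/-- Rebracketing `(x y) f` as `x (y f)` prepends two factors in turn. -/
theorem isProd_mul_whiskerRight {A : PlusObj triv gcp} {f : A ⟶ one} (hf : IsProd f) :
    IsProd ((mul ▷ A) ≫ (one ◁ f) ≫ mul) := by
  have h : (mul ▷ A) ≫ (one ◁ f) ≫ mul = (α_ one one A).hom ≫ (one ◁ ((one ◁ f) ≫ mul)) ≫ mul := by
    rw [← whisker_exchange_assoc, MonoidalCategory.whiskerLeft_comp, Category.assoc, mul_assoc]
    simp
  rw [h, associator_hom_eq]
  exact hf.whiskerLeft_mul.whiskerLeft_mul.perm_comp _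

theorem isProd_unit_whiskerRight (h : gcp) {A : PlusObj triv gcp} {f : A ⟶ one} (hf : IsProd f) :
    IsProd ((unit h ▷ A) ≫ (one ◁ f) ≫ mul) := by
  rw [← whisker_exchange_assoc, unit_mul, leftUnitor_naturality, leftUnitor_hom_eq]
  exact hf.perm_comp _

/-- Substituting `g` for one factor of a product keeps the normal form. The hypothesis `hg'` treats
`g` in front of further factors, `hg` a product with only one factor. If `g` sits further back, the
first factor is a spectator that can be split off, which shortens the product. -/
theorem isProd_whiskerRight_comp_iter {X : PlusObj triv gcp} {g : X ⟶ one} (hg : IsProd g)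
    (hg' : ∀ {A : PlusObj triv gcp} {f : A ⟶ one}, IsProd f → IsProd ((g ▷ A) ≫ (one ◁ f) ≫ mul))
    (n : ℕ) (C : PlusObj triv gcp) (e : pos (one ⊗ C) ≃ pos (pow gcp (n + 1))) :
    IsProd ((g ▷ C) ≫ perm e ≫ iter n) := by
  have key : ∀ (n : ℕ) (C : PlusObj triv gcp) (e : pos (one ⊗ C) ≃ pos (pow gcp (n + 1)))
      (_ : e (Sum.inl ()) = Sum.inl ()), IsProd ((g ▷ C) ≫ perm e ≫ iter n) := by
    intro n C e he
    obtain ⟨r, rfl⟩ : ∃ r : pos C ≃ pos (pow gcp n),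
        e = sumP (A := one) (B := one) (Equiv.refl _) r :=
      Equiv.exists_eq_sumCongr_refl e he
    have : perm (A := one ⊗ C) (B := one ⊗ pow gcp n) (sumP (Equiv.refl _) r) = one ◁ perm r :=
      (whiskerLeft_perm _ _).symm
    rcases n with _ | n
    · have h₀ : ∀ r : pos C ≃ pos (𝟙_ (PlusObj triv gcp)),
          IsProd ((g ▷ C) ≫ (one ◁ perm r) ≫ (ρ_ one).hom) := by
        intro r
        rw [← whisker_exchange_assoc, rightUnitor_naturality, rightUnitor_hom_eq, whiskerLeft_perm]
        exact (hg.perm_comp _).perm_comp _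
      exact cast (congrArg (fun k => IsProd ((g ▷ C) ≫ k ≫ (ρ_ one).hom)) this.symm) (h₀ r)
    · change IsProd ((g ▷ C) ≫ perm (A := one ⊗ C) (B := one ⊗ pow gcp (n + 1))
        (sumP (Equiv.refl _) r) ≫ (one ◁ iter n) ≫ mul)
      rw [this, ← MonoidalCategory.whiskerLeft_comp_assoc]
      exact hg' (Or.inl ⟨n, r, rfl⟩)
  induction n generalizing C with
  | zero =>
    refine key 0 C e ?_
    rcases hx : e (Sum.inl ()) with x | x
    · rfl
    · exact x.elim
  | succ n ih =>
    rcases hx : e (Sum.inl ()) with x | x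
    · exact key _ C e hx
    rcases hc : e.symm (Sum.inl ()) with c | c
    · have := (e.symm_apply_eq.1 hc).trans hx
      cases this
    -- The position `c` is the spectator that occupies the first place of the product.
    obtain ⟨C', q, hq⟩ := exists_split C c
    obtain ⟨r, he⟩ : ∃ r : pos (one ⊗ C') ≃ pos (pow gcp (n + 1)),
        e = (sumP (A := one) (B := one) (Equiv.refl _) q).trans ((assocP one one C').symm.trans
          ((sumP (commP one one) (Equiv.refl (pos C'))).trans ((assocP one one C').trans
            (sumP (A := one) (B := one) (Equiv.refl _) r)))) :=
      Equiv.exists_eq_exchange e c (e.symm_apply_eq.1 hc).symm q hq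
    -- Moving `c` in front of `X` by the symmetry leaves `g` inside the remaining `n + 1` factors,
    -- where induction applies.
    have h : (g ▷ C) ≫ perm e ≫ iter (n + 1) =
        (X ◁ perm q) ≫ (α_ X one C').inv ≫ ((β_ X one).hom ▷ C') ≫ (α_ one X C').hom ≫
          (one ◁ ((g ▷ C') ≫ perm r ≫ iter n)) ≫ mul := by
      have h₁ : perm e = (one ◁ perm q) ≫ (α_ one one C').inv ≫ ((β_ one one).hom ▷ C') ≫
          (α_ one one C').hom ≫ (one ◁ perm r) := by
        rw [he, associator_inv_eq, associator_hom_eq, braiding_hom_eq, whiskerLeft_perm,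
          whiskerLeft_perm, perm_whiskerRight, perm_comp, perm_comp, perm_comp]
        exact (perm_comp _ _).symm
      change _ ≫ _ ≫ (one ◁ iter n) ≫ mul = _
      have h₂ : perm e ≫ (one ◁ iter n) ≫ mul = (one ◁ perm q) ≫ (α_ one one C').inv ≫
          ((β_ one one).hom ▷ C') ≫ (α_ one one C').hom ≫ (one ◁ perm r) ≫
            (one ◁ iter n) ≫ mul := by
        refine (congrArg (· ≫ (one ◁ iter n) ≫ mul) h₁).trans ?_
        simp only [Category.assoc]
      refine (congrArg ((g ▷ C) ≫ ·) h₂).trans ?_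
      rw [← whisker_exchange_assoc, associator_inv_naturality_left_assoc,
        ← comp_whiskerRight_assoc, BraidedCategory.braiding_naturality_left]
      simp
    have h' := ((ih C' r).whiskerLeft_mul.perm_comp (assocP one X C')).perm_comp
      (sumP (commP X one) (Equiv.refl (pos C')))
    have h'' := (h'.perm_comp (assocP X one C').symm).perm_comp (sumP (Equiv.refl (pos X)) q)
    rw [← associator_hom_eq, ← associator_inv_eq, ← whiskerLeft_perm, ← perm_whiskerRight,
      ← braiding_hom_eq] at h''
    rw [← h] at h''
    exact h''

/-- Normal forms are closed under precomposition with every generator, hence with every morphism;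
apply this to the identity of `one`. -/
theorem isProd {A : PlusObj triv gcp} (f : A ⟶ one) : IsProd f := by
  have key : ∀ {A B : PlusObj triv gcp} (f : A ⟶ B) (k : B ⟶ one), IsProd k → IsProd (f ≫ k) := by
    intro A B f
    induction f using hom_induction with
    | h_perm e => exact fun k hk => hk.perm_comp e
    | h_comp f g hf hg =>
      intro k hk
      rw [Category.assoc]
      exact hf _ (hg _ hk)
    | h_mul C =>
      rintro k (⟨n, e, rfl⟩ | ⟨h, e, rfl⟩)
      · exact isProd_whiskerRight_comp_iter isProd_mul isProd_mul_whiskerRight n C e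
      -- The unit has no input, whereas the target of `mul ▷ C` has a position.
      · exact (e (Sum.inl ())).elim
    | h_unit h C =>
      rintro k (⟨n, e, rfl⟩ | ⟨h', e, rfl⟩)
      · exact isProd_whiskerRight_comp_iter (isProd_unit h) (isProd_unit_whiskerRight h) n C e
      · exact (e (Sum.inl ())).elim
  have := key f _ isProd_id
  rwa [Category.comp_id] at this

end TrivPlus

end FeynmanTriple

/-! ### Finite linear orders and disjoint unions of morphisms -/

theorem Sum.isLeft_eq_of_map_eq_map {A B A' B' C D : Type*} {f : A → C} {g : B → D} {f' : A' → C}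
    {g' : B' → D} {x : A ⊕ B} {y : A' ⊕ B'} (h : Sum.map f g x = Sum.map f' g' y) :
    x.isLeft = y.isLeft := by
  rcases x with x | x <;> rcases y with y | y <;> simp_all

theorem Sum.map_apply_map_symm {A B C D : Type*} (e : A ≃ C) (e' : B ≃ D) (x : C ⊕ D) :
    Sum.map e e' (Sum.map e.symm e'.symm x) = x := by
  rcases x with x | x <;> simp

namespace NCSet

theorem isStrictTotalOrder_lt {S T : NCSet} (f : S ⟶ T) [Subsingleton T.carrier] :
    IsStrictTotalOrder S.carrier f.lt where
  irrefl := f.irrefl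
  trans _ _ _ := f.trans
  trichotomous x y h h' := by
    rcases f.total (Subsingleton.elim (f.toFun x) (f.toFun y)) with h₁ | h₁ | h₁
    · exact (h h₁).elim
    · exact h₁
    · exact (h' h₁).elim

/-- Finite totally ordered sets with the same number of elements are isomorphic. -/
theorem exists_equiv_lt {S T S' T' : NCSet} (f : S ⟶ T) (g : S' ⟶ T') [Subsingleton T.carrier]
    [Subsingleton T'.carrier] (h : Nat.card S.carrier = Nat.card S'.carrier) :
    ∃ e : S.carrier ≃ S'.carrier, ∀ x y, f.lt x y ↔ g.lt (e x) (e y) := by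
  classical
  have := isStrictTotalOrder_lt f
  have := isStrictTotalOrder_lt g
  have := Fintype.ofFinite S.carrier
  have := Fintype.ofFinite S'.carrier
  rw [Nat.card_eq_fintype_card, Nat.card_eq_fintype_card] at h
  let _ := linearOrderOfSTO f.lt
  let _ := linearOrderOfSTO g.lt
  let e := (Fintype.orderIsoFinOfCardEq S.carrier rfl).symm.trans
    (Fintype.orderIsoFinOfCardEq S'.carrier h.symm)
  exact ⟨e.toEquiv, fun x y => (e.lt_iff_lt (x := x) (y := y)).symm⟩

/-- Isomorphisms of finite totally ordered sets are unique. -/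
theorem equiv_lt_unique {S S' T' : NCSet} (g : S' ⟶ T') [Subsingleton T'.carrier]
    (e e' : S.carrier ≃ S'.carrier)
    (h : ∀ x y, g.lt (e x) (e y) ↔ g.lt (e' x) (e' y)) : e = e' := by
  have := isStrictTotalOrder_lt g
  have : IsWellFounded S'.carrier g.lt := ⟨Finite.wellFounded_of_trans_of_irrefl _⟩
  let φ : g.lt ≃r g.lt := ⟨e.symm.trans e', fun {x y} => by simp [← h]⟩
  have hφ : φ = RelIso.refl _ := by
    have := congrArg (fun k : InitialSeg g.lt g.lt => (k : S'.carrier → S'.carrier))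
      (Subsingleton.elim φ.toInitialSeg (RelIso.refl g.lt).toInitialSeg)
    exact RelIso.ext fun x => congrFun this x
  ext x
  have := congrArg (fun k : g.lt ≃r g.lt => k (e x)) hφ
  simpa [φ] using this.symm

theorem sumMap_inj {S T S' T' : NCSet} {f g : S ⟶ T} {f' g' : S' ⟶ T'}
    (h : sumMap f f' = sumMap g g') : f = g ∧ f' = g' := by
  have h₁ : ∀ x, (sumMap f f').toFun x = (sumMap g g').toFun x := fun x => by rw [h]
  have h₂ : ∀ x y, (sumMap f f').lt x y ↔ (sumMap g g').lt x y := fun x y => by rw [h]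
  exact ⟨hom_ext (fun x => Sum.inl_injective (h₁ (Sum.inl x)))
      fun x y => Sum.liftRel_inl_inl.symm.trans
        ((h₂ (Sum.inl x) (Sum.inl y)).trans Sum.liftRel_inl_inl),
    hom_ext (fun x => Sum.inr_injective (h₁ (Sum.inr x)))
      fun x y => Sum.liftRel_inr_inr.symm.trans
        ((h₂ (Sum.inr x) (Sum.inr y)).trans Sum.liftRel_inr_inr)⟩

/-- Every morphism into a disjoint union is a disjoint union, up to a bijection of the source. -/
theorem exists_eq_sumMap {S T₁ T₂ : NCSet} (f : S ⟶ T₁ ⊗ T₂) :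
    ∃ (S₁ S₂ : NCSet) (e : S.carrier ≃ (S₁ ⊗ S₂).carrier) (f₁ : S₁ ⟶ T₁) (f₂ : S₂ ⟶ T₂),
      f = (isoOfEquiv e).hom ≫ (f₁ ⊗ₘ f₂) := by
  classical
  have hl : ∀ x : {x // (f.toFun x).isLeft}, ∃ t, f.toFun x = Sum.inl t :=
    fun x => Sum.isLeft_iff.1 x.2
  have hr : ∀ x : {x // ¬ (f.toFun x).isLeft}, ∃ t, f.toFun x = Sum.inr t :=
    fun x => Sum.isRight_iff.1 (by simpa using x.2)
  choose f₁ h₁ using hl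
  choose f₂ h₂ using hr
  let S₁ : NCSet := ⟨{x // (f.toFun x).isLeft}⟩
  let S₂ : NCSet := ⟨{x // ¬ (f.toFun x).isLeft}⟩
  let e : (S₁ ⊗ S₂).carrier ≃ S.carrier := Equiv.sumCompl _
  let g₁ : S₁ ⟶ T₁ :=
    { toFun := f₁
      lt := fun x y => f.lt x y
      fiber := fun {x y} h => Sum.inl_injective ((h₁ x).symm.trans ((f.fiber h).trans (h₁ y)))
      irrefl := fun x => f.irrefl x
      trans := f.trans
      total := fun {x y} h => 
        (f.total ((h₁ x).trans ((congrArg Sum.inl h).trans (h₁ y).symm))).imp_right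
          (Or.imp_left Subtype.ext) }
  let g₂ : S₂ ⟶ T₂ :=
    { toFun := f₂
      lt := fun x y => f.lt x y
      fiber := fun {x y} h => Sum.inr_injective ((h₂ x).symm.trans ((f.fiber h).trans (h₂ y)))
      irrefl := fun x => f.irrefl x
      trans := f.trans
      total := fun {x y} h => 
        (f.total ((h₂ x).trans ((congrArg Sum.inr h).trans (h₂ y).symm))).imp_right
          (Or.imp_left Subtype.ext) }
  refine ⟨S₁, S₂, e.symm, g₁, g₂, ?_⟩
  have h : (isoOfEquiv e).hom ≫ f = sumMap g₁ g₂ := by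
    refine hom_ext ?_ ?_
    · rintro (x | x)
      · exact h₁ x
      · exact h₂ x
    · intro x y
      refine (ofEquiv_comp_lt e f x y).trans ?_
      rcases x with x | x <;> rcases y with y | y
      · exact (Sum.liftRel_inl_inl (r := g₁.lt) (s := g₂.lt)).symm
      -- Ordered elements lie in one fiber, so their images are on the same side.
      · refine iff_of_false (fun h => ?_) Sum.not_liftRel_inl_inr
        exact y.2 ((congrArg Sum.isLeft (f.fiber h)).symm.trans x.2)
      · refine iff_of_false (fun h => ?_) Sum.not_liftRel_inr_inl
        exact x.2 ((congrArg Sum.isLeft (f.fiber h)).trans y.2)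
      · exact (Sum.liftRel_inr_inr (r := g₁.lt) (s := g₂.lt)).symm
  change f = (isoOfEquiv e.symm).hom ≫ sumMap g₁ g₂
  rw [← h]
  exact ((isoOfEquiv e).inv_hom_id_assoc f).symm

end NCSet

/-! ### Full faithfulness of the interpretation -/

namespace FeynmanTriple

namespace TrivPlus

variable {gcp : Prop}

theorem card_pos_pow (n : ℕ) : Nat.card (pos (pow gcp n)) = n := by
  induction n with
  | zero => exact Nat.card_of_isEmpty (α := Empty)
  | succ n ih =>
    have : Finite (pos (pow gcp n)) := (trivPos _).finite
    exact (Nat.card_sum (α := Unit) (β := pos (pow gcp n))).trans (by rw [ih]; simp [add_comm])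

/-- Counting positions shows that both normal forms have the same number of factors, and the common
linear order on the inputs then forces the same permutation. -/
theorem IsProd.eq_of_eval_eq {A : PlusObj triv gcp} {f g : A ⟶ one} (hf : IsProd f)
    (hg : IsProd g) (h : eval f = eval g) : f = g := by
  rcases hf with ⟨n, e, rfl⟩ | ⟨_, e, rfl⟩ <;> rcases hg with ⟨m, d, rfl⟩ | ⟨_, d, rfl⟩
  · have hnm := Nat.card_congr (e.symm.trans d)
    rw [card_pos_pow, card_pos_pow] at hnm
    obtain rfl : n = m := by omega
    have : e = d := by
      have : Subsingleton (trivPos (one : PlusObj triv gcp).mor).carrier :=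
        inferInstanceAs (Subsingleton Unit)
      refine NCSet.equiv_lt_unique (S := trivPos A.mor) (eval (iter (gcp := gcp) n)) e d
        fun x y => ?_
      rw [eval_comp, eval_comp, eval_perm, eval_perm] at h
      rw [← NCSet.ofEquiv_comp_lt, ← NCSet.ofEquiv_comp_lt, h]
    rw [this]
  · exact (d (e.symm (Sum.inl ()))).elim
  · exact (e (d.symm (Sum.inl ()))).elim
  · have : e = d := Equiv.ext fun x => (e x).elim
    rw [this]

theorem comp_perm_cancel {A B C : PlusObj triv gcp} {f g : A ⟶ B} (e : pos B ≃ pos C)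
    (h : f ≫ perm e = g ≫ perm e) : f = g := by
  have h' := congrArg (· ≫ perm e.symm) h
  simpa only [Category.assoc, perm_comp_symm, Category.comp_id] using h'

theorem eval_injective {A B : PlusObj triv gcp} {f g : A ⟶ B} (h : eval f = eval g) : f = g := by
  have key : ∀ (w : FreeSym (Discrete PUnit.{1})) (A : PlusObj triv gcp)
      (f g : A ⟶ ofWord w), eval f = eval g → f = g := by
    intro w
    induction w with
    | unit =>
      intro A f g h
      obtain ⟨e, rfl⟩ := eq_perm_of_isEmpty f (inferInstanceAs (IsEmpty Empty))
      obtain ⟨e', rfl⟩ := eq_perm_of_isEmpty g (inferInstanceAs (IsEmpty Empty))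
      have : e = e' := Equiv.ext fun x => (e x).elim
      rw [this]
    | of v => exact fun A f g h => (isProd f).eq_of_eval_eq (isProd g) h
    | tensor w w' ih ih' =>
      intro A f g h
      let e₀ : pos (ofWord (gcp := gcp) (w.tensor w')) ≃
        pos (ofWord (gcp := gcp) w ⊗ ofWord w') := Equiv.refl _
      obtain ⟨A₁, A₂, e, f₁, f₂, hf⟩ := splits f (ofWord w) (ofWord w') e₀
      obtain ⟨A₁', A₂', d, g₁, g₂, hg⟩ := splits g (ofWord w) (ofWord w') e₀
      have h' : eval (perm e ≫ (f₁ ⊗ₘ f₂)) = eval (perm d ≫ (g₁ ⊗ₘ g₂)) := by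
        rw [← hf, ← hg, eval_comp, eval_comp, h]
      -- Equal evaluations send each source position to the same side, so the two splittings of the
      -- source differ by a bijection on each side.
      obtain ⟨c₁, c₂, hc⟩ : ∃ (c₁ : pos A₁ ≃ pos A₁') (c₂ : pos A₂ ≃ pos A₂'),
          e.symm.trans d = sumP c₁ c₂ := by
        refine Equiv.exists_eq_sumCongr (e.symm.trans d) fun x => ?_
        have hx := congrArg (fun k => NCSet.Hom.toFun k (e.symm x)) h'
        rw [eval_comp, eval_comp, eval_tensor, eval_tensor] at hx
        have hx' : Sum.map (eval f₁).toFun (eval f₂).toFun (e (e.symm x)) =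
            Sum.map (eval g₁).toFun (eval g₂).toFun (d (e.symm x)) := hx
        exact (Sum.isLeft_eq_of_map_eq_map hx').symm.trans
          (congrArg Sum.isLeft (e.apply_symm_apply x))
      have hd : perm d = perm e ≫ (perm c₁ ⊗ₘ perm c₂) := by
        rw [perm_tensor, ← hc, perm_comp, ← Equiv.trans_assoc, Equiv.self_trans_symm,
          Equiv.refl_trans]
      rw [hd, Category.assoc, tensorHom_comp_tensorHom, eval_comp, eval_comp] at h'
      have h'' := (cancel_epi
        (NCSet.isoOfEquiv (S := trivPos A.mor) (T := trivPos (A₁ ⊗ A₂).mor) e).hom).1 h'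
      rw [eval_tensor, eval_tensor] at h''
      obtain ⟨h₁, h₂⟩ := NCSet.sumMap_inj h''
      have : f ≫ perm e₀ = g ≫ perm e₀ := by
        rw [hf, hg, hd, Category.assoc, tensorHom_comp_tensorHom, ih _ _ _ h₁, ih' _ _ _ h₂]
      exact comp_perm_cancel e₀ this
  -- Every object is isomorphic to the identity of its target word, with the same positions.
  have h' := key B.mor.right A (f ≫ perm (Equiv.refl _)) (g ≫ perm (Equiv.refl _))
    (by rw [eval_comp, eval_comp, h])
  exact comp_perm_cancel (C := ofWord B.mor.right) (Equiv.refl _) h'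

theorem exists_eval_eq {A B : PlusObj triv gcp} (f : trivPos A.mor ⟶ trivPos B.mor)
    (hf : gcp ∨ Function.Surjective f.toFun) : ∃ g : A ⟶ B, eval g = f := by
  have key : ∀ (w : FreeSym (Discrete PUnit.{1})) (A : PlusObj triv gcp)
      (f : trivPos A.mor ⟶ trivPos (ofWord (gcp := gcp) w).mor)
      (_ : gcp ∨ Function.Surjective f.toFun), ∃ g : A ⟶ ofWord w, eval g = f := by
    intro w
    induction w with
    | unit =>
      intro A f hf
      have : IsEmpty (pos A) := ⟨fun x => (f.toFun x).elim⟩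
      exact ⟨perm ⟨f.toFun, fun x => x.elim, fun x => (f.toFun x).elim, fun x => x.elim⟩,
        NCSet.hom_ext (fun x => (f.toFun x).elim) fun x => (f.toFun x).elim⟩
    | of v =>
      intro A f hf
      have hs : Subsingleton (trivPos (one : PlusObj triv gcp).mor).carrier :=
        inferInstanceAs (Subsingleton Unit)
      have hs' : Subsingleton (trivPos (ofWord (gcp := gcp) (.of v)).mor).carrier :=
        inferInstanceAs (Subsingleton Unit)
      have : Finite (pos A) := (trivPos A.mor).finite
      rcases isEmpty_or_nonempty (pos A) with hA | hA
      -- An empty fiber over the letter excludes surjectivity, so the unit is available.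
      · have h : gcp := hf.resolve_right fun h => hA.elim (h ()).choose
        let e : pos A ≃ pos (𝟙_ (PlusObj triv gcp)) := Equiv.equivOfIsEmpty _ Empty
        exact ⟨perm e ≫ unit h, NCSet.hom_ext (fun x => hA.elim x) fun x => hA.elim x⟩
      · obtain ⟨n, hn⟩ := Nat.exists_eq_succ_of_ne_zero (Nat.card_pos (α := pos A)).ne'
        -- Otherwise list the inputs in increasing order and multiply.
        obtain ⟨e, he⟩ := NCSet.exists_equiv_lt f (eval (iter (gcp := gcp) n))
          (hn.trans (card_pos_pow (n + 1)).symm)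
        refine ⟨perm (B := pow gcp (n + 1)) e ≫ iter n,
          NCSet.hom_ext (fun x => Subsingleton.elim _ _) fun x y => ?_⟩
        rw [eval_comp, eval_perm, NCSet.ofEquiv_comp_lt]
        exact (he x y).symm
    | tensor w w' ih ih' =>
      intro A f hf
      obtain ⟨S₁, S₂, e, f₁, f₂, h⟩ := NCSet.exists_eq_sumMap
        (T₁ := trivPos (ofWord (gcp := gcp) w).mor) (T₂ := trivPos (ofWord (gcp := gcp) w').mor) f
      -- The two parts of the source are bare sets; choose objects with these positions so that
      -- induction applies.
      obtain ⟨A₁, ⟨c₁⟩⟩ := exists_pos_equiv gcp S₁.carrier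
      obtain ⟨A₂, ⟨c₂⟩⟩ := exists_pos_equiv gcp S₂.carrier
      have hs : gcp ∨ Function.Surjective (Sum.map f₁.toFun f₂.toFun) := by
        refine hf.imp_right fun hf => ?_
        rw [h] at hf
        exact Function.Surjective.of_comp (f := Sum.map f₁.toFun f₂.toFun) (g := e) hf
      obtain ⟨g₁, h₁⟩ := ih A₁ ((NCSet.isoOfEquiv (S := trivPos A₁.mor) c₁).hom ≫ f₁)
        (hs.imp_right fun hs => Function.Surjective.comp (g := f₁.toFun) (f := c₁)
          (Sum.map_surjective.1 hs).1 c₁.surjective)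
      obtain ⟨g₂, h₂⟩ := ih' A₂ ((NCSet.isoOfEquiv (S := trivPos A₂.mor) c₂).hom ≫ f₂)
        (hs.imp_right fun hs => Function.Surjective.comp (g := f₂.toFun) (f := c₂)
          (Sum.map_surjective.1 hs).2 c₂.surjective)
      let e' : pos A ≃ pos (A₁ ⊗ A₂) := e.trans (Equiv.sumCongr c₁.symm c₂.symm)
      let g : A ⟶ ofWord w ⊗ ofWord w' := perm e' ≫ (g₁ ⊗ₘ g₂)
      refine ⟨g ≫ perm (B := ofWord (w.tensor w')) (Equiv.refl _), ?_⟩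
      have hc : (NCSet.isoOfEquiv (S := trivPos A.mor)
          (T := trivPos A₁.mor ⊗ trivPos A₂.mor) e').hom ≫
          ((NCSet.isoOfEquiv (S := trivPos A₁.mor) c₁).hom ⊗ₘ
            (NCSet.isoOfEquiv (S := trivPos A₂.mor) c₂).hom) = (NCSet.isoOfEquiv e).hom := by
        refine NCSet.hom_ext_of_isIso fun x => ?_
        change Sum.map c₁ c₂ (Sum.map c₁.symm c₂.symm (e x)) = e x
        exact Sum.map_apply_map_symm c₁ c₂ (e x)
      have hg : eval g = f := by
        rw [h, ← hc, Category.assoc, tensorHom_comp_tensorHom, ← h₁, ← h₂, eval_comp, eval_tensor]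
        rfl
      rw [eval_comp, hg]
      exact Category.comp_id f
  obtain ⟨g, hg⟩ := key B.mor.right A f hf
  exact ⟨g ≫ perm (B := B) (Equiv.refl _), by
    rw [eval_comp, hg]
    exact Category.comp_id f⟩

end TrivPlus

end FeynmanTriple

/-! ### The equivalence of categories and its inverse -/

namespace FeynmanTriple

section ToWide

variable {gcp : Prop} (P : MorphismProperty NCSet) [P.IsStableUnderBraiding]
  (hP : ∀ {S T : NCSet} (f : S ⟶ T), P f ↔ gcp ∨ Function.Surjective f.toFun)

theorem trivToWide_map_hom {A B : PlusObj triv gcp} (f : A ⟶ B) :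
    ((trivToWide P hP).map f).hom = TrivPlus.eval f := by
  obtain ⟨s⟩ := f
  rfl

/-- The functor `trivToWide` is an equivalence of categories. -/
theorem trivToWide_isEquivalence : (trivToWide P hP).IsEquivalence where
  faithful := ⟨fun {A B f g} h => TrivPlus.eval_injective (by
    rw [← trivToWide_map_hom P hP, ← trivToWide_map_hom P hP, h])⟩
  full := ⟨fun {A B} f => by
    obtain ⟨g, hg⟩ := TrivPlus.exists_eval_eq (A := A) (B := B) f.hom ((hP _).1 f.property)
    exact ⟨g, WideSubcategory.hom_ext _ ((trivToWide_map_hom P hP g).trans hg)⟩⟩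
  essSurj := ⟨fun S => by
    obtain ⟨A, ⟨e⟩⟩ := TrivPlus.exists_pos_equiv gcp S.obj.carrier
    exact ⟨A, ⟨WideSubcategory.isoMk (NCSet.isoOfEquiv e) ((hP _).2 (Or.inr e.surjective))
      ((hP _).2 (Or.inr e.symm.surjective))⟩⟩⟩

end ToWide

end FeynmanTriple

open Functor.LaxMonoidal Functor.OplaxMonoidal in
/-- The inverse of a symmetric monoidal equivalence is symmetric monoidal. -/
theorem CategoryTheory.Equivalence.nonempty_inverse_braided {C : Type u₁} [Category.{v₁} C]
    [MonoidalCategory C] [BraidedCategory C] {D : Type u₂} [Category.{v₂} D] [MonoidalCategory D]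
    [BraidedCategory D] (e : C ≌ D) [h : e.functor.Braided] : Nonempty e.inverse.Braided := by
  let := e.inverseMonoidal
  have : e.IsMonoidal :=
    have h' : (letI := e.toAdjunction.rightAdjointLaxMonoidal; e.toAdjunction.IsMonoidal) :=
      inferInstance
    h'
  refine ⟨Functor.Braided.mk fun X Y => ?_⟩
  -- After applying the functor and the counit, the claim becomes naturality of the counit with
  -- respect to the braiding.
  apply e.functor.map_injective
  rw [← cancel_mono (e.counitIso.hom.app (Y ⊗ X)), Functor.map_comp, Functor.map_comp,
    Category.assoc, Category.assoc, e.functor_map_μ_inverse_comp_counitIso_hom_app_tensor,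
    Functor.map_braiding e.functor, Category.assoc, Category.assoc, Functor.Monoidal.μ_δ_assoc,
    ← BraidedCategory.braiding_naturality,
    ← e.functor_map_μ_inverse_comp_counitIso_hom_app_tensor_assoc]
  congr 1
  exact e.counitIso.hom.naturality (β_ X Y).hom

/-! ### Disjoint unions of families, and extension to words -/

/-- The relation on a disjoint union given by relations on the summands. -/
inductive SigmaLt {ι : Type} {β : ι → Type} (r : ∀ i, β i → β i → Prop) :
    (Σ i, β i) → (Σ i, β i) → Prop
  | mk (i : ι) (x y : β i) (h : r i x y) : SigmaLt r ⟨i, x⟩ ⟨i, y⟩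

theorem sigmaLt_mk_iff {ι : Type} {β : ι → Type} {r : ∀ i, β i → β i → Prop} {i : ι} {x y : β i} :
    SigmaLt r ⟨i, x⟩ ⟨i, y⟩ ↔ r i x y :=
  ⟨fun h => by cases h; assumption, .mk i x y⟩

theorem SigmaLt.fst_eq {ι : Type} {β : ι → Type} {r : ∀ i, β i → β i → Prop} {p q : Σ i, β i}
    (h : SigmaLt r p q) : p.1 = q.1 := by
  cases h
  rfl

theorem sigmaLt_sigmaCongr {ι ι' : Type} {β : ι → Type} {β' : ι' → Type}
    {r : ∀ i, β i → β i → Prop} {r' : ∀ i, β' i → β' i → Prop} (f : ι ≃ ι')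
    (F : ∀ i, β i ≃ β' (f i)) (h : ∀ i x y, r i x y ↔ r' (f i) (F i x) (F i y))
    (p q : Σ i, β i) :
    SigmaLt r' (Equiv.sigmaCongr f F p) (Equiv.sigmaCongr f F q) ↔ SigmaLt r p q := by
  obtain ⟨i, x⟩ := p
  obtain ⟨j, y⟩ := q
  constructor
  · intro hlt
    obtain rfl : i = j := f.injective hlt.fst_eq
    exact sigmaLt_mk_iff.2 ((h i x y).2 (sigmaLt_mk_iff.1 hlt))
  · intro hlt
    obtain rfl : i = j := hlt.fst_eq
    exact sigmaLt_mk_iff.2 ((h i x y).1 (sigmaLt_mk_iff.1 hlt))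

namespace NCSet

/-- The disjoint union of a family of morphisms. -/
def sigmaMap {ι : Type} [Finite ι] {S T : ι → NCSet} (f : ∀ i, S i ⟶ T i) :
    (⟨Σ i, (S i).carrier⟩ : NCSet) ⟶ ⟨Σ i, (T i).carrier⟩ where
  toFun := Sigma.map id fun i => (f i).toFun
  lt := SigmaLt fun i => (f i).lt
  fiber := by
    rintro _ _ ⟨i, x, y, h⟩
    exact congrArg (Sigma.mk i) ((f i).fiber h)
  irrefl := by
    rintro ⟨i, x⟩ h
    exact (f i).irrefl x (sigmaLt_mk_iff.1 h)
  trans := by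
    rintro _ _ ⟨_, z⟩ ⟨i, x, y, h⟩ h'
    obtain rfl := h'.fst_eq
    exact sigmaLt_mk_iff.2 ((f i).trans h (sigmaLt_mk_iff.1 h'))
  total := by
    rintro ⟨i, x⟩ ⟨j, y⟩ h
    obtain rfl : i = j := congrArg Sigma.fst h
    rcases (f i).total (eq_of_heq (Sigma.mk.inj h).2) with h | h | h
    · exact Or.inl (sigmaLt_mk_iff.2 h)
    · exact Or.inr (Or.inl (congrArg _ h))
    · exact Or.inr (Or.inr (sigmaLt_mk_iff.2 h))

/-- The property is either that of all morphisms or that of all surjective morphisms. -/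
class IsFiberwise (P : MorphismProperty NCSet) : Prop where
  exists_iff : ∃ gcp : Prop, ∀ {S T : NCSet} (f : S ⟶ T), P f ↔ gcp ∨ Function.Surjective f.toFun

instance : IsFiberwise surj := ⟨False, fun _ => (false_or _).to_iff.symm⟩

instance : IsFiberwise ⊤ := ⟨True, fun _ => iff_of_true trivial (Or.inl trivial)⟩

section

variable (P : MorphismProperty NCSet) [IsFiberwise P]

theorem mem_of_surjective {S T : NCSet} (f : S ⟶ T) (h : Function.Surjective f.toFun) : P f := by
  obtain ⟨gcp, hP⟩ := IsFiberwise.exists_iff (P := P)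
  exact (hP f).2 (Or.inr h)

theorem sigmaMap_mem {ι : Type} [Finite ι] {S T : ι → NCSet} (f : ∀ i, S i ⟶ T i)
    (hf : ∀ i, P (f i)) : P (sigmaMap f) := by
  obtain ⟨gcp, hP⟩ := IsFiberwise.exists_iff (P := P)
  refine (hP _).2 ?_
  by_cases h : gcp
  · exact Or.inl h
  refine Or.inr ?_
  rintro ⟨i, y⟩
  obtain ⟨x, rfl⟩ := ((hP _).1 (hf i)).resolve_left h y
  exact ⟨⟨i, x⟩, rfl⟩

/-- Bijections are isomorphisms. -/
def wideIso [P.IsStableUnderBraiding] {S T : WideSubcategory P}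
    (e : S.obj.carrier ≃ T.obj.carrier) : S ≅ T :=
  WideSubcategory.isoMk (isoOfEquiv e) (mem_of_surjective P _ e.surjective)
    (mem_of_surjective P _ e.symm.surjective)

end

section Extension

/-- Constraints of words carry identities on the letters; this evaluates them elementwise in the
coherence conditions below. -/
theorem map_id_apply {P : MorphismProperty NCSet} [P.IsStableUnderBraiding]
    {G : Type u₁} [Category.{v₁} G] (k : G ⥤ WideSubcategory P) {g : G}
    (x : (k.obj g).obj.carrier) : (k.map (𝟙 g)).hom.toFun x = x := by
  rw [k.map_id]
  rfl

variable {P : MorphismProperty NCSet} [IsFiberwise P] [P.IsStableUnderBraiding]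
  {G : Type u₁} [Groupoid.{v₁} G] (k : G ⥤ WideSubcategory P)

/-- The bijection underlying an isomorphism. -/
abbrev groupoidEquiv {g g' : G} (f : g ⟶ g') : (k.obj g).obj.carrier ≃ (k.obj g').obj.carrier :=
  equivOfIso ((wideSubcategoryInclusion P).mapIso (k.mapIso (Groupoid.isoEquivHom g g' |>.symm f)))

/-- The extension of a functor to the free symmetric monoidal category. -/
def extension : FreeSym G ⥤ WideSubcategory P where
  obj w := ⟨⟨Σ i : w.Pos, (k.obj (w.letter i)).obj.carrier⟩⟩
  map {w w'} f := ⟨Hom.ofEquiv (Equiv.sigmaCongr f.perm fun i => groupoidEquiv k (f.app i)),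
    mem_of_surjective P _ (Equiv.surjective _)⟩
  map_id w := WideSubcategory.hom_ext _ (hom_ext_ordFree
    (fun p => congrArg (Sigma.mk p.1) (map_id_apply k p.2)) (fun _ _ => id) (fun _ _ => id))
  map_comp f g := WideSubcategory.hom_ext _ (hom_ext_ordFree
    (fun p => congrArg (Sigma.mk _) (by
      change (k.map (f.app p.1 ≫ g.app (f.perm p.1))).hom.toFun p.2 = _
      rw [k.map_comp]
      rfl)) (fun _ _ => id) (comp_ordFree (fun _ _ => id) (fun _ _ => id)))

/-- The compatibility of `extension` with units. -/
def extensionUnit : 𝟙_ (WideSubcategory P) ≅ (extension k).obj (𝟙_ (FreeSym G)) :=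
  wideIso P (T := (extension k).obj (𝟙_ (FreeSym G)))
    (@Equiv.equivOfIsEmpty Empty (Σ _ : Empty, _) _ _)

/-- The compatibility of `extension` with tensor products. -/
def extensionTensor (w w' : FreeSym G) :
    (extension k).obj w ⊗ (extension k).obj w' ≅ (extension k).obj (w ⊗ w') :=
  wideIso P (S := (extension k).obj w ⊗ (extension k).obj w') (T := (extension k).obj (w ⊗ w'))
    { toFun := Sum.elim (fun p => ⟨Sum.inl p.1, p.2⟩) (fun p => ⟨Sum.inr p.1, p.2⟩)
      invFun := fun p => match p with
        | ⟨Sum.inl i, x⟩ => Sum.inl ⟨i, x⟩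
        | ⟨Sum.inr i, x⟩ => Sum.inr ⟨i, x⟩
      left_inv := by rintro (p | p) <;> rfl
      right_inv := by rintro ⟨i | i, x⟩ <;> rfl }

/-- The functor `extension` is monoidal. -/
def extensionCore : (extension k).CoreMonoidal where
  εIso := extensionUnit k
  μIso := extensionTensor k
  μIso_hom_natural_left {w w'} f w'' := wide_hom_ext_of_isIso (by
    rintro (p | p)
    · rfl
    · exact congrArg (Sigma.mk (Sum.inr p.1)) (map_id_apply k p.2).symm)
  μIso_hom_natural_right {w w'} w'' f := wide_hom_ext_of_isIso (by
    rintro (p | p)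
    · exact congrArg (Sigma.mk (Sum.inl p.1)) (map_id_apply k p.2).symm
    · rfl)
  associativity w w' w'' := wide_hom_ext_of_isIso (by
    rintro ((p | p) | p)
    all_goals exact congrArg (Sigma.mk _) (map_id_apply k p.2))
  left_unitality w := wide_hom_ext_of_isIso (by
    rintro (p | p)
    · exact p.elim
    · exact congrArg (Sigma.mk _) (map_id_apply k p.2).symm)
  right_unitality w := wide_hom_ext_of_isIso (by
    rintro (p | p)
    · exact congrArg (Sigma.mk _) (map_id_apply k p.2).symm
    · exact p.elim)

instance : (extension k).Braided where
  __ := (extensionCore k).toMonoidal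
  braided w w' := wide_hom_ext_of_isIso (by
    rintro (p | p)
    all_goals exact congrArg (Sigma.mk _) (map_id_apply k p.2))

/-- The letter of a word with one letter. -/
def inclExtensionApp (g : G) : (FreeSym.incl G ⋙ extension k).obj g ≅ k.obj g :=
  wideIso P (S := (extension k).obj (FreeSym.of g))
    (Equiv.uniqueSigma (α := Unit) fun _ => (k.obj g).obj.carrier)

/-- The functor `extension` extends the given one. -/
def inclExtension : FreeSym.incl G ⋙ extension k ≅ k :=
  NatIso.ofComponents (inclExtensionApp k)
    fun _ => wide_hom_ext_of_isIso fun _ => rfl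

end Extension

end NCSet

/-! ### Isomorphisms of arrows, fibers, and extension to arrow categories -/

/-- An equivalence of disjoint unions over an equivalence of the index sets consists of equivalences
of the summands. -/
theorem Equiv.exists_sigma_congr {ι ι' : Type} {α : ι → Type} {β : ι' → Type} (p : ι ≃ ι')
    (e : (Σ i, α i) ≃ Σ j, β j) (h : ∀ q, (e q).1 = p q.1) :
    ∃ F : ∀ i, α i ≃ β (p i), ∀ i x, e ⟨i, x⟩ = ⟨p i, F i x⟩ := by
  have h' : ∀ i x, ∃ y, e ⟨i, x⟩ = ⟨p i, y⟩ := by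
    intro i x
    have := h ⟨i, x⟩
    -- The index of `e ⟨i, x⟩` equals `p i` only propositionally; generalizing allows substitution.
    generalize e ⟨i, x⟩ = q at this
    obtain ⟨j, y⟩ := q
    obtain rfl : j = p i := this
    exact ⟨y, rfl⟩
  choose F hF using h'
  refine ⟨fun i => Equiv.ofBijective (F i) ⟨fun x y hxy => ?_, fun y => ?_⟩, hF⟩
  · have : e ⟨i, x⟩ = e ⟨i, y⟩ := by rw [hF, hF, hxy]
    exact eq_of_heq (Sigma.mk.inj (e.injective this)).2
  · obtain ⟨⟨j, x⟩, hx⟩ := e.surjective ⟨p i, y⟩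
    obtain rfl : j = i := p.injective ((h _).symm.trans (congrArg Sigma.fst hx))
    exact ⟨x, eq_of_heq (Sigma.mk.inj ((hF j x).symm.trans hx)).2⟩

namespace NCSet

section MorIso

variable {P : MorphismProperty NCSet} [P.IsStableUnderBraiding]

theorem mor_hom_ext_of_isIso {φ ψ : Mor (WideSubcategory P)} {f g : φ ⟶ ψ} [IsIso f] [IsIso g]
    (h : ∀ x, f.left.hom.toFun x = g.left.hom.toFun x)
    (h' : ∀ x, f.right.hom.toFun x = g.right.hom.toFun x) : f = g :=
  Comma.hom_ext _ _ (wide_hom_ext_of_isIso h) (wide_hom_ext_of_isIso h')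

/-- The bijection of the underlying sets. -/
abbrev wideEquiv {S T : WideSubcategory P} (e : S ≅ T) : S.obj.carrier ≃ T.obj.carrier :=
  equivOfIso ((wideSubcategoryInclusion P).mapIso e)

theorem mor_iso_apply {φ ψ : Mor (WideSubcategory P)} (e : φ ≅ ψ) (x : φ.left.obj.carrier) :
    wideEquiv (Comma.rightIso e) (φ.hom.hom.toFun x) =
      ψ.hom.hom.toFun (wideEquiv (Comma.leftIso e) x) :=
  (congrArg (fun f : φ.left ⟶ ψ.right => f.hom.toFun x) e.hom.w).symm

/-- Compare the orders of the two composites around the square: the isomorphisms contribute none, so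
only those of `φ` and `ψ` remain. -/
theorem mor_iso_lt {φ ψ : Mor (WideSubcategory P)} (e : φ ≅ ψ) (x y : φ.left.obj.carrier) :
    φ.hom.hom.lt x y ↔
      ψ.hom.hom.lt (wideEquiv (Comma.leftIso e) x) (wideEquiv (Comma.leftIso e) y) := by
  have h : ((e.hom.left ≫ ψ.hom : φ.left ⟶ ψ.right).hom.lt x y) =
      ((φ.hom ≫ e.hom.right : φ.left ⟶ ψ.right).hom.lt x y) :=
    congrArg (fun f : φ.left ⟶ ψ.right => f.hom.lt x y) e.hom.w
  have h₁ : ((e.hom.left ≫ ψ.hom : φ.left ⟶ ψ.right).hom.lt x y) ↔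
      e.hom.left.hom.lt x y ∨ ψ.hom.hom.lt (e.hom.left.hom.toFun x) (e.hom.left.hom.toFun y) :=
    Iff.rfl
  have h₂ : ((φ.hom ≫ e.hom.right : φ.left ⟶ ψ.right).hom.lt x y) ↔
      φ.hom.hom.lt x y ∨ e.hom.right.hom.lt (φ.hom.hom.toFun x) (φ.hom.hom.toFun y) := Iff.rfl
  rw [or_iff_right (ordFree_of_isIso _ _ _)] at h₁
  rw [or_iff_left (ordFree_of_isIso _ _ _)] at h₂
  exact (h₁.symm.trans ((iff_of_eq h).trans h₂)).symm

/-- Bijections of the sources and targets which are compatible with the morphisms form an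
isomorphism. -/
def morIso [IsFiberwise P] {φ ψ : Mor (WideSubcategory P)}
    (a : φ.left.obj.carrier ≃ ψ.left.obj.carrier) (b : φ.right.obj.carrier ≃ ψ.right.obj.carrier)
    (h : ∀ x, b (φ.hom.hom.toFun x) = ψ.hom.hom.toFun (a x))
    (h' : ∀ x y, φ.hom.hom.lt x y ↔ ψ.hom.hom.lt (a x) (a y)) : φ ≅ ψ :=
  Mor.sd (φ := φ.hom) (φ' := ψ.hom) (wideIso P a) (wideIso P b) (WideSubcategory.hom_ext _
    (hom_ext h fun x y => (or_false _).to_iff.trans ((h' x y).trans (false_or _).to_iff.symm)))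

end MorIso

section Fiber

/-- The restriction of a morphism to a fiber. -/
def fiberMap {S T : NCSet} (f : S ⟶ T) (t : T.carrier) :
    (⟨{x // f.toFun x = t}⟩ : NCSet) ⟶ ⟨Unit⟩ where
  toFun _ := ()
  lt x y := f.lt x y
  fiber _ := rfl
  irrefl x := f.irrefl x
  trans h h' := f.trans h h'
  total {x y} _ := by
    rcases f.total (x.2.trans y.2.symm) with h | h | h
    · exact Or.inl h
    · exact Or.inr (Or.inl (Subtype.ext h))
    · exact Or.inr (Or.inr h)

variable {P : MorphismProperty NCSet} [IsFiberwise P] [P.IsStableUnderBraiding]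

/-- The restriction of a morphism to a fiber. -/
def fiberHom {S T : WideSubcategory P} (f : S ⟶ T) (t : T.obj.carrier) :
    (⟨⟨{x // f.hom.toFun x = t}⟩⟩ : WideSubcategory P) ⟶ ⟨⟨Unit⟩⟩ :=
  ⟨fiberMap f.hom t, by
    obtain ⟨gcp, hP⟩ := IsFiberwise.exists_iff (P := P)
    refine (hP _).2 (((hP _).1 f.property).imp_right fun h _ => ?_)
    obtain ⟨x, hx⟩ := h t
    exact ⟨⟨x, hx⟩, rfl⟩⟩

end Fiber

section ExtensionMor

variable {P : MorphismProperty NCSet} [IsFiberwise P] [P.IsStableUnderBraiding]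
  {G : Type u₁} [Groupoid.{v₁} G] (k : G ⥤ Mor (WideSubcategory P))

/-- The source of the value of `extensionMor`. -/
abbrev extensionSource : FreeSym G ⥤ WideSubcategory P := extension (k ⋙ Comma.fst _ _)

/-- The target of the value of `extensionMor`. -/
abbrev extensionTarget : FreeSym G ⥤ WideSubcategory P := extension (k ⋙ Comma.snd _ _)

/-- The value of `extensionMor`. -/
def extensionHom (w : FreeSym G) : (extensionSource k).obj w ⟶ (extensionTarget k).obj w :=
  ⟨sigmaMap fun i => (k.obj (w.letter i)).hom.hom,
    sigmaMap_mem P _ fun i => (k.obj (w.letter i)).hom.property⟩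

theorem extensionHom_naturality {w w' : FreeSym G} (f : w ⟶ w') :
    (extensionSource k).map f ≫ extensionHom k w' =
      extensionHom k w ≫ (extensionTarget k).map f := by
  refine WideSubcategory.hom_ext _ (hom_ext (fun q => ?_) fun q q' => ?_)
  · exact congrArg (Sigma.mk (f.perm q.1))
      (mor_iso_apply (k.mapIso (Groupoid.isoEquivHom _ _ |>.symm (f.app q.1))) q.2).symm
  · refine (false_or _).to_iff.trans (Iff.trans ?_ (or_false _).to_iff.symm)
    exact sigmaLt_sigmaCongr _ _ (fun i x y =>
      mor_iso_lt (k.mapIso (Groupoid.isoEquivHom _ _ |>.symm (f.app i))) x y) q q'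

/-- The extension of a functor to `(C ↓ C)` to the free symmetric monoidal category. -/
def extensionMor : FreeSym G ⥤ Mor (WideSubcategory P) where
  obj w := Mor.mk (extensionHom k w)
  map f :=
    { left := (extensionSource k).map f
      right := (extensionTarget k).map f
      w := extensionHom_naturality k f }
  map_id w := Comma.hom_ext _ _ ((extensionSource k).map_id w) ((extensionTarget k).map_id w)
  map_comp f g := Comma.hom_ext _ _ ((extensionSource k).map_comp f g)
    ((extensionTarget k).map_comp f g)

/-- The compatibility of `extensionMor` with units. -/
def extensionMorUnit : 𝟙_ (Mor (WideSubcategory P)) ≅ (extensionMor k).obj (𝟙_ (FreeSym G)) :=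
  Mor.sd (φ' := extensionHom k (𝟙_ (FreeSym G))) (extensionUnit _) (extensionUnit _)
    (WideSubcategory.hom_ext _ (hom_ext (fun i => i.elim) (fun i => i.elim)))

/-- The compatibility of `extensionMor` with tensor products. -/
def extensionMorTensor (w w' : FreeSym G) :
    (extensionMor k).obj w ⊗ (extensionMor k).obj w' ≅ (extensionMor k).obj (w ⊗ w') :=
  Mor.sd (φ := extensionHom k w ⊗ₘ extensionHom k w') (φ' := extensionHom k (w ⊗ w'))
    (extensionTensor _ w w') (extensionTensor _ w w') (WideSubcategory.hom_ext _ (hom_ext (by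
      rintro (q | q) <;> rfl) (by
      rintro q q'
      refine (or_false _).to_iff.trans (Iff.trans ?_ (false_or _).to_iff.symm)
      rcases q with ⟨i, x⟩ | ⟨i, x⟩ <;> rcases q' with ⟨j, y⟩ | ⟨j, y⟩
      · constructor
        · rintro (⟨_, _, _, h⟩ | _)
          exact sigmaLt_mk_iff.2 h
        · intro h
          obtain rfl : i = j := Sum.inl.inj h.fst_eq
          exact .inl (sigmaLt_mk_iff.2 (sigmaLt_mk_iff.1 h))
      · exact iff_of_false (fun h => nomatch h) (fun h => nomatch h.fst_eq)
      · exact iff_of_false (fun h => nomatch h) (fun h => nomatch h.fst_eq)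
      · constructor
        · rintro (_ | ⟨_, _, _, h⟩)
          exact sigmaLt_mk_iff.2 h
        · intro h
          obtain rfl : i = j := Sum.inr.inj h.fst_eq
          exact .inr (sigmaLt_mk_iff.2 (sigmaLt_mk_iff.1 h)))))

/-- The functor `extensionMor` is monoidal. -/
def extensionMorCore : (extensionMor k).CoreMonoidal where
  εIso := extensionMorUnit k
  μIso := extensionMorTensor k
  μIso_hom_natural_left f w := Comma.hom_ext _ _
    ((extensionCore _).μIso_hom_natural_left f w) ((extensionCore _).μIso_hom_natural_left f w)
  μIso_hom_natural_right w f := Comma.hom_ext _ _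
    ((extensionCore _).μIso_hom_natural_right w f) ((extensionCore _).μIso_hom_natural_right w f)
  associativity w w' w'' := Comma.hom_ext _ _
    ((extensionCore _).associativity w w' w'') ((extensionCore _).associativity w w' w'')
  left_unitality w := Comma.hom_ext _ _
    ((extensionCore _).left_unitality w) ((extensionCore _).left_unitality w)
  right_unitality w := Comma.hom_ext _ _
    ((extensionCore _).right_unitality w) ((extensionCore _).right_unitality w)

instance : (extensionMor k).Braided where
  __ := (extensionMorCore k).toMonoidal
  braided w w' := Comma.hom_ext _ _
    (Functor.LaxBraided.braided (F := extensionSource k) w w')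
    (Functor.LaxBraided.braided (F := extensionTarget k) w w')

/-- The letter of a word with one letter. -/
def inclExtensionMorApp (g : G) : (FreeSym.incl G ⋙ extensionMor k).obj g ≅ k.obj g :=
  morIso (φ := (extensionMor k).obj (FreeSym.of g))
    (Equiv.uniqueSigma (α := Unit) fun _ => (k.obj g).left.obj.carrier)
    (Equiv.uniqueSigma (α := Unit) fun _ => (k.obj g).right.obj.carrier)
    (fun _ => rfl) (fun _ _ => sigmaLt_mk_iff)

/-- The functor `extensionMor` extends the given one. -/
def inclExtensionMor : FreeSym.incl G ⋙ extensionMor k ≅ k :=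
  NatIso.ofComponents (inclExtensionMorApp k)
    fun _ => mor_hom_ext_of_isIso (fun _ => rfl) (fun _ => rfl)

end ExtensionMor

end NCSet

/-! ### Criteria for free generation of isomorphisms -/

theorem CategoryTheory.Core.functorToCore_isEquivalence {G : Type u₁} [Groupoid.{v₁} G]
    {C : Type u₂} [Category.{v₂} C] (E : G ⥤ C) [E.Faithful]
    (hfull : ∀ {g g' : G} (e : E.obj g ≅ E.obj g'), ∃ f : g ⟶ g', E.map f = e.hom)
    [E.EssSurj] : (Core.functorToCore E).IsEquivalence where
  faithful := ⟨fun {g g' f f'} h => E.map_injective (congrArg (fun e => e.iso.hom) h)⟩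
  full := ⟨fun {g g'} e => by
    obtain ⟨f, hf⟩ := hfull e.iso
    exact ⟨f, CoreHom.ext (Iso.ext hf)⟩⟩
  essSurj := ⟨fun X => ⟨E.objPreimage X.of, ⟨Core.isoMk (E.objObjPreimageIso X.of)⟩⟩⟩

namespace NCSet

section

variable {P : MorphismProperty NCSet} [IsFiberwise P] [P.IsStableUnderBraiding]
  {G : Type u₁} [Groupoid.{v₁} G]

/-- Each letter contributes one point, so a word becomes its set of positions; a morphism of words
is just a bijection of positions because the groupoid is contractible. -/
theorem freelyGeneratesIsos_of_unique [Nonempty G] (h : ∀ g g' : G, Nonempty (Unique (g ⟶ g')))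
    (k : G ⥤ WideSubcategory P) (hk : ∀ g, Nonempty (Unique (k.obj g).obj.carrier)) :
    FreelyGeneratesIsos k := by
  have (g g' : G) : Unique (g ⟶ g') := (h g g').some
  have (g : G) : Unique (k.obj g).obj.carrier := (hk g).some
  let ε (w : FreeSym G) : ((extension k).obj w).obj.carrier ≃ w.Pos :=
    Equiv.sigmaUnique w.Pos fun i => (k.obj (w.letter i)).obj.carrier
  refine ⟨extension k, inferInstance, ⟨inclExtension k⟩, ?_⟩
  have : (extension k).Faithful := ⟨fun {w w' f f'} hf => FreeSym.hom_ext (fun i => by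
    have := congrArg (fun f : (extension k).obj w ⟶ (extension k).obj w' =>
      ε w' (f.hom.toFun ((ε w).symm i))) hf
    exact this) fun _ => Subsingleton.elim _ _⟩
  have : (extension k).EssSurj := ⟨fun S => by
    obtain ⟨w, e, -⟩ := FreeSym.exists_pos_equiv fun _ : S.obj.carrier => Classical.arbitrary G
    exact ⟨w, ⟨wideIso P ((ε w).trans e)⟩⟩⟩
  refine Core.functorToCore_isEquivalence _ fun {w w'} e => ?_
  refine ⟨⟨(ε w).symm.trans ((wideEquiv e).trans (ε w')), fun _ => default⟩, ?_⟩
  refine wide_hom_ext_of_isIso fun x => (ε w').injective ?_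
  obtain ⟨i, rfl⟩ := (ε w).symm.surjective x
  rfl

/-- The positions of a word are the points of the target, and its letters are the restrictions to
the fibers. An isomorphism of arrows permutes the fibers and restricts to isomorphisms between them.
-/
theorem freelyGeneratesIsos_of_mor (k : G ⥤ Mor (WideSubcategory P)) [k.Faithful]
    (hfull : ∀ {g g' : G} (e : k.obj g ≅ k.obj g'), ∃ f : g ⟶ g', k.map f = e.hom)
    (hk : ∀ g, Nonempty (Unique (k.obj g).right.obj.carrier))
    (hsurj : ∀ φ : Mor (WideSubcategory P), Nonempty (Unique φ.right.obj.carrier) →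
      ∃ g, Nonempty (k.obj g ≅ φ)) : FreelyGeneratesIsos k := by
  have (g : G) : Unique (k.obj g).right.obj.carrier := (hk g).some
  let ε (w : FreeSym G) : ((extensionMor k).obj w).right.obj.carrier ≃ w.Pos :=
    Equiv.sigmaUnique w.Pos fun i => (k.obj (w.letter i)).right.obj.carrier
  refine ⟨extensionMor k, inferInstance, ⟨inclExtensionMor k⟩, ?_⟩
  have : (extensionMor k).Faithful := ⟨fun {w w' f f'} hf => by
    -- The target component determines the permutation, and the source component then determines
    -- each letter map.
    have hp : f.perm = f'.perm := Equiv.ext fun i =>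
      congrArg (fun f : (extensionMor k).obj w ⟶ (extensionMor k).obj w' =>
        ε w' (f.right.hom.toFun ((ε w).symm i))) hf
    obtain ⟨p, a⟩ := f
    obtain ⟨p', b⟩ := f'
    obtain rfl : p = p' := hp
    congr 1
    funext i
    refine k.map_injective (mor_hom_ext_of_isIso (fun x => ?_) fun _ => Subsingleton.elim _ _)
    have := congrArg (fun f : (extensionMor k).obj w ⟶ (extensionMor k).obj w' =>
      f.left.hom.toFun ⟨i, x⟩) hf
    exact eq_of_heq (Sigma.mk.inj this).2⟩
  have : (extensionMor k).EssSurj := ⟨fun φ => by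
    -- Every fiber restriction has a one-point target and so comes from the groupoid; a word with
    -- these letters reassembles `φ`.
    have hg (t : φ.right.obj.carrier) := hsurj (Mor.mk (C := WideSubcategory P)
      (fiberHom φ.hom t)) ⟨inferInstanceAs (Unique Unit)⟩
    choose g hg using hg
    obtain ⟨w, e, hw⟩ := FreeSym.exists_pos_equiv g
    have hφ (i : w.Pos) : Nonempty (k.obj (w.letter i) ≅ Mor.mk (fiberHom φ.hom (e i))) := by
      rw [hw i]
      exact hg (e i)
    let α (i : w.Pos) := (hφ i).some
    let β : ((extensionMor k).obj w).left.obj.carrier ≃ φ.left.obj.carrier :=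
      (Equiv.sigmaCongr e fun i => wideEquiv (Comma.leftIso (α i))).trans
        (Equiv.sigmaFiberEquiv φ.hom.hom.toFun)
    refine ⟨w, ⟨morIso (φ := (extensionMor k).obj w) β ((ε w).trans e) ?_ ?_⟩⟩
    · rintro ⟨i, x⟩
      exact (wideEquiv (Comma.leftIso (α i)) x).2.symm
    · rintro ⟨i, x⟩ ⟨j, y⟩
      constructor
      · intro h
        obtain rfl : i = j := h.fst_eq
        exact (mor_iso_lt (α i) x y).1 (sigmaLt_mk_iff.1 h)
      · intro h
        obtain rfl : i = j := e.injective ((wideEquiv (Comma.leftIso (α i)) x).2.symm.trans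
          ((φ.hom.hom.fiber h).trans (wideEquiv (Comma.leftIso (α j)) y).2))
        exact sigmaLt_mk_iff.2 ((mor_iso_lt (α i) x y).2 h)⟩
  refine Core.functorToCore_isEquivalence _ fun {w w'} e => ?_
  let p : w.Pos ≃ w'.Pos := (ε w).symm.trans ((wideEquiv (Comma.rightIso e)).trans (ε w'))
  -- The square makes the source bijection lie over `p`, so it splits into bijections of fibers;
  -- these preserve the orders and lift by `hfull`.
  obtain ⟨F, hF⟩ := Equiv.exists_sigma_congr p (wideEquiv (Comma.leftIso e)) fun q => by
    have := congrArg (ε w') (mor_iso_apply e q)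
    exact this.symm.trans (congrArg (fun x => ε w' (wideEquiv (Comma.rightIso e) x))
      ((ε w).symm_apply_apply _).symm)
  have hα (i : w.Pos) : ∃ f : w.letter i ⟶ w'.letter (p i),
      ∀ x, (k.map f).left.hom.toFun x = F i x := by
    obtain ⟨f, hf⟩ := hfull (morIso (φ := k.obj (w.letter i)) (ψ := k.obj (w'.letter (p i)))
      (F i) (Equiv.ofUnique _ _) (fun _ => Subsingleton.elim _ _) fun x y =>
        sigmaLt_mk_iff.symm.trans ((mor_iso_lt e ⟨i, x⟩ ⟨i, y⟩).trans
          ((iff_of_eq (congrArg₂ (extensionHom k w').hom.lt (hF i x) (hF i y))).trans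
            sigmaLt_mk_iff)))
    exact ⟨f, fun x => by rw [hf]; rfl⟩
  choose f hf using hα
  refine ⟨⟨p, f⟩, mor_hom_ext_of_isIso (fun ⟨i, x⟩ => ?_) fun q => (ε w').injective ?_⟩
  · exact (congrArg (Sigma.mk (p i)) (hf i x)).trans (hF i x).symm
  · obtain ⟨i, rfl⟩ := (ε w).symm.surjective q
    rfl

end

end NCSet

/-! ### Transport along symmetric monoidal equivalences, and smallness -/

theorem CategoryTheory.Functor.preimage_comp_eq {C : Type u₁} [Category.{v₁} C] {D : Type u₂}
    [Category.{v₂} D] (Ψ : C ⥤ D) [Ψ.IsEquivalence] {X Y X' Y' : C} {φ : X ⟶ Y} {ψ : X' ⟶ Y'}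
    {l : Ψ.obj X ⟶ Ψ.obj X'} {r : Ψ.obj Y ⟶ Ψ.obj Y'} (h : l ≫ Ψ.map ψ = Ψ.map φ ≫ r) :
    Ψ.preimage l ≫ ψ = φ ≫ Ψ.preimage r :=
  Ψ.map_injective (by simpa using h)

section MorMap

variable {C : Type u₁} [Category.{v₁} C] {D : Type u₂} [Category.{v₂} D] (Ψ : C ⥤ D)

/-- The functor induced on morphisms and commutative squares. -/
def Mor.map : Mor C ⥤ Mor D where
  obj φ := Mor.mk (Ψ.map φ.hom)
  map f :=
    { left := Ψ.map f.left
      right := Ψ.map f.right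
      w := (Ψ.map_comp _ _).symm.trans ((congrArg Ψ.map f.w).trans (Ψ.map_comp _ _)) }
  map_id φ := Comma.hom_ext _ _ (Ψ.map_id φ.left) (Ψ.map_id φ.right)
  map_comp f g := Comma.hom_ext _ _ (Ψ.map_comp f.left g.left) (Ψ.map_comp f.right g.right)

instance [Ψ.IsEquivalence] : (Mor.map Ψ).IsEquivalence where
  faithful := ⟨fun h => Comma.hom_ext _ _ (Ψ.map_injective (congrArg CommaMorphism.left h))
    (Ψ.map_injective (congrArg CommaMorphism.right h))⟩
  full := ⟨fun {φ ψ} f => ⟨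
    { left := Ψ.preimage f.left
      right := Ψ.preimage f.right
      w := Ψ.preimage_comp_eq f.w },
    Comma.hom_ext _ _ (Ψ.map_preimage _) (Ψ.map_preimage _)⟩⟩
  essSurj := ⟨fun φ => ⟨Mor.mk (Ψ.preimage ((Ψ.objObjPreimageIso φ.left).hom ≫ φ.hom ≫
      (Ψ.objObjPreimageIso φ.right).inv)),
    ⟨Mor.sd (φ' := φ.hom) (Ψ.objObjPreimageIso φ.left) (Ψ.objObjPreimageIso φ.right)
      (by simp)⟩⟩⟩

variable [MonoidalCategory C] [MonoidalCategory D]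

open Functor in
/-- The functor `Mor.map Ψ` is monoidal. -/
def Mor.mapCore [Ψ.Monoidal] : (Mor.map Ψ).CoreMonoidal where
  εIso := Mor.sd (φ' := Ψ.map (𝟙 (𝟙_ C))) (Monoidal.εIso Ψ) (Monoidal.εIso Ψ) (by simp)
  μIso φ ψ := Mor.sd (φ := Ψ.map φ.hom ⊗ₘ Ψ.map ψ.hom) (φ' := Ψ.map (φ.hom ⊗ₘ ψ.hom))
    (Monoidal.μIso Ψ _ _) (Monoidal.μIso Ψ _ _) (LaxMonoidal.μ_natural Ψ φ.hom ψ.hom)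
  μIso_hom_natural_left f φ := Comma.hom_ext _ _
    (LaxMonoidal.μ_natural_left Ψ f.left φ.left) (LaxMonoidal.μ_natural_left Ψ f.right φ.right)
  μIso_hom_natural_right φ f := Comma.hom_ext _ _
    (LaxMonoidal.μ_natural_right Ψ φ.left f.left) (LaxMonoidal.μ_natural_right Ψ φ.right f.right)
  associativity φ ψ χ := Comma.hom_ext _ _ (LaxMonoidal.associativity Ψ φ.left ψ.left χ.left)
    (LaxMonoidal.associativity Ψ φ.right ψ.right χ.right)
  left_unitality φ := Comma.hom_ext _ _ (LaxMonoidal.left_unitality Ψ φ.left)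
    (LaxMonoidal.left_unitality Ψ φ.right)
  right_unitality φ := Comma.hom_ext _ _ (LaxMonoidal.right_unitality Ψ φ.left)
    (LaxMonoidal.right_unitality Ψ φ.right)

instance [SymmetricCategory C] [SymmetricCategory D] [Ψ.Braided] : (Mor.map Ψ).Braided where
  __ := (Mor.mapCore Ψ).toMonoidal
  braided φ ψ := Comma.hom_ext _ _ (Functor.LaxBraided.braided (F := Ψ) φ.left ψ.left)
    (Functor.LaxBraided.braided (F := Ψ) φ.right ψ.right)

end MorMap

/-- The symmetric monoidal extension of `k`, followed by `Ψ`, extends `k'`; on cores this composes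
two equivalences. -/
theorem FreelyGeneratesIsos.of_equivalence {G : Type u₁} [Groupoid.{v₁} G]
    {C : Type u₂} [Category.{v₂} C] [MonoidalCategory C] [SymmetricCategory C]
    {D : Type u₃} [Category.{v₃} D] [MonoidalCategory D] [SymmetricCategory D] {k : G ⥤ C}
    (h : FreelyGeneratesIsos k) (Ψ : C ⥤ D) [Ψ.Braided] [Ψ.IsEquivalence] {k' : G ⥤ D}
    (i : k ⋙ Ψ ≅ k') : FreelyGeneratesIsos k' := by
  obtain ⟨E, _, ⟨j⟩, _⟩ := h
  refine ⟨E ⋙ Ψ, inferInstance, ⟨Functor.isoWhiskerRight j Ψ ≪≫ i⟩, ?_⟩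
  have : Ψ.core.IsEquivalence := Ψ.asEquivalence.core.isEquivalence_functor
  rw [Core.functorToCore_comp_right]
  infer_instance

namespace NCSet

theorem wide_hom_eq_of_unique {P : MorphismProperty NCSet} [P.IsStableUnderBraiding]
    {S T : WideSubcategory P} (hT : Nonempty (Unique T.obj.carrier))
    {f g : S ⟶ T} [hf : IsIso f] [IsIso g] : f = g :=
  have := hT.some
  wide_hom_ext_of_isIso fun _ => Subsingleton.elim _ _

section

variable {P : MorphismProperty NCSet} [IsFiberwise P] [P.IsStableUnderBraiding]

instance : EssentiallySmall.{0} (WideSubcategory P) := by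
  -- The sets `Fin n` already represent all isomorphism classes.
  let F : InducedCategory (WideSubcategory P) (fun n : ℕ => ⟨⟨Fin n⟩⟩) ⥤ WideSubcategory P :=
    inducedFunctor _
  have : F.EssSurj := ⟨fun S => by
    obtain ⟨n, ⟨e⟩⟩ := Finite.exists_equiv_fin S.obj.carrier
    exact ⟨n, ⟨wideIso P (S := ⟨⟨Fin n⟩⟩) e.symm⟩⟩⟩
  have : F.Full := inferInstanceAs (inducedFunctor _).Full
  have : F.Faithful := inferInstanceAs (inducedFunctor _).Faithful
  have : F.IsEquivalence := {}
  have : EssentiallySmall.{0} (InducedCategory (WideSubcategory P)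
      (fun n : ℕ => (⟨⟨Fin n⟩⟩ : WideSubcategory P))) := essentiallySmallSelf _
  exact (essentiallySmall_congr F.asEquivalence).1 this

end

end NCSet

/-! ### A criterion for Feynman categories -/

namespace FeynmanTriple

open NCSet

section

variable {P : MorphismProperty NCSet} [IsFiberwise P] [P.IsStableUnderBraiding]

/-- A triple whose groupoid is equivalent to the trivial one is a Feynman category if its symmetric
monoidal category is that of finite sets and a fiberwise class of maps with orders on the fibers,
with the objects of the groupoid corresponding to the one-element sets. -/
theorem isFeynman_of_wide (𝔉 : FeynmanTriple.{v₁, 0, u₁, u₂}) (Ψ : WideSubcategory P ⥤ 𝔉.F)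
    [Ψ.Braided] [Ψ.IsEquivalence] [Nonempty 𝔉.V]
    (hV : ∀ v v' : 𝔉.V, Nonempty (Unique (v ⟶ v')))
    (hι : ∀ v, ∃ S : WideSubcategory P, Nonempty (Unique S.obj.carrier) ∧
      Nonempty (𝔉.ι.obj v ≅ Ψ.obj S)) : 𝔉.IsFeynman := by
  have (v v' : 𝔉.V) : Unique (v ⟶ v') := (hV v v').some
  -- Sets corresponding to objects of the groupoid have one element, whichever representative is
  -- chosen.
  have hpre (S : WideSubcategory P) {v : 𝔉.V} (e : Ψ.obj S ≅ 𝔉.ι.obj v) :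
      Nonempty (Unique S.obj.carrier) := by
    obtain ⟨T, ⟨hT⟩, ⟨a⟩⟩ := hι v
    exact ⟨(wideEquiv (Ψ.preimageIso (e ≪≫ a))).unique⟩
  -- Read through `Ψ`, these are isomorphisms of one-element sets, so they coincide; nothing is
  -- assumed about `ι` on morphisms.
  have hiso {v v' : 𝔉.V} (f g : 𝔉.ι.obj v ≅ 𝔉.ι.obj v') : f.hom = g.hom := by
    obtain ⟨S, hS, ⟨a⟩⟩ := hι v
    obtain ⟨T, hT, ⟨b⟩⟩ := hι v'
    have h : (Ψ.preimageIso (a.symm ≪≫ f ≪≫ b)).hom = (Ψ.preimageIso (a.symm ≪≫ g ≪≫ b)).hom :=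
      wide_hom_eq_of_unique hT
    have h' := congrArg Ψ.map h
    simpa using h'
  refine ⟨?_, ?_, fun v => ?_⟩
  -- The inverse of `Ψ` brings the functor to finite sets, where the criterion applies; the result
  -- returns along `Ψ`.
  · refine (freelyGeneratesIsos_of_unique hV (𝔉.ι ⋙ Ψ.inv) fun v => ?_).of_equivalence Ψ
      (Functor.isoWhiskerLeft 𝔉.ι Ψ.asEquivalence.counitIso)
    exact hpre _ (Ψ.asEquivalence.counitIso.app (𝔉.ι.obj v))
  · let M := Mor.map Ψ
    have : 𝔉.basicToMor.Faithful := ⟨fun {g g' f f'} h => CoreHom.ext (Iso.ext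
      (Comma.hom_ext _ _ (congrArg (fun f : 𝔉.basicToMor.obj g ⟶ 𝔉.basicToMor.obj g' =>
        f.left) h) (Subsingleton.elim _ _)))⟩
    refine (freelyGeneratesIsos_of_mor (𝔉.basicToMor ⋙ M.inv) ?_ ?_ ?_).of_equivalence M
      (Functor.isoWhiskerLeft 𝔉.basicToMor M.asEquivalence.counitIso)
    · intro g g' e
      let e' : 𝔉.basicToMor.obj g ≅ 𝔉.basicToMor.obj g' := M.inv.preimageIso e
      let l : g.of.left ≅ g'.of.left :=
        (Comma.leftIso e' : (𝔉.basicToMor.obj g).left ≅ (𝔉.basicToMor.obj g').left)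
      -- The groupoid provides exactly one candidate for the target component, and `hiso` identifies
      -- its image with that of `e'`.
      let r : g.of.right ≅ g'.of.right := (Groupoid.isoEquivHom _ _).symm default
      let f : g.of ≅ g'.of := Comma.isoMk l r (by
        have h : e'.hom.left ≫ g'.of.hom = g.of.hom ≫ e'.hom.right := e'.hom.w
        have hr : e'.hom.right = 𝔉.ι.map r.hom := hiso (Comma.rightIso e') (𝔉.ι.mapIso r)
        rw [hr] at h
        exact h)
      refine ⟨⟨f⟩, ?_⟩
      have : 𝔉.basicToMor.map (⟨f⟩ : g ⟶ g') = e'.hom := Comma.hom_ext _ _ rfl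
        (hiso (𝔉.ι.mapIso r) (Comma.rightIso e'))
      exact (congrArg M.inv.map this).trans (M.inv.map_preimage _)
    · intro g
      exact hpre _ (Comma.rightIso (M.asEquivalence.counitIso.app (𝔉.basicToMor.obj g)))
    · rintro φ ⟨hφ⟩
      obtain ⟨S, ⟨hS⟩, ⟨a⟩⟩ := hι (Classical.arbitrary 𝔉.V)
      -- Replacing the one-point target by the image of an object of the groupoid makes `φ` basic.
      let b : Ψ.obj φ.right ≅ 𝔉.ι.obj (Classical.arbitrary 𝔉.V) :=
        Ψ.mapIso (wideIso P (Equiv.ofUnique _ _)) ≪≫ a.symm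
      let g : Core 𝔉.Basic := ⟨Comma.mk (L := 𝟭 𝔉.F) (R := 𝔉.ι) (Ψ.obj φ.left) _
        (Ψ.map φ.hom ≫ b.hom)⟩
      let c : 𝔉.basicToMor.obj g ≅ M.obj φ := Mor.sd (φ := Ψ.map φ.hom ≫ b.hom)
        (φ' := Ψ.map φ.hom) (Iso.refl _) b.symm (by simp)
      exact ⟨g, ⟨M.preimageIso (M.asEquivalence.counitIso.app _ ≪≫ c)⟩⟩
  · have : EssentiallySmall.{0} 𝔉.F := (essentiallySmall_congr Ψ.asEquivalence).1 inferInstance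
    exact inferInstanceAs (EssentiallySmall.{0} (CostructuredArrow (𝟭 𝔉.F) (𝔉.ι.obj v)))

end

end FeynmanTriple

/-! ### The four Feynman categories and the two equivalences -/

theorem CategoryTheory.Functor.nonempty_inv_braided {C : Type u₁} [Category.{v₁} C]
    [MonoidalCategory C] [BraidedCategory C] {D : Type u₂} [Category.{v₂} D] [MonoidalCategory D]
    [BraidedCategory D] (Ψ : C ⥤ D) [h : Ψ.Braided] [Ψ.IsEquivalence] : Nonempty Ψ.inv.Braided :=
  Equivalence.nonempty_inverse_braided (h := h) Ψ.asEquivalence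

namespace NCSet

instance : (⊤ : MorphismProperty NCSet).IsStableUnderBraiding where
  whiskerLeft _ _ _ _ _ := trivial
  whiskerRight _ _ _ := trivial
  associator_hom_mem _ _ _ := trivial
  associator_inv_mem _ _ _ := trivial
  leftUnitor_hom_mem _ := trivial
  leftUnitor_inv_mem _ := trivial
  rightUnitor_hom_mem _ := trivial
  rightUnitor_inv_mem _ := trivial
  braiding_hom_mem _ _ := trivial
  braiding_inv_mem _ _ := trivial

/-- The inclusion of the wide subcategory of all morphisms. -/
abbrev topInclusion : WideSubcategory (⊤ : MorphismProperty NCSet) ⥤ NCSet :=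
  wideSubcategoryInclusion ⊤

instance : topInclusion.IsEquivalence where
  full := ⟨fun f => ⟨⟨f, trivial⟩, rfl⟩⟩
  essSurj := ⟨fun S => ⟨⟨S⟩, ⟨Iso.refl S⟩⟩⟩

/-- The compatibility of the inclusion with units. -/
def topInclusionUnit : 𝟙_ NCSet ≅ topInclusion.obj (𝟙_ (WideSubcategory ⊤)) := Iso.refl _

/-- The compatibility of the inclusion with tensor products. -/
def topInclusionTensor (S T : WideSubcategory (⊤ : MorphismProperty NCSet)) :
    topInclusion.obj S ⊗ topInclusion.obj T ≅ topInclusion.obj (S ⊗ T) := Iso.refl _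

/-- The inclusion of the wide subcategory of all morphisms is strictly monoidal. -/
def topInclusionCore : topInclusion.CoreMonoidal where
  εIso := topInclusionUnit
  μIso := topInclusionTensor
  μIso_hom_natural_left _ _ := (Category.comp_id _).trans (Category.id_comp _).symm
  μIso_hom_natural_right _ _ := (Category.comp_id _).trans (Category.id_comp _).symm
  associativity _ _ _ := hom_ext_of_isIso (by rintro ((i | i) | i) <;> rfl)
  left_unitality _ := hom_ext_of_isIso (by rintro (i | i); exacts [i.elim, rfl])
  right_unitality _ := hom_ext_of_isIso (by rintro (i | i); exacts [rfl, i.elim])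

instance : topInclusion.Braided where
  __ := topInclusionCore.toMonoidal
  braided _ _ := hom_ext_of_isIso (by rintro (i | i) <;> rfl)

end NCSet

namespace FeynmanTriple

theorem mk_isFeynman_of_wide {P : MorphismProperty NCSet} [NCSet.IsFiberwise P]
    [P.IsStableUnderBraiding] {V : Type u₁} [Groupoid.{v₁} V] {F : Type u₂} [Category.{0} F]
    [MonoidalCategory F] [SymmetricCategory F] (ι : V ⥤ F) (Ψ : WideSubcategory P ⥤ F)
    [Ψ.Braided] [Ψ.IsEquivalence] [Nonempty V] (hV : ∀ v v' : V, Nonempty (Unique (v ⟶ v')))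
    (hι : ∀ v, ∃ S : WideSubcategory P, Nonempty (Unique S.obj.carrier) ∧
      Nonempty (ι.obj v ≅ Ψ.obj S)) : (FeynmanTriple.mk V F ι).IsFeynman :=
  isFeynman_of_wide (FeynmanTriple.mk V F ι) Ψ hV hι

theorem discrete_unique (v v' : Discrete PUnit.{1}) : Nonempty (Unique (v ⟶ v')) :=
  ⟨⟨⟨eqToHom (Subsingleton.elim _ _)⟩, fun _ => Subsingleton.elim _ _⟩⟩

end FeynmanTriple

theorem NCSet.isFeynman : NCSet.feynman.IsFeynman :=
  FeynmanTriple.mk_isFeynman_of_wide _ topInclusion FeynmanTriple.discrete_unique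
    fun _ => ⟨⟨⟨PUnit⟩⟩, ⟨inferInstanceAs (Unique PUnit)⟩, ⟨Iso.refl (⟨PUnit⟩ : NCSet)⟩⟩

theorem FSOrd.isFeynman : FSOrd.feynman.IsFeynman :=
  FeynmanTriple.mk_isFeynman_of_wide _ (𝟭 FSOrd) FeynmanTriple.discrete_unique
    fun _ => ⟨⟨⟨PUnit⟩⟩, ⟨inferInstanceAs (Unique PUnit)⟩, ⟨Iso.refl (⟨⟨PUnit⟩⟩ : FSOrd)⟩⟩

namespace FeynmanTriple

instance : Nonempty (Core triv.Basic) :=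
  ⟨⟨Comma.mk (L := 𝟭 triv.F) (R := triv.ι) (triv.ι.obj ⟨⟨⟩⟩) ⟨⟨⟩⟩ (𝟙 _)⟩⟩

/-- All morphisms of words are invertible, so the square determines a source component from the
unique target component; uniqueness holds because the source has one position. -/
theorem triv_basic_unique (φ ψ : Core triv.Basic) : Nonempty (Unique (φ ⟶ ψ)) := by
  let r : φ.of.right ≅ ψ.of.right := eqToIso (Subsingleton.elim (α := Discrete PUnit) _ _)
  have (w w' : triv.F) (f : w ⟶ w') : IsIso f :=
    @IsIso.of_groupoid (FreeSym (Discrete PUnit.{1})) _ w w' f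
  let l : φ.of.left ≅ ψ.of.left :=
    asIso (C := triv.F) (φ.of.hom ≫ triv.ι.map r.hom ≫ inv ψ.of.hom)
  have hl : l.hom ≫ ψ.of.hom = φ.of.hom ≫ triv.ι.map r.hom := by
    change (φ.of.hom ≫ triv.ι.map r.hom ≫ inv ψ.of.hom) ≫ ψ.of.hom = _
    simp
  refine ⟨⟨⟨⟨Comma.isoMk l r hl⟩⟩, fun f => CoreHom.ext (Iso.ext (Comma.hom_ext _ _
    (triv_hom_ext fun i => ?_) (Subsingleton.elim (α := (_ : Discrete PUnit) ⟶ _) _ _)))⟩⟩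
  have : Subsingleton (FreeSym.Pos (V := Discrete PUnit.{1}) ψ.of.left) :=
    (trivPerm ψ.of.hom).subsingleton
  exact Subsingleton.elim (α := FreeSym.Pos (V := Discrete PUnit.{1}) ψ.of.left) _ _

/-- The inclusion of the basic morphisms in the plus construction of the trivial Feynman
category. -/
abbrev trivPlusIncl (gcp : Prop) : Core triv.Basic ⥤ PlusObj triv gcp := (triv.plusAux gcp).ι

theorem plusAux_isFeynman {gcp : Prop} (P : MorphismProperty NCSet) [P.IsStableUnderBraiding]
    [NCSet.IsFiberwise P]
    (hP : ∀ {S T : NCSet} (f : S ⟶ T), P f ↔ gcp ∨ Function.Surjective f.toFun) :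
    (triv.plusAux gcp).IsFeynman := by
  have := trivToWide_isEquivalence P hP
  obtain ⟨_⟩ := (trivToWide P hP).nonempty_inv_braided
  -- The criterion takes an equivalence out of finite sets, hence the inverse functor; the unit
  -- isomorphism identifies the objects of the groupoid with one-element sets.
  exact mk_isFeynman_of_wide (trivPlusIncl gcp) (trivToWide P hP).inv triv_basic_unique
    fun φ => ⟨(trivToWide P hP).obj ((trivPlusIncl gcp).obj φ), ⟨(inferInstance : Unique Unit)⟩,
      ⟨(trivToWide P hP).asEquivalence.unitIso.app ((trivPlusIncl gcp).obj φ)⟩⟩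

theorem const_isEquivalence : ((Functor.const (Core triv.Basic)).obj
    (⟨⟨⟩⟩ : Discrete PUnit.{1})).IsEquivalence :=
  have (φ ψ : Core triv.Basic) : Unique (φ ⟶ ψ) := (triv_basic_unique φ ψ).some
  { faithful := ⟨fun _ => Subsingleton.elim _ _⟩
    full := ⟨fun _ => ⟨default, Subsingleton.elim _ _⟩⟩
    essSurj := ⟨fun _ => ⟨Classical.arbitrary _, ⟨eqToIso (Subsingleton.elim _ _)⟩⟩⟩ }

theorem mk_equivalent {V : Type u₁} [Groupoid.{v₁} V] {F : Type u₂} [Category.{v₂} F]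
    [MonoidalCategory F] [SymmetricCategory F] {V' : Type u₃} [Groupoid.{v₃} V'] {F' : Type u₄}
    [Category.{v₄} F'] [MonoidalCategory F'] [SymmetricCategory F'] {ι : V ⥤ F} {ι' : V' ⥤ F'}
    (v : V ⥤ V') (f : F ⥤ F') [h : f.Braided] (hv : v.IsEquivalence) (hf : f.IsEquivalence)
    (comm : ι ⋙ f = v ⋙ ι') : (FeynmanTriple.mk V F ι).Equivalent (FeynmanTriple.mk V' F' ι') :=
  ⟨⟨v, f, h, comm⟩, hv, hf⟩

/-- Compatibility with the inclusions holds strictly: a basic morphism has definitionally a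
one-point set of positions, and isomorphisms between one-point sets are unique. -/
theorem plus_equivalent : triv.plus.Equivalent FSOrd.feynman :=
  have hP {S T : NCSet} (f : S ⟶ T) : NCSet.surj f ↔ False ∨ Function.Surjective f.toFun :=
    (false_or _).to_iff.symm
  mk_equivalent (ι := trivPlusIncl False) _ (trivToWide NCSet.surj hP) const_isEquivalence
    (trivToWide_isEquivalence _ hP) (Functor.hext (fun _ => rfl) fun _ _ f => heq_of_eq
      (NCSet.wide_hom_eq_of_unique (P := NCSet.surj) (S := ⟨⟨PUnit⟩⟩) (T := ⟨⟨PUnit⟩⟩)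
        ⟨inferInstanceAs (Unique PUnit)⟩
        (hf := Functor.map_isIso (trivPlusIncl False ⋙ trivToWide NCSet.surj hP) f)
        (g := 𝟙 _)))

theorem plusGcp_equivalent : triv.plusGcp.Equivalent NCSet.feynman :=
  have hP {S T : NCSet} (f : S ⟶ T) : (⊤ : MorphismProperty NCSet) f ↔
    True ∨ Function.Surjective f.toFun := iff_of_true trivial (Or.inl trivial)
  have := trivToWide_isEquivalence _ hP
  mk_equivalent (ι := trivPlusIncl True) _ (trivToWide ⊤ hP ⋙ NCSet.topInclusion)
    const_isEquivalence inferInstance (Functor.hext (fun _ => rfl) fun _ _ f => heq_of_eq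
      (NCSet.hom_ext_of_isIso (S := ⟨PUnit⟩) (T := ⟨PUnit⟩)
        (hf := Functor.map_isIso (trivPlusIncl True ⋙ trivToWide ⊤ hP ⋙ NCSet.topInclusion) f)
        (g := 𝟙 _) fun _ => rfl))

end FeynmanTriple

theorem mainTheorem5 :
    FeynmanTriple.triv.plus.IsFeynman ∧ FSOrd.feynman.IsFeynman ∧
    FeynmanTriple.triv.plus.Equivalent FSOrd.feynman ∧
    FeynmanTriple.triv.plusGcp.IsFeynman ∧ NCSet.feynman.IsFeynman ∧
    FeynmanTriple.triv.plusGcp.Equivalent NCSet.feynman :=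
  ⟨FeynmanTriple.plusAux_isFeynman NCSet.surj fun _ => (false_or _).to_iff.symm, FSOrd.isFeynman,
    FeynmanTriple.plus_equivalent,
    FeynmanTriple.plusAux_isFeynman ⊤ fun _ => iff_of_true trivial (Or.inl trivial),
    NCSet.isFeynman, FeynmanTriple.plusGcp_equivalent⟩
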